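/- Let $X$ be a smooth projective (irreducible) threefold over $\mathbb{C}$. A codimension $r$ distribution $\mathcal{D}$ on $X$ is an exact sequence $0\to T_{\mathcal{D}}\to TX\to N_{\mathcal{D}}\to 0$ with $T_{\mathcal{D}}$ reflexive of rank $3-r$ and $N_{\mathcal{D}}$ torsion free. Its singular scheme $\mathrm{Sing}(\mathcal{D})$ is the closed subscheme whose ideal sheaf, twisted by $\det(T_{\mathcal{D}})^\vee$, is the image of the natural morphism $\Omega_X^{3-r}\to\det(T_{\mathcal{D}})^\vee$. For $W=\mathrm{Sing}(\mathcal{D})$ of dimension at most one, let $\mathcal{U}\subset\mathcal{O}_W$ be the maximal $0$-dimensional subsheaf; $\mathrm{Sing}_1(\mathcal{D})$ is the subscheme with structure sheaf $\mathcal{O}_W/\mathcal{U}$, and $\mathrm{Sing}_0(\mathcal{D})$ is the support of $\mathcal{U}$. Let $\mathcal{F}$ be a codimension one distribution on $X$ that is generic, i.e. $\mathrm{Sing}(\mathcal{F})$ is empty or $0$-dimensional. Let $\mathcal{L}$ be a line bundle on $X$, and let $\sigma\in H^0(T_{\mathcal{F}}\otimes\mathcal{L}^\vee)=\mathrm{Hom}(\mathcal{L},T_{\mathcal{F}})$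 be a section whose zero scheme $Y$ (defined by the image ideal of $T_{\mathcal{F}}^\vee\otimes\mathcal{L}\to\mathcal{O}_X$) is a possibly empty curve, i.e. $\dim Y\le 1$. Let $\mathcal{G}$ be the subfoliation of $\mathcal{F}$ induced by $\sigma$, i.e. the codimension two distribution with tangent sheaf $T_{\mathcal{G}}=\mathcal{L}\xrightarrow{\ \sigma\ }T_{\mathcal{F}}\subset TX$. Then $Y=\mathrm{Sing}_1(\mathcal{G})$ as subschemes of $X$, and $\mathrm{Sing}_0(\mathcal{G})=\emptyset$. If, in addition, $H^1(X,\mathcal{L}^\vee\otimes\det\Omega^1_X\otimes\det(T_{\mathcal{F}})^{\otimes 2})=0$, then there is a codimension one distribution $\mathcal{H}$ on $X$ such that $\mathcal{G}$ is the intersection of $\mathcal{F}$ and $\mathcal{H}$, i.e. $T_{\mathcal{G}}=T_{\mathcal{F}}\cap T_{\mathcal{H}}$ in $TX$, and $\det(N_{\mathcal{H}})\cong\det(T_{\mathcal{F}}/T_{\mathcal{G}})$. -/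

import Mathlib

open CategoryTheory AlgebraicGeometry TopologicalSpace Opposite

noncomputable section

namespace Foliated

/-- The restriction map of the structure sheaf, for `W ≤ V`. -/
def resO {X : Scheme.{0}} {W V : X.Opens} (h : W ≤ V) : Γ(X, V) →+* Γ(X, W) :=
  (X.presheaf.map (homOfLE h).op).hom

/-- The restriction map of a sheaf of modules, for `W ≤ V`. -/
def resM {X : Scheme.{0}} (M : X.Modules) {W V : X.Opens} (h : W ≤ V) : Γ(M, V) →+ Γ(M, W) :=
  (M.presheaf.map (homOfLE h).op).hom

section Restriction

variable {X : Scheme.{0}} {U V W : X.Opens}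

theorem resO_resO (hWV : W ≤ V) (hVU : V ≤ U) (a : Γ(X, U)) :
    resO hWV (resO hVU a) = resO (hWV.trans hVU) a := by
  simp only [resO]
  rw [← CommRingCat.comp_apply, ← Functor.map_comp]
  rfl

theorem resM_resM (M : X.Modules) (hWV : W ≤ V) (hVU : V ≤ U) (m : Γ(M, U)) :
    resM M hWV (resM M hVU m) = resM M (hWV.trans hVU) m := by
  simp only [resM]
  rw [← AddCommGrpCat.comp_apply, ← Functor.map_comp]
  rfl

theorem resM_smul (M : X.Modules) (hWV : W ≤ V) (a : Γ(X, V)) (m : Γ(M, V)) :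
    resM M hWV (a • m) = resO hWV a • resM M hWV m :=
  Scheme.Modules.map_smul M (homOfLE hWV) a m

theorem resO_ext {a b : Γ(X, V)}
    (h : ∀ x ∈ V, ∃ (W : X.Opens) (hWV : W ≤ V), x ∈ W ∧ resO hWV a = resO hWV b) : a = b := by
  choose W hW hx he using h
  refine TopCat.Sheaf.eq_of_locally_eq' X.sheaf (fun x : V => W x.1 x.2) V
    (fun x => homOfLE (hW x.1 x.2)) ?_ a b ?_
  · intro x hxV
    exact Opens.mem_iSup.mpr ⟨⟨x, hxV⟩, hx x hxV⟩
  · intro x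
    exact he x.1 x.2

theorem resO_glue {ι : Type} (W : ι → X.Opens) (hW : ∀ i, W i ≤ V) (hc : V ≤ iSup W)
    (a : ∀ i, Γ(X, W i))
    (h : ∀ i j, resO (inf_le_left : W i ⊓ W j ≤ W i) (a i) = resO inf_le_right (a j)) :
    ∃ b : Γ(X, V), ∀ i, resO (hW i) b = a i := by
  obtain ⟨b, hb, -⟩ := TopCat.Sheaf.existsUnique_gluing' X.sheaf W V
    (fun i => homOfLE (hW i)) hc a h
  exact ⟨b, hb⟩

end Restriction

/-- A local class of `𝒪_X`-valued operations: a presheaf of sets `V ↦ S V` and, for each open `V`,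
a `Γ(X, V)`-module `P V` of maps `S V → Γ(X, V)`, such that membership in `P` can be checked
locally. -/
structure LocalOps (X : Scheme.{0}) where
  S : X.Opens → Type
  res : ∀ {W V : X.Opens}, W ≤ V → S V → S W
  res_res : ∀ {W V U : X.Opens} (hWV : W ≤ V) (hVU : V ≤ U) (s : S U),
    res hWV (res hVU s) = res (hWV.trans hVU) s
  P : ∀ V : X.Opens, Submodule Γ(X, V) (S V → Γ(X, V))
  isLocal : ∀ (V : X.Opens) (g : S V → Γ(X, V)),
    (∀ x ∈ V, ∃ (W : X.Opens) (hWV : W ≤ V), x ∈ W ∧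
      ∃ h ∈ P W, ∀ s, resO hWV (g s) = h (res hWV s)) → g ∈ P V

namespace LocalOps

variable {X : Scheme.{0}} (D : LocalOps X)

/-- A section over `U` of the sheaf of operations `D`: a family of operations over all open
`V ≤ U`, compatible with restriction. -/
@[ext]
structure Sec (U : X.Opens) where
  fn : ∀ V : X.Opens, V ≤ U → D.S V → Γ(X, V)
  mem : ∀ V h, fn V h ∈ D.P V
  compat : ∀ {W V : X.Opens} (hWV : W ≤ V) (hVU : V ≤ U) (s : D.S V),
    resO hWV (fn V hVU s) = fn W (hWV.trans hVU) (D.res hWV s)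

namespace Sec

variable {D} {U : X.Opens}

instance : Zero (D.Sec U) :=
  ⟨⟨fun _ _ => 0, fun V _ => (D.P V).zero_mem, by intros; simp⟩⟩

instance : Add (D.Sec U) :=
  ⟨fun a b => ⟨fun V h => a.fn V h + b.fn V h,
    fun V h => (D.P V).add_mem (a.mem V h) (b.mem V h), by
      intros; simp [a.compat, b.compat]⟩⟩

instance : Neg (D.Sec U) :=
  ⟨fun a => ⟨fun V h => - a.fn V h, fun V h => (D.P V).neg_mem (a.mem V h), by
      intros; simp [a.compat]⟩⟩

instance : SMul Γ(X, U) (D.Sec U) :=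
  ⟨fun r a => ⟨fun V h => resO h r • a.fn V h, fun V h => (D.P V).smul_mem _ (a.mem V h), by
      intros; simp [a.compat, resO_resO]⟩⟩

@[simp] theorem zero_fn (V : X.Opens) (h : V ≤ U) : (0 : D.Sec U).fn V h = 0 := rfl
@[simp] theorem add_fn (a b : D.Sec U) (V : X.Opens) (h : V ≤ U) :
    (a + b).fn V h = a.fn V h + b.fn V h := rfl
@[simp] theorem neg_fn (a : D.Sec U) (V : X.Opens) (h : V ≤ U) : (-a).fn V h = - a.fn V h := rfl
@[simp] theorem smul_fn (r : Γ(X, U)) (a : D.Sec U) (V : X.Opens) (h : V ≤ U) :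
    (r • a).fn V h = resO h r • a.fn V h := rfl

instance : AddCommGroup (D.Sec U) where
  add_assoc a b c := by ext; simp [add_assoc]
  zero_add a := by ext; simp
  add_zero a := by ext; simp
  add_comm a b := by ext; simp [add_comm]
  neg_add_cancel a := by ext; simp
  nsmul := nsmulRec
  zsmul := zsmulRec

instance : Module Γ(X, U) (D.Sec U) where
  one_smul a := by ext; simp
  mul_smul r s a := by ext; simp [mul_assoc]
  smul_zero r := by ext; simp
  smul_add r a b := by ext; simp [mul_add]
  add_smul r s a := by ext; simp [add_mul]
  zero_smul a := by ext; simp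

/-- Restriction of sections. -/
def restrict {W : X.Opens} (hWU : W ≤ U) : D.Sec U →+ D.Sec W where
  toFun a := ⟨fun V h => a.fn V (h.trans hWU), fun V _ => a.mem V _,
    fun hWV hVU s => a.compat hWV (hVU.trans hWU) s⟩
  map_zero' := rfl
  map_add' _ _ := rfl

end Sec

/-- The presheaf of abelian groups of sections. -/
def presheaf : TopCat.Presheaf Ab X where
  obj U := AddCommGrpCat.of (D.Sec U.unop)
  map i := AddCommGrpCat.ofHom (Sec.restrict i.unop.le)
  map_id _ := rfl
  map_comp _ _ := rfl

theorem presheaf_isSheaf : D.presheaf.IsSheaf := by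
  rw [TopCat.Presheaf.isSheaf_iff_isSheafUniqueGluing]
  intro ι U sf hsf
  have hsf' : ∀ (i j : ι) (V : X.Opens) (hi : V ≤ U i) (hj : V ≤ U j) (s : D.S V),
      (sf i).fn V hi s = (sf j).fn V hj s := by
    intro i j V hi hj s
    have := congrArg (fun t : D.Sec (U i ⊓ U j) => t.fn V (le_inf hi hj) s) (hsf i j)
    exact this
  have key : ∀ (V : X.Opens) (hV : V ≤ iSup U) (s : D.S V),
      ∃ b : Γ(X, V), ∀ i, resO (inf_le_left : V ⊓ U i ≤ V) b =
        (sf i).fn (V ⊓ U i) inf_le_right (D.res inf_le_left s) := by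
    intro V hV s
    refine resO_glue (fun i => V ⊓ U i) (fun i => inf_le_left) ?_
      (fun i => (sf i).fn (V ⊓ U i) inf_le_right (D.res inf_le_left s)) ?_
    · rw [← inf_iSup_eq]
      exact le_inf le_rfl hV
    · intro i j
      rw [(sf i).compat, (sf j).compat, D.res_res, D.res_res]
      exact hsf' i j _ _ _ _
  choose b hb using key
  have hb' : ∀ (V : X.Opens) (hV : V ≤ iSup U) (s : D.S V) (i : ι) (W : X.Opens) (hW : W ≤ V)
      (hi : W ≤ U i), resO hW (b V hV s) = (sf i).fn W hi (D.res hW s) := by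
    intro V hV s i W hW hi
    have h1 := congrArg (resO (le_inf hW hi : W ≤ V ⊓ U i)) (hb V hV s i)
    rw [resO_resO, (sf i).compat, D.res_res] at h1
    exact h1
  have cov : ∀ (V : X.Opens), V ≤ iSup U → ∀ x ∈ V, ∃ i, x ∈ V ⊓ U i := by
    intro V hV x hx
    obtain ⟨i, hi⟩ := Opens.mem_iSup.mp (hV hx)
    exact ⟨i, hx, hi⟩
  let t : D.Sec (iSup U) :=
    { fn := b
      mem := by
        intro V hV
        refine D.isLocal V _ fun x hx => ?_
        obtain ⟨i, hi⟩ := cov V hV x hx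
        exact ⟨V ⊓ U i, inf_le_left, hi, _, (sf i).mem _ inf_le_right, fun s => hb V hV s i⟩
      compat := by
        intro W V hWV hVU s
        refine resO_ext fun x hx => ?_
        obtain ⟨i, hi⟩ := cov W (hWV.trans hVU) x hx
        refine ⟨W ⊓ U i, inf_le_left, hi, ?_⟩
        rw [resO_resO, hb' V hVU s i _ (inf_le_left.trans hWV) inf_le_right,
          hb' W _ _ i _ inf_le_left inf_le_right, D.res_res] }
  refine ⟨t, ?_, ?_⟩
  · intro i
    apply Sec.ext
    funext V hV s
    refine resO_ext fun x hx => ⟨V ⊓ U i, inf_le_left, ⟨hx, hV hx⟩, ?_⟩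
    exact (hb V (hV.trans (le_iSup U i)) s i).trans ((sf i).compat inf_le_left hV s).symm
  · intro t' ht'
    apply Sec.ext
    funext V hV s
    refine resO_ext fun x hx => ?_
    obtain ⟨i, hi⟩ := cov V hV x hx
    refine ⟨V ⊓ U i, inf_le_left, hi, ?_⟩
    have h1 : Sec.restrict (le_iSup U i) t' = sf i := ht' i
    have h2 := congrArg (fun r : D.Sec (U i) => r.fn (V ⊓ U i) inf_le_right (D.res inf_le_left s)) h1
    exact (Sec.compat t' inf_le_left hV s).trans (h2.trans (hb V hV s i).symm)

instance (U : X.Opensᵒᵖ) : Module (X.ringCatSheaf.obj.obj U) (D.presheaf.obj U) :=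
  inferInstanceAs (Module Γ(X, U.unop) (D.Sec U.unop))

/-- The sheaf of `𝒪_X`-modules of operations: its sections over `U` are `D.Sec U`. -/
def sheaf : X.Modules where
  val := PresheafOfModules.ofPresheaf D.presheaf (by
    intro U V i r a
    apply Sec.ext
    funext W hW s
    exact congrArg (fun c : Γ(X, W) => c * Sec.fn (U := U.unop) a W (hW.trans i.unop.le) s)
      (resO_resO hW i.unop.le r).symm)
  isSheaf := D.presheaf_isSheaf

end LocalOps

/-- The constants `ℂ → Γ(X, V)` of a scheme over `ℂ`. -/
def cst {X : Scheme.{0}} (f : X ⟶ Spec (.of ℂ)) (V : X.Opens) : ℂ →+* Γ(X, V) :=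
  (resO (le_top : V ≤ ⊤)).comp ((Scheme.ΓSpecIso (.of ℂ)).inv ≫ f.appTop).hom

theorem resO_cst {X : Scheme.{0}} (f : X ⟶ Spec (.of ℂ)) {W V : X.Opens} (h : W ≤ V) (c : ℂ) :
    resO h (cst f V c) = cst f W c :=
  resO_resO h le_top _

/-- `ℂ`-linear derivations of the structure sheaf. -/
def derOps {X : Scheme.{0}} (f : X ⟶ Spec (.of ℂ)) : LocalOps X where
  S V := Γ(X, V)
  res h := resO h
  res_res := resO_resO
  P V :=
    { carrier := {g | (∀ a b, g (a + b) = g a + g b) ∧ (∀ a b, g (a * b) = a * g b + b * g a) ∧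
        ∀ c : ℂ, g (cst f V c) = 0}
      zero_mem' := by simp
      add_mem' := by
        rintro g h ⟨h1, h2, h3⟩ ⟨h4, h5, h6⟩
        refine ⟨fun a b => ?_, fun a b => ?_, fun c => ?_⟩
        · simp only [Pi.add_apply, h1, h4]; ring
        · simp only [Pi.add_apply, h2, h5]; ring
        · simp only [Pi.add_apply, h3, h6, add_zero]
      smul_mem' := by
        rintro r g ⟨h1, h2, h3⟩
        refine ⟨fun a b => ?_, fun a b => ?_, fun c => ?_⟩
        · simp only [Pi.smul_apply, smul_eq_mul, h1]; ring
        · simp only [Pi.smul_apply, smul_eq_mul, h2]; ring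
        · simp only [Pi.smul_apply, h3, smul_zero] }
  isLocal V g H := by
    refine ⟨fun a b => ?_, fun a b => ?_, fun c => ?_⟩ <;>
    · refine resO_ext fun x hx => ?_
      obtain ⟨W, hW, hxW, h, ⟨h1, h2, h3⟩, he⟩ := H x hx
      refine ⟨W, hW, hxW, ?_⟩
      simp only [map_add, map_mul, map_zero, he, h1, h2, h3, resO_cst]

/-- The tangent sheaf `TX` of a smooth scheme over `ℂ`: the sheaf of `ℂ`-linear derivations of
`𝒪_X`. -/
def tangentSheaf {X : Scheme.{0}} (f : X ⟶ Spec (.of ℂ)) : X.Modules := (derOps f).sheaf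

/-- `𝒪_X`-linear maps `M → 𝒪_X`. -/
def linOps {X : Scheme.{0}} (M : X.Modules) : LocalOps X where
  S V := Γ(M, V)
  res h := resM M h
  res_res := resM_resM M
  P V :=
    { carrier := {g | (∀ m n, g (m + n) = g m + g n) ∧ ∀ (a : Γ(X, V)) m, g (a • m) = a * g m}
      zero_mem' := by simp
      add_mem' := by
        rintro g h ⟨h1, h2⟩ ⟨h4, h5⟩
        refine ⟨fun a b => ?_, fun a b => ?_⟩
        · simp only [Pi.add_apply, h1, h4]; ring
        · simp only [Pi.add_apply, h2, h5]; ring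
      smul_mem' := by
        rintro r g ⟨h1, h2⟩
        refine ⟨fun a b => ?_, fun a b => ?_⟩
        · simp only [Pi.smul_apply, smul_eq_mul, h1]; ring
        · simp only [Pi.smul_apply, smul_eq_mul, h2]; ring }
  isLocal V g H := by
    refine ⟨fun a b => ?_, fun a b => ?_⟩ <;>
    · refine resO_ext fun x hx => ?_
      obtain ⟨W, hW, hxW, h, ⟨h1, h2⟩, he⟩ := H x hx
      refine ⟨W, hW, hxW, ?_⟩
      simp only [map_add, map_mul, he, h1, h2, resM_smul]

/-- The dual sheaf `M^∨ = ℋom(M, 𝒪_X)`. -/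
def dual {X : Scheme.{0}} (M : X.Modules) : X.Modules := (linOps M).sheaf

/-- The canonical map `M → M^∨∨` on sections over `U`. -/
def toBidual {X : Scheme.{0}} (M : X.Modules) (U : X.Opens) (m : Γ(M, U)) :
    Γ(dual (dual M), U) :=
  show (linOps (dual M)).Sec U from
  { fn := fun V h (l : (linOps M).Sec V) => l.fn V le_rfl (resM M h m)
    mem := fun _ _ => ⟨fun _ _ => rfl, fun a l => by
      change resO _ a * _ = _
      simp [resO]⟩
    compat := fun hWV hVU (l : (linOps M).Sec _) => by
      refine (l.compat hWV le_rfl _).trans ?_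
      exact congrArg (l.fn _ _) (resM_resM M hWV hVU m) }

/-- Alternating `𝒪_X`-multilinear maps `M × ⋯ × M → 𝒪_X` (with `r` factors). -/
def altOps {X : Scheme.{0}} (M : X.Modules) (r : ℕ) : LocalOps X where
  S V := Fin r → Γ(M, V)
  res h m := fun i => resM M h (m i)
  res_res hWV hVU m := funext fun i => resM_resM M hWV hVU (m i)
  P V :=
    { carrier := {g | (∀ m i x y, g (Function.update m i (x + y)) =
          g (Function.update m i x) + g (Function.update m i y)) ∧
        (∀ m i (a : Γ(X, V)) x, g (Function.update m i (a • x)) = a * g (Function.update m i x)) ∧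
        ∀ m i j, m i = m j → i ≠ j → g m = 0}
      zero_mem' := by simp
      add_mem' := by
        rintro g h ⟨h1, h2, h3⟩ ⟨h4, h5, h6⟩
        refine ⟨fun m i x y => ?_, fun m i a x => ?_, fun m i j hm hij => ?_⟩
        · simp only [Pi.add_apply, h1, h4]; ring
        · simp only [Pi.add_apply, h2, h5]; ring
        · simp only [Pi.add_apply, h3 m i j hm hij, h6 m i j hm hij, add_zero]
      smul_mem' := by
        rintro r g ⟨h1, h2, h3⟩
        refine ⟨fun m i x y => ?_, fun m i a x => ?_, fun m i j hm hij => ?_⟩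
        · simp only [Pi.smul_apply, smul_eq_mul, h1]; ring
        · simp only [Pi.smul_apply, smul_eq_mul, h2]; ring
        · simp only [Pi.smul_apply, h3 m i j hm hij, smul_zero] }
  isLocal V g H := by
    have hu : ∀ {W : X.Opens} (hW : W ≤ V) (m : Fin r → Γ(M, V)) (i : Fin r) (x : Γ(M, V)),
        (fun k => resM M hW (Function.update m i x k)) =
          Function.update (fun k => resM M hW (m k)) i (resM M hW x) := by
      intro W hW m i x
      exact Function.comp_update (resM M hW) m i x
    refine ⟨fun m i x y => ?_, fun m i a x => ?_, fun m i j hm hij => ?_⟩ <;>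
      refine resO_ext fun x hx => ?_ <;>
      obtain ⟨W, hW, hxW, h, ⟨h1, h2, h3⟩, he⟩ := H x hx <;>
      refine ⟨W, hW, hxW, ?_⟩
    · simp only [map_add, he, hu, h1]
    · simp only [map_mul, he, hu, resM_smul, h2]
    · rw [he, map_zero]
      exact h3 _ i j (congrArg (resM M hW) hm) hij

/-- The sheaf of alternating `r`-forms on `M`, that is `(⋀^r M)^∨`. -/
def altSheaf {X : Scheme.{0}} (M : X.Modules) (r : ℕ) : X.Modules := (altOps M r).sheaf

/-- The sheaf `Ω^p_X` of differential `p`-forms of a smooth scheme over `ℂ`: alternating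
`𝒪_X`-multilinear forms on vector fields. -/
def formSheaf {X : Scheme.{0}} (f : X ⟶ Spec (.of ℂ)) (p : ℕ) : X.Modules :=
  altSheaf (tangentSheaf f) p

/-- The determinant `det M = (⋀^r M)^∨∨` of a coherent sheaf `M` of rank `r`. -/
def det {X : Scheme.{0}} (M : X.Modules) (r : ℕ) : X.Modules := dual (altSheaf M r)

/-- The tensor product of sheaves of modules: the sheafification of `U ↦ M(U) ⊗ N(U)`. -/
def tensor {X : Scheme.{0}} (M N : X.Modules) : X.Modules :=
  (PresheafOfModules.sheafification (𝟙 X.ringCatSheaf.obj)).obj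
    (PresheafOfModules.Monoidal.tensorObj (R := X.presheaf) M.val N.val)

/-- The cohomology group `H^n(X, M)`. -/
def cohomology {X : Scheme.{0}} (M : X.Modules) (n : ℕ) : Type :=
  Sheaf.H ((SheafOfModules.toSheaf X.ringCatSheaf).obj M) n

/-- Coherent sheaves (on a Noetherian scheme): the sheaves of modules of finite presentation. -/
def IsCoherent {X : Scheme.{0}} (M : X.Modules) : Prop :=
  SheafOfModules.IsFinitePresentation M

/-- Invertible sheaves: locally isomorphic to `𝒪_X`. -/
def IsInvertible {X : Scheme.{0}} (L : X.Modules) : Prop :=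
  ∀ x : X, ∃ U : X.Opens, x ∈ U ∧
    Nonempty (L.restrict U.ι ≅ (SheafOfModules.unit U.toScheme.ringCatSheaf : U.toScheme.Modules))

/-- Reflexive sheaves: coherent sheaves for which `M → M^∨∨` is an isomorphism. -/
def IsReflexive {X : Scheme.{0}} (M : X.Modules) : Prop :=
  IsCoherent M ∧ ∀ U : X.Opens, Function.Bijective (toBidual M U)

/-- Torsion free sheaves on an integral scheme. -/
def IsTorsionFree {X : Scheme.{0}} (M : X.Modules) : Prop :=
  IsCoherent M ∧ ∀ (U : X.Opens) (a : Γ(X, U)) (m : Γ(M, U)), a • m = 0 → a = 0 ∨ m = 0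

/-- A coherent sheaf on an integral scheme has rank `r`. -/
def HasRank {X : Scheme.{0}} (M : X.Modules) (r : ℕ) : Prop :=
  ∀ U : X.affineOpens, (U : Set X).Nonempty → Module.rank Γ(X, U) Γ(M, U) = r

section

attribute [local instance] MvPolynomial.gradedAlgebra

/-- A scheme over `ℂ` is projective: it is a closed subscheme of some `ℙⁿ` over `ℂ`. -/
def IsProjective {X : Scheme.{0}} (f : X ⟶ Spec (.of ℂ)) : Prop :=
  ∃ (n : ℕ) (i : X ⟶ Proj (MvPolynomial.homogeneousSubmodule (Fin (n + 1)) ℂ)),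
    IsClosedImmersion i ∧
    i ≫ Proj.toSpecZero (MvPolynomial.homogeneousSubmodule (Fin (n + 1)) ℂ) ≫
      Spec.map (CommRingCat.ofHom
        (algebraMap ℂ (MvPolynomial.homogeneousSubmodule (Fin (n + 1)) ℂ 0))) = f

end

/-- A distribution of codimension `r` on a smooth threefold `X` over `ℂ`: an exact sequence
`0 → T → TX → N → 0` with `T` reflexive of rank `3 - r` and `N` torsion free. -/
structure Distribution {X : Scheme.{0}} (f : X ⟶ Spec (.of ℂ)) (r : ℕ) where
  T : X.Modules
  N : X.Modules
  φ : T ⟶ tangentSheaf f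
  π : tangentSheaf f ⟶ N
  zero : φ ≫ π = 0
  exact : (ShortComplex.mk φ π zero).ShortExact
  reflexive : IsReflexive T
  rank : HasRank T (3 - r)
  torsionFree : IsTorsionFree N

/-- The value over `V` of a linear form on `M`. -/
def evalLin {X : Scheme.{0}} {M : X.Modules} {V : X.Opens} (l : Γ(dual M, V)) (m : Γ(M, V)) :
    Γ(X, V) :=
  LocalOps.Sec.fn (D := linOps M) l V le_rfl m

/-- The restriction of a differential `s`-form to `T`, along `φ : T → TX`; this is the morphism
`Ω^s_X → (⋀^s T)^∨ = (det T)^∨` induced by the dual of `φ`, on sections over `V`. -/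
def pullForm {X : Scheme.{0}} {f : X ⟶ Spec (.of ℂ)} {T : X.Modules} (φ : T ⟶ tangentSheaf f)
    (s : ℕ) (V : X.Opens) (w : Γ(formSheaf f s, V)) : Γ(altSheaf T s, V) :=
  show (altOps T s).Sec V from
  { fn := fun W h t =>
      LocalOps.Sec.fn (D := altOps (tangentSheaf f) s) w W h (fun i => φ.app W (t i))
    mem := by
      intro W h
      obtain ⟨h1, h2, h3⟩ := LocalOps.Sec.mem (D := altOps (tangentSheaf f) s) w W h
      have hu : ∀ (m : Fin s → Γ(T, W)) (i : Fin s) (x : Γ(T, W)),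
          (fun k => φ.app W (Function.update m i x k)) =
            Function.update (fun k => φ.app W (m k)) i (φ.app W x) :=
        fun m i x => Function.comp_update (φ.app W) m i x
      refine ⟨fun m i x y => ?_, fun m i a x => ?_, fun m i j hm hij => ?_⟩
      · simp only [hu, map_add, h1]
      · simp only [hu, Scheme.Modules.Hom.app_smul, h2]
      · exact h3 _ i j (congrArg (φ.app W) hm) hij
    compat := by
      intro W' W hWW hWV t
      refine (LocalOps.Sec.compat (D := altOps (tangentSheaf f) s) w hWW hWV _).trans ?_
      refine congrArg (LocalOps.Sec.fn (D := altOps (tangentSheaf f) s) w W' _) (funext fun i => ?_)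
      exact (ConcreteCategory.congr_hom (φ.mapPresheaf.naturality (homOfLE hWW).op) (t i)).symm }

/-- The zero scheme of a section of `T ⊗ L^∨`, given as a morphism `σ : L → T` (for `L`
invertible): its ideal is the image of the morphism `T^∨ ⊗ L → 𝒪_X` defined by `σ`. For coherent
sheaves the sections of this image over an affine open are given by the span below. -/
def zeroScheme {X : Scheme.{0}} {L T : X.Modules} (σ : L ⟶ T) : X.IdealSheafData :=
  .ofIdeals fun U => Ideal.span
    {a | ∃ (l : Γ(dual T, U)) (s : Γ(L, U)), a = evalLin l (σ.app U s)}

/-- The ideal `W_x ⊆ 𝒪_{X,x}` generated by the sections over `U ∋ x` of the ideal of `W`. -/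
def stalkIdeal {X : Scheme.{0}} (W : X.IdealSheafData) (U : X.affineOpens) (x : X) (hx : x ∈ U.1) :
    Ideal (X.presheaf.stalk x) :=
  (W.ideal U).map (X.presheaf.germ U.1 x hx).hom

/-- For a closed subscheme `W` of dimension at most one of a variety, the subscheme `W₁` with
structure sheaf `𝒪_W / 𝒰`, where `𝒰` is the maximal zero-dimensional subsheaf of `𝒪_W`: the
sections of `𝒰` are those supported at closed points, so a function `a` lies in the ideal of `W₁`
if and only if it lies in the ideal of `W` at every non-closed point. -/
def sing1 {X : Scheme.{0}} (W : X.IdealSheafData) : X.IdealSheafData :=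
  .ofIdeals fun U => ⨅ (x : X) (hx : x ∈ U.1) (_ : ¬ IsClosed ({x} : Set X)),
    (stalkIdeal W U x hx).comap (X.presheaf.germ U.1 x hx).hom

/-- The support of the maximal zero-dimensional subsheaf `𝒰` of `𝒪_W`. -/
def sing0 {X : Scheme.{0}} (W : X.IdealSheafData) : Set X :=
  {x | ∃ (U : X.affineOpens) (hx : x ∈ U.1), ∃ a ∈ (sing1 W).ideal U,
    X.presheaf.germ U.1 x hx a ∉ stalkIdeal W U x hx}

namespace Distribution

variable {X : Scheme.{0}} {f : X ⟶ Spec (.of ℂ)} {r : ℕ}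

/-- The singular scheme: the image of `Ω^s_X → (det T)^∨`, where `s = 3 - r` is the rank of `T`, is
the ideal sheaf of this closed subscheme twisted by `(det T)^∨`. So its ideal is the image of
`Ω^s_X ⊗ det T → 𝒪_X`. -/
def sing (F : Distribution f r) : X.IdealSheafData :=
  .ofIdeals fun U => Ideal.span
    {a | ∃ (l : Γ(det F.T (3 - r), U)) (w : Γ(formSheaf f (3 - r), U)),
      a = evalLin l (pullForm F.φ (3 - r) U w)}

/-- Generic distributions: the singular scheme is empty or zero-dimensional. -/
def IsGeneric (F : Distribution f r) : Prop :=
  topologicalKrullDim (F.sing.support : Set X) ≤ 0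

/-- `G` is the subfoliation of `F` induced by `σ : L → T_F`: its tangent sheaf is `L`, embedded in
`TX` through `σ`. -/
def IsInducedBy (G : Distribution f 2) (F : Distribution f 1) {L : X.Modules} (σ : L ⟶ F.T) :
    Prop :=
  ∃ e : G.T ≅ L, G.φ = e.hom ≫ σ ≫ F.φ

/-- `G` is the intersection of `F` and `H`: one has `T_G = T_F ∩ T_H` in `TX`. -/
def IsIntersection (G : Distribution f 2) (F H : Distribution f 1) : Prop :=
  ∃ (a : G.T ⟶ F.T) (b : G.T ⟶ H.T), IsPullback a b F.φ H.φ ∧ a ≫ F.φ = G.φ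

end Distribution

end Foliated

end

open Foliated

/-! On an affine chart where the tangent sheaf is free, vector fields and one-forms become vectors
of length three over the coordinate ring, and pairing is the dot product. `F` is generically the
kernel of a one-form `w`. Since Sing(`F`) has dimension at most zero, the rank one module of forms
proportional to `w` is invertible away from closed points. The local rings have depth three there,
so it is principal at those points too. Its generator has coordinates whose ideal is trivial or
primary to a closed point, hence contains a regular sequence of length three, and its Koszul complex
is exact in degree one (`exists_fmodel`). Two consequences carry the proof. (a) Every linear form on
`F.T` is locally the restriction of a one-form on X (`FModel.exists_lev_eq`); abstractly, Ext¹ of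
the normal sheaf of `F` into the structure sheaf vanishes. (b) The vector `v` of `σ`, being
orthogonal to `w`, has the form `h ⨯₃ w` (`exists_gmodel`).

For the equality of schemes, reflexivity of the tangent sheaf of `G` shows that Sing(`G`) is cut out
by the values of one-forms of X on `σ`, whereas the zero scheme of `σ` is cut out by the values of
linear forms on `F.T`. By (a) the two ideals agree, and locally both are generated by the
coordinates of `v`. Torsion-freeness of the normal sheaf of `G` makes `v` primitive, so the
Hilbert–Burch complex with columns `h`, `w` is exact. The quotient by the ideal of `v` therefore has
positive depth at closed points (`exists_dotProduct_eq`, `mem_span_cross_of_forall`), no function is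
killed only at closed points, and Sing(`G`) coincides with its one-dimensional part (`sing1_sing`).

For the intersection, let Q be the cokernel of `σ`. Its sheaf of linear forms is invertible,
generated locally by the restriction of `h`. A morphism `θ` from TX to the double dual of Q which
extends the canonical map on `F.T` has a kernel meeting `F.T` exactly in the image of `L`.
Restriction of such morphisms from TX to `F.T` is a map of sheaves, surjective by (a), with kernel
N_F^∨ ⊗ Q^∨∨. As N_F^∨ is det Ω ⊗ det T_F and Q^∨∨ is L^∨ ⊗ det T_F, this kernel is the line bundle
whose first cohomology is assumed to vanish (`nonempty_vanishing_iso`), so `θ` exists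
(`exists_isExtension`). Locally `θ` is a one-form `h` which still satisfies `v = h ⨯₃ w`.
Primitivity of `h` then gives the reflexivity of the kernel and the generators of the conormal sheaf
(`exists_distribution`, `isIntersection`, `nonempty_det_iso`). -/

noncomputable section

namespace Foliated

/-! ### Weakly regular sequences of length three, and freeness of modules of maximal depth. -/

section RegularSequences

open RingTheory.Sequence

/-- `x, y, z` is a weakly regular sequence on `M`, spelled out on elements. -/
structure RegTriple {R : Type*} (M : Type*) [CommRing R] [AddCommGroup M] [Module R M]
    (x y z : R) : Prop where
  fst : ∀ m : M, x • m = 0 → m = 0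
  snd : ∀ m n : M, y • m = x • n → ∃ k, m = x • k
  trd : ∀ m n n' : M, z • m = x • n + y • n' → ∃ k k', m = x • k + y • k'

/-- The elementwise form is the one used in computations; the list form gives access to flat base
change and to the inductive description of regular sequences. -/
theorem regTriple_iff {R : Type*} {M : Type*} [CommRing R] [AddCommGroup M] [Module R M]
    {x y z : R} : RegTriple M x y z ↔ IsWeaklyRegular M [x, y, z] := by
  have h1 : ∀ m : M, m ∈ Ideal.ofList [x] • (⊤ : Submodule R M) ↔ ∃ k, m = x • k := by
    intro m
    simp only [Ideal.ofList_singleton, Submodule.ideal_span_singleton_smul,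
      Submodule.mem_smul_pointwise_iff_exists, Submodule.mem_top, true_and, eq_comm]
  have h2 : ∀ m : M, m ∈ Ideal.ofList [x, y] • (⊤ : Submodule R M) ↔
      ∃ k k', m = x • k + y • k' := by
    intro m
    rw [Ideal.ofList_cons, Ideal.ofList_singleton, Submodule.sup_smul, Submodule.mem_sup]
    simp only [Submodule.ideal_span_singleton_smul,
      Submodule.mem_smul_pointwise_iff_exists, Submodule.mem_top, true_and]
    constructor
    · rintro ⟨_, ⟨a, rfl⟩, _, ⟨b, rfl⟩, rfl⟩; exact ⟨a, b, rfl⟩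
    · rintro ⟨a, b, rfl⟩; exact ⟨_, ⟨a, rfl⟩, _, ⟨b, rfl⟩, rfl⟩
  have h3 : ∀ m : M, m ∈ Ideal.ofList ([] : List R) • (⊤ : Submodule R M) ↔ m = 0 := by
    intro m
    rw [Ideal.ofList_nil, Submodule.bot_smul, Submodule.mem_bot]
  rw [isWeaklyRegular_iff_Fin]
  simp only [isSMulRegular_quotient_iff_mem_of_smul_mem]
  constructor
  · rintro ⟨a, b, c⟩ i
    change Fin 3 at i
    fin_cases i
    · intro m hm
      exact (h3 _).2 (a m ((h3 _).1 hm))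
    · intro m hm
      obtain ⟨k, hk⟩ := (h1 _).1 hm
      exact (h1 _).2 (b m k hk)
    · intro m hm
      obtain ⟨k, k', hk⟩ := (h2 _).1 hm
      exact (h2 _).2 (c m k k' hk)
  · intro H
    refine ⟨fun m hm => (h3 _).1 (H (0 : Fin 3) m ((h3 _).2 hm)),
      fun m n hm => (h1 _).1 (H (1 : Fin 3) m ((h1 _).2 ⟨n, hm⟩)),
      fun m n n' hm => (h2 _).1 (H (2 : Fin 3) m ((h2 _).2 ⟨n, n', hm⟩))⟩

namespace RegTriple

variable {R : Type*} {M : Type*} [CommRing R] [AddCommGroup M] [Module R M] {x y z : R}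

/-- A relation modulo `x ^ (n + 1)` is divided first by `x` and then by `x ^ n`. In the third
condition the first division leaves an error which is a multiple of `y` modulo `x`, and the second
condition absorbs it. -/
theorem pow_fst (h : RegTriple M x y z) (n : ℕ) : RegTriple M (x ^ n) y z := by
  have hinj : ∀ {a b : M}, x • a = x • b → a = b := fun {a b} e =>
    sub_eq_zero.1 (h.fst _ (by rw [smul_sub, e, sub_self]))
  induction n with
  | zero =>
    exact ⟨fun m hm => by simpa using hm, fun m n _ => ⟨m, by simp⟩,
      fun m n n' _ => ⟨m, 0, by simp⟩⟩
  | succ n ih =>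
    refine ⟨fun m hm => ?_, fun m k hm => ?_, fun m k k' hm => ?_⟩
    · rw [pow_succ, mul_smul] at hm
      exact h.fst _ (ih.fst _ hm)
    · obtain ⟨p, rfl⟩ := h.snd m (x ^ n • k) (by rw [hm, pow_succ', mul_smul])
      obtain ⟨q, rfl⟩ := ih.snd p k (hinj (by rw [smul_comm, hm, pow_succ', mul_smul]))
      exact ⟨q, by rw [pow_succ', mul_smul]⟩
    · obtain ⟨p, q, rfl⟩ := h.trd m (x ^ n • k) k' (by rw [hm, pow_succ', mul_smul])
      have e : y • (z • q - k') = x • (x ^ n • k - z • p) := by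
        rw [smul_add, smul_comm z x, smul_comm z y, pow_succ', mul_smul] at hm
        rw [smul_sub, smul_sub, sub_eq_sub_iff_add_eq_add, add_comm, hm, add_comm]
      obtain ⟨s, hs⟩ := h.snd _ _ e
      have e2 : z • p = x ^ n • k + y • (-s) := by
        rw [hs, smul_comm] at e
        have := hinj e
        rw [smul_neg, this]; abel
      obtain ⟨a, b, rfl⟩ := ih.trd _ _ _ e2
      exact ⟨a, x • b + q, by rw [pow_succ', mul_smul]; simp only [smul_add, smul_comm x y]; abel⟩

theorem pow_snd (h : RegTriple M x y z) (n : ℕ) : RegTriple M x (y ^ n) z := by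
  induction n with
  | zero =>
    exact ⟨h.fst, fun m n hm => ⟨n, by simpa using hm⟩, fun m n n' _ => ⟨0, m, by simp⟩⟩
  | succ n ih =>
    refine ⟨h.fst, fun m k hm => ?_, fun m k k' hm => ?_⟩
    · rw [pow_succ', mul_smul] at hm
      obtain ⟨p, hp⟩ := h.snd _ _ hm
      exact ih.snd _ _ hp
    · rw [pow_succ', mul_smul] at hm
      obtain ⟨p, q, rfl⟩ := h.trd _ _ _ hm
      have e : y • (z • q - y ^ n • k') = x • (k - z • p) := by
        rw [smul_add, smul_comm z x, smul_comm z y] at hm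
        rw [smul_sub, smul_sub, sub_eq_sub_iff_add_eq_add, add_comm, hm]
      obtain ⟨s, hs⟩ := h.snd _ _ e
      obtain ⟨a, b, rfl⟩ := ih.trd q s k' (by rw [← hs]; abel)
      exact ⟨p + y • a, b, by
        rw [pow_succ', mul_smul]; simp only [smul_add, smul_comm x y]; abel⟩

theorem pow_trd (h : RegTriple M x y z) (n : ℕ) : RegTriple M x y (z ^ n) := by
  induction n with
  | zero => exact ⟨h.fst, h.snd, fun m n n' hm => ⟨n, n', by simpa using hm⟩⟩
  | succ n ih =>
    refine ⟨h.fst, h.snd, fun m k k' hm => ?_⟩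
    rw [pow_succ, mul_smul] at hm
    obtain ⟨p, q, hp⟩ := ih.trd _ _ _ hm
    exact h.trd _ _ _ hp

theorem pow (h : RegTriple M x y z) (a b c : ℕ) : RegTriple M (x ^ a) (y ^ b) (z ^ c) :=
  ((h.pow_fst a).pow_snd b).pow_trd c

theorem pi (h : RegTriple M x y z) (ι : Type*) : RegTriple (ι → M) x y z := by
  refine ⟨fun m hm => funext fun i => h.fst _ (congrFun hm i), fun m n hm => ?_,
    fun m n n' hm => ?_⟩
  · choose k hk using fun i => h.snd (m i) (n i) (congrFun hm i)
    exact ⟨k, funext hk⟩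
  · choose k k' hk using fun i => h.trd (m i) (n i) (n' i) (congrFun hm i)
    exact ⟨k, k', funext hk⟩

/-- A second syzygy has depth at least three. -/
theorem ker {N : Type*} [AddCommGroup N] [Module R N] (h : RegTriple M x y z)
    (hN : RegTriple N x y z) (π : M →ₗ[R] N)
    (hr : ∀ n : N, x • n ∈ LinearMap.range π → n ∈ LinearMap.range π) :
    RegTriple (LinearMap.ker π) x y z := by
  refine ⟨fun m hm => Subtype.ext (h.fst _ (congrArg Subtype.val hm)), fun m n hm => ?_,
    fun m n n' hm => ?_⟩
  · obtain ⟨k, hk⟩ := h.snd _ _ (congrArg Subtype.val hm)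
    refine ⟨⟨k, hN.fst _ ?_⟩, Subtype.ext hk⟩
    rw [← map_smul, ← hk]
    exact m.2
  -- The coefficients `u`, `u'` found in `M` need not lie in the kernel. Regularity on `N` and
  -- saturation of the range give `(π u, π u') = (-y • π k', x • π k')`, so adding `(y • k', -x •
  -- k')` moves both into the kernel without changing `x • u + y • u'`.
  · obtain ⟨u, u', hu⟩ := h.trd _ _ _ (congrArg Subtype.val hm)
    have e : x • π u + y • π u' = 0 := by
      rw [← map_smul, ← map_smul, ← map_add, ← hu]; exact m.2
    obtain ⟨k, hk⟩ := hN.snd (π u') (- π u) (by rw [smul_neg, eq_neg_iff_add_eq_zero, add_comm, e])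
    obtain ⟨k', rfl⟩ := hr k ⟨u', hk⟩
    have e2 : π u = - y • π k' := by
      refine sub_eq_zero.1 (hN.fst _ ?_)
      rw [neg_smul, sub_neg_eq_add, smul_add, smul_comm x y, ← hk, e]
    refine ⟨⟨u + y • k', ?_⟩, ⟨u' - x • k', ?_⟩, Subtype.ext ?_⟩
    · simp [e2]
    · simp [hk]
    · simp only [hu, Submodule.coe_add, SetLike.val_smul, smul_add, smul_sub, smul_comm x y]
      abel

end RegTriple

/-- The case of the Auslander–Buchsbaum formula in which the depth is maximal. As `r` is regular on
`K` and lies in the maximal ideal, `K` is free over `R` as soon as `K / rK` is free over `R / (r)`.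
When the sequence is exhausted the maximal ideal is zero and the ring is a field. -/
theorem free_of_isWeaklyRegular (n : ℕ) : ∀ {R : Type} {K : Type} [CommRing R] [IsLocalRing R]
    [IsNoetherianRing R] [AddCommGroup K] [Module R K] [Module.Finite R K] (rs : List R),
    rs.length = n → IsWeaklyRegular K rs → Ideal.ofList rs = IsLocalRing.maximalIdeal R →
    Module.Free R K := by
  induction n with
  | zero =>
    intro R K _ _ _ _ _ _ rs hl _ hm
    obtain rfl := List.length_eq_zero_iff.1 hl
    rw [Ideal.ofList_nil] at hm
    let := ((IsLocalRing.isField_iff_maximalIdeal_eq (R := R)).2 hm.symm).toField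
    exact Module.Free.of_divisionRing R K
  | succ n ih =>
    intro R K _ _ _ _ _ _ rs hl h hm
    obtain ⟨r, rs, rfl⟩ := List.exists_cons_of_length_eq_add_one hl
    have hr : r ∈ IsLocalRing.maximalIdeal R := by
      rw [← hm]
      exact Ideal.subset_span (by simp)
    rw [isWeaklyRegular_cons_iff'] at h
    have hnt : Nontrivial (R ⧸ Ideal.span {r}) := by
      refine Ideal.Quotient.nontrivial_iff.2 fun e => ?_
      exact (IsLocalRing.maximalIdeal.isMaximal R).ne_top
        (top_le_iff.1 (e ▸ (Ideal.span_singleton_le_iff_mem _).2 hr))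
    have hloc : IsLocalRing (R ⧸ Ideal.span {r}) :=
      IsLocalRing.of_surjective' (Ideal.Quotient.mk _) Ideal.Quotient.mk_surjective
    have hfin : Module.Finite (R ⧸ Ideal.span {r}) (QuotSMulTop r K) :=
      Module.Finite.of_restrictScalars_finite R _ _
    have := Module.finitePresentation_of_finite R K
    rw [← Module.free_quotSMulTop_iff_free R K (x := r)
      (by rw [IsLocalRing.jacobson_eq_maximalIdeal _ bot_ne_top]; exact hr) h.1]
    refine ih (rs.map (Ideal.Quotient.mk (Ideal.span {r}))) (by simpa using hl) h.2 ?_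
    rw [← Ideal.map_ofList]
    have h2 : Ideal.map (Ideal.Quotient.mk (Ideal.span {r})) (Ideal.ofList (r :: rs)) =
        Ideal.map (Ideal.Quotient.mk (Ideal.span {r})) (Ideal.ofList rs) := by
      rw [Ideal.ofList_cons, Ideal.map_sup, Ideal.map_quotient_self, bot_sup_eq]
    rw [← h2, hm]
    exact IsLocalRing.map_maximalIdeal_of_surjective _ Ideal.Quotient.mk_surjective

end RegularSequences

/-! ### Koszul and Hilbert–Burch exactness expressed with cross products. -/

section VectorAlgebra

open Matrix

variable {R : Type*} [CommRing R]

/-- Exactness of the Koszul complex of `w` in degree one, when the ideal of `w` contains a regular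
sequence of length three. -/
theorem exists_eq_cross {x y z : R} (reg : RegTriple R x y z) {a b c w u : Fin 3 → R}
    (hx : x = a ⬝ᵥ w) (hy : y = b ⬝ᵥ w) (hz : z = c ⬝ᵥ w) (hu : u ⬝ᵥ w = 0) :
    ∃ t, u = w ⨯₃ t := by
  have R3 := reg.pi (Fin 3)
  -- Triple product expansion: `w ⨯₃ (u ⨯₃ a)` is `(a ⬝ᵥ w) • u - (u ⬝ᵥ w) • a`.
  have e1 : x • u = w ⨯₃ (u ⨯₃ a) := by
    rw [hx]
    simp only [vec3_dotProduct] at hu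
    ext i
    fin_cases i <;> simp [cross_apply, vec3_dotProduct]
    · linear_combination (a 0) * hu
    · linear_combination (a 1) * hu
    · linear_combination (a 2) * hu
  -- It suffices to divide `u ⨯₃ a` by `x` modulo `w`: the multiple of `w` disappears in the product
  -- with `w`, and `x` is then cancelled.
  obtain ⟨m, k, hm⟩ : ∃ (m : R) (k : Fin 3 → R), u ⨯₃ a = m • w + x • k := by
    set v := u ⨯₃ a
    have e2 : (b ⬝ᵥ v) • w = y • v + x • (b ⨯₃ u) := by
      have e : x • (b ⨯₃ u) = b ⨯₃ (w ⨯₃ v) := by rw [← e1, map_smul]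
      rw [e, hy, cross_cross_eq_smul_sub_smul', dotProduct_comm w b, add_sub_cancel]
    -- Pairing `e2` with `c` brings in `z`, so the third regularity condition places `b ⬝ᵥ v` in the
    -- ideal `(x, y)`; the second condition then divides `v - q • w` by `x`.
    have e3 : z • (b ⬝ᵥ v) = x • (c ⬝ᵥ (b ⨯₃ u)) + y • (c ⬝ᵥ v) := by
      have := congrArg (fun t => c ⬝ᵥ t) e2
      simp only [dotProduct_smul, dotProduct_add, smul_eq_mul] at this
      rw [hz, smul_eq_mul, smul_eq_mul, smul_eq_mul]
      linear_combination this
    obtain ⟨p, q, hpq⟩ := reg.trd _ _ _ e3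
    obtain ⟨k, hk⟩ := R3.snd (v - q • w) (p • w - b ⨯₃ u) (by
      rw [smul_sub, smul_sub, smul_smul, smul_smul]
      simp only [smul_eq_mul] at hpq
      rw [hpq, add_smul] at e2
      rw [sub_eq_sub_iff_add_eq_add, ← e2])
    exact ⟨q, k, by rw [← hk]; abel⟩
  refine ⟨k, sub_eq_zero.1 (R3.fst _ ?_)⟩
  rw [smul_sub, e1, hm]
  simp

/-- If `v = h × w` and the vectors orthogonal to `v` are the combinations of `h` and `w`, then the
quotient by the ideal of `v` has positive depth. -/
theorem exists_dotProduct_eq {x y z : R} (reg : RegTriple R x y z) {h w : Fin 3 → R}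
    (perp : ∀ b, b ⬝ᵥ (h ⨯₃ w) = 0 → ∃ c d : R, b = c • h + d • w)
    (indep : ∀ c d : R, c • h + d • w = 0 → c = 0 ∧ d = 0)
    {a : R} {b₁ b₂ b₃ : Fin 3 → R} (h₁ : x * a = b₁ ⬝ᵥ (h ⨯₃ w)) (h₂ : y * a = b₂ ⬝ᵥ (h ⨯₃ w))
    (h₃ : z * a = b₃ ⬝ᵥ (h ⨯₃ w)) : ∃ b, a = b ⬝ᵥ (h ⨯₃ w) := by
  set v := h ⨯₃ w with hv
  -- Two expressions of `s * t * a` differ by a syzygy of `v`, which is a combination of `h` and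
  -- `w`.
  have key : ∀ {s t : R} {b b' : Fin 3 → R}, s * a = b ⬝ᵥ v → t * a = b' ⬝ᵥ v →
      ∃ c d : R, t • b - s • b' = c • h + d • w := by
    intro s t b b' hb hb'
    apply perp
    simp only [sub_dotProduct, smul_dotProduct, ← hb, ← hb', smul_eq_mul]
    ring
  obtain ⟨c₁, d₁, e₁⟩ := key h₁ h₂
  obtain ⟨c₂, d₂, e₂⟩ := key h₁ h₃
  obtain ⟨c₃, d₃, e₃⟩ := key h₂ h₃
  -- The three differences form a Koszul cocycle in `x, y, z`; independence of `h` and `w` passes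
  -- the cocycle relation to the coefficients.
  have e : (z * c₁ - y * c₂ + x * c₃) • h + (z * d₁ - y * d₂ + x * d₃) • w = 0 := by
    have : z • (c₁ • h + d₁ • w) - y • (c₂ • h + d₂ • w) + x • (c₃ • h + d₃ • w) = 0 := by
      rw [← e₁, ← e₂, ← e₃]; module
    rw [← this]; module
  obtain ⟨ec, ed⟩ := indep _ _ e
  obtain ⟨p, q, hpq⟩ := reg.trd c₁ (-c₃) c₂ (by simp only [smul_eq_mul]; linear_combination ec)
  obtain ⟨p', q', hpq'⟩ := reg.trd d₁ (-d₃) d₂ (by simp only [smul_eq_mul]; linear_combination ed)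
  simp only [smul_eq_mul] at hpq hpq'
  -- `b₁` and `b₂` may be corrected by multiples of `h` and `w`, which are orthogonal to `v`. The
  -- corrections make `y` times the first equal to `x` times the second, so the corrected `b₁` is
  -- divisible by `x`, and the quotient is the vector sought.
  obtain ⟨b, hb⟩ := (reg.pi (Fin 3)).snd (b₁ - q • h - q' • w) (b₂ + p • h + p' • w) (by
    have : y • b₁ = x • b₂ + (c₁ • h + d₁ • w) := by rw [← e₁]; abel
    rw [smul_sub, smul_sub, this, hpq, hpq']; module)
  refine ⟨b, sub_eq_zero.1 (reg.fst _ ?_)⟩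
  have h1 : h ⬝ᵥ v = 0 := dot_self_cross _ _
  have h2 : w ⬝ᵥ v = 0 := dot_cross_self _ _
  have := congrArg (fun t => t ⬝ᵥ v) hb
  simp only [sub_dotProduct, smul_dotProduct, h1, h2, smul_eq_mul, ← h₁] at this
  rw [smul_eq_mul]
  linear_combination this

end VectorAlgebra

/-! ### Principality of saturated rank one modules at a closed point. -/

section RankOne

open Matrix

variable {B : Type} [CommRing B] [IsDomain B]

/-- The module of vectors proportional to `w`. -/
def line (w : Fin 3 → B) : Submodule B (Fin 3 → B) := LinearMap.ker (crossProduct w)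

omit [IsDomain B] in
theorem mem_line {w m : Fin 3 → B} : m ∈ line w ↔ w ⨯₃ m = 0 := Iff.rfl

theorem finrank_line [IsNoetherianRing B] {w : Fin 3 → B} (hw : w ≠ 0) :
    Module.finrank B (line w) = 1 := by
  obtain ⟨i, hi⟩ := Function.ne_iff.1 hw
  have hi : w i ≠ 0 := hi
  refine le_antisymm ?_ ?_
  · rw [← Module.finrank_self B]
    refine LinearMap.finrank_le_finrank_of_injective
      (f := (LinearMap.proj i : (Fin 3 → B) →ₗ[B] B).comp (line w).subtype) ?_
    rw [← LinearMap.ker_eq_bot, LinearMap.ker_eq_bot']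
    rintro ⟨m, hm⟩ (hmi : m i = 0)
    rw [mem_line] at hm
    refine Subtype.ext (funext fun j => ?_)
    change m j = 0
    have h0 := congrFun hm 0
    have h1 := congrFun hm 1
    have h2 := congrFun hm 2
    simp [cross_apply] at h0 h1 h2
    refine (mul_eq_zero.1 (?_ : w i * m j = 0)).resolve_left hi
    fin_cases i <;> fin_cases j <;> simp_all [sub_eq_zero]
  · have : Nontrivial (line w) := ⟨⟨⟨w, cross_self w⟩, 0, fun h => hw (congrArg Subtype.val h)⟩⟩
    exact Module.finrank_pos

-- Cramer's rule with the rows `s, k` as the would-be basis; only the coefficient of `s` has to be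
-- identified. It makes `u ↦ det (u, k)` proportional to any linear map that kills all the `k i`.
omit [IsDomain B] in
theorem exists_det_smul_eq {r : ℕ} (s u : Fin (r + 1) → B) (k : Fin r → Fin (r + 1) → B) :
    ∃ c : Fin r → B, (Matrix.of (vecCons s k)).det • u =
      (Matrix.of (vecCons u k)).det • s + ∑ i, c i • k i := by
  set N : Matrix (Fin (r + 1)) (Fin (r + 1)) B := Matrix.of (vecCons s k)
  have h1 : N.det • u = ∑ i, (Nᵀ.cramer u) i • N i := by
    rw [← det_transpose, ← mulVec_cramer]
    ext j
    rw [Finset.sum_apply]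
    change ∑ i, N i j * Nᵀ.cramer u i = ∑ i, Nᵀ.cramer u i * N i j
    exact Finset.sum_congr rfl fun i _ => mul_comm _ _
  have h2 : (Nᵀ.cramer u) 0 = (Matrix.of (vecCons u k)).det := by
    rw [cramer_transpose_apply]
    congr 1
    ext i j
    refine Fin.cases ?_ (fun i => ?_) i
    · rw [updateRow_self]; rfl
    · rw [updateRow_ne (Fin.succ_ne_zero i)]; rfl
  refine ⟨fun i => (Nᵀ.cramer u) i.succ, ?_⟩
  rw [h1, Fin.sum_univ_succ, h2]
  rfl

/-- Over a regular local ring of dimension three, a saturated submodule of rank one which is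
invertible outside the closed point is principal. -/
theorem exists_line_le_span [IsLocalRing B] [IsNoetherianRing B] {x y z : B}
    (reg : RegTriple B x y z) (hm : Ideal.ofList [x, y, z] = IsLocalRing.maximalIdeal B)
    {w : Fin 3 → B} (hw : w ≠ 0) (H : Set B)
    (hH : ∀ h ∈ H, ∃ μ ∈ line w, ∀ m ∈ line w, ∃ c : B, h • m = c • μ)
    (hrad : IsLocalRing.maximalIdeal B ≤ (Ideal.span H).radical) :
    ∃ v ∈ line w, ∀ m ∈ line w, ∃ c : B, m = c • v := by
  have hsat : ∀ (a : B) (m : Fin 3 → B), a ≠ 0 → a • m ∈ line w → m ∈ line w := by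
    intro a m ha h
    rw [mem_line, map_smul] at h
    exact (smul_eq_zero.1 h).resolve_left ha
  have hx0 : x ≠ 0 := by
    rintro rfl
    exact one_ne_zero (reg.fst (1 : B) (by simp))
  obtain ⟨n, g, hg⟩ := Submodule.fg_iff_exists_fin_generating_family.1
    (IsNoetherian.noetherian (line w))
  let π : (Fin n → B) →ₗ[B] (Fin 3 → B) := Fintype.linearCombination B g
  have hπ : LinearMap.range π = line w := by rw [← hg, Fintype.range_linearCombination]
  -- The quotient of `B³` by the saturated module `line w` has no torsion, so the module of
  -- relations is a second syzygy. It has depth three and is free, of rank one less than the number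
  -- of generators.
  have regK : RegTriple (LinearMap.ker π) x y z :=
    (reg.pi (Fin n)).ker (reg.pi (Fin 3)) π fun m h => by
      rw [hπ] at h ⊢; exact hsat x m hx0 h
  have hfree : Module.Free B (LinearMap.ker π) :=
    free_of_isWeaklyRegular 3 [x, y, z] rfl (regTriple_iff.1 regK) hm
  obtain ⟨r, b, rfl⟩ : ∃ (r : ℕ) (_ : Module.Basis (Fin r) B (LinearMap.ker π)), r + 1 = n := by
    refine ⟨_, Module.finBasis B (LinearMap.ker π), ?_⟩
    have := Submodule.finrank_quotient_add_finrank (LinearMap.ker π)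
    rw [π.quotKerEquivRange.finrank_eq, hπ, finrank_line hw, Module.finrank_fin_fun] at this
    omega
  let k : Fin r → Fin (r + 1) → B := fun j => (b j : Fin (r + 1) → B)
  let Δ : (Fin (r + 1) → B) →ₗ[B] B :=
    { toFun := fun u => (Matrix.of (vecCons u k)).det
      map_add' := fun u u' => (detRowAlternating.toMultilinearMap.cons_add k u u')
      map_smul' := fun c u => (detRowAlternating.toMultilinearMap.cons_smul k c u) }
  have hcr : ∀ s u, Δ s • π u = Δ u • π s := by
    intro s u
    obtain ⟨c, hc⟩ := exists_det_smul_eq s u k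
    have h3 := congrArg π hc
    rw [map_smul, map_add, map_smul, map_sum, Finset.sum_eq_zero, add_zero] at h3
    · exact h3
    · intro i _
      have : π (k i) = 0 := (b i).2
      rw [map_smul, this, smul_zero]
  let I : Ideal B := LinearMap.range Δ
  -- Let `s` lift the local generator `μ`. Up to the factor `h`, the vectors `s` and `k` span the
  -- free module; the matrix `D` records this. Determinants give `h ^ (r + 1) = det D * Δ s`, a
  -- value of `Δ`.
  have hmem : ∀ h ∈ H, h ∈ I.radical := by
    intro h hh
    obtain ⟨μ, hμ, hc⟩ := hH h hh
    rw [← hπ] at hμ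
    obtain ⟨s, rfl⟩ := hμ
    choose c hc using fun u => hc (π u) (hπ ▸ ⟨u, rfl⟩)
    have hK : ∀ u, h • u - c u • s ∈ LinearMap.ker π := fun u => by
      rw [LinearMap.mem_ker, map_sub, map_smul, map_smul, hc, sub_self]
    let D : Matrix (Fin (r + 1)) (Fin (r + 1)) B := Matrix.of fun i =>
      vecCons (c (Pi.single i 1)) (fun j => b.repr ⟨_, hK (Pi.single i 1)⟩ j)
    have hD : D * Matrix.of (vecCons s k) = h • (1 : Matrix _ _ B) := by
      ext i j
      have h1 := congrFun (congrArg Subtype.val (b.sum_repr ⟨_, hK (Pi.single i 1)⟩)) j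
      simp only [Submodule.coe_sum, Finset.sum_apply, SetLike.val_smul, Pi.smul_apply,
        Pi.sub_apply, smul_eq_mul] at h1
      rw [mul_apply, Fin.sum_univ_succ]
      simp only [D, of_apply, cons_val_zero, cons_val_succ, k, h1]
      rw [add_sub_cancel, Matrix.smul_apply, Matrix.one_apply, Pi.single_apply, smul_eq_mul]
      simp only [eq_comm]
    refine ⟨r + 1, ⟨D.det • s, ?_⟩⟩
    have h2 := congrArg Matrix.det hD
    rw [det_mul, det_smul, det_one, mul_one, Fintype.card_fin] at h2
    rw [← h2, map_smul]
    rfl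
  have hI : IsLocalRing.maximalIdeal B ≤ I.radical :=
    hrad.trans (Ideal.radical_le_radical_iff.2 (Ideal.span_le.2 hmem))
  obtain ⟨N, a, ha⟩ : ∃ N, x ^ N ∈ I :=
    hI (hm ▸ Ideal.subset_span (by simp))
  obtain ⟨N', a', ha'⟩ : ∃ N, y ^ N ∈ I :=
    hI (hm ▸ Ideal.subset_span (by simp))
  -- With `Δ a = x ^ N` and `Δ a' = y ^ N'`, proportionality gives `x ^ N • π a' = y ^ N' • π a`.
  -- Regularity divides `π a` by `x ^ N`, and the quotient `v` generates because `x ^ N • π u = Δ u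
  -- • π a`.
  have e := hcr a a'
  rw [ha, ha'] at e
  obtain ⟨v, hv⟩ := (((reg.pow_fst N).pow_snd N').pi (Fin 3)).snd _ _ e.symm
  have hxN : x ^ N ≠ 0 := pow_ne_zero _ hx0
  refine ⟨v, hsat _ _ hxN ?_, fun m hm => ?_⟩
  · rw [← hv, ← hπ]; exact ⟨_, rfl⟩
  · rw [← hπ] at hm
    obtain ⟨u, rfl⟩ := hm
    refine ⟨Δ u, smul_right_injective _ hxN ?_⟩
    change x ^ N • π u = x ^ N • _
    rw [smul_comm, ← hv, ← ha, hcr]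

end RankOne

/-! ### Étale coordinates, and regular parameters at closed points. -/

section EtaleCoordinates

open KaehlerDifferential

/-- The differentials of `t 0, t 1, t 2` form a basis of `Ω[A⁄ℂ]`. -/
def IsCoords {A : Type} [CommRing A] [Algebra ℂ A] (t : Fin 3 → A) : Prop :=
  ∃ b : Module.Basis (Fin 3) A Ω[A⁄ℂ], ∀ i, b i = D ℂ A (t i)

theorem exists_isCoords (A : Type) [CommRing A] [Nontrivial A] [Algebra ℂ A]
    [Algebra.IsStandardSmoothOfRelativeDimension 3 ℂ A] : ∃ t : Fin 3 → A, IsCoords t := by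
  have := Algebra.IsStandardSmoothOfRelativeDimension.isStandardSmooth 3 (R := ℂ) (S := A)
  obtain ⟨-, I, b, hb⟩ := Algebra.IsStandardSmooth.iff_exists_basis_kaehlerDifferential.1 this
  have hr := Algebra.IsStandardSmoothOfRelativeDimension.rank_kaehlerDifferential (R := ℂ) (S := A) 3
  rw [← b.mk_eq_rank''] at hr
  have : Nonempty (I ≃ Fin 3) := by
    rw [← Cardinal.eq, hr]; simp
  obtain ⟨e⟩ := this
  choose t ht using fun i => hb ⟨e.symm i, rfl⟩
  exact ⟨t, b.reindex e, fun i => by rw [ht, Module.Basis.reindex_apply]⟩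

theorem IsCoords.localization {A A' : Type} [CommRing A] [Algebra ℂ A] [CommRing A'] [Algebra ℂ A']
    [Algebra A A'] [IsScalarTower ℂ A A'] [Algebra.FormallyEtale A A'] {t : Fin 3 → A}
    (ht : IsCoords t) : IsCoords (fun i => algebraMap A A' (t i)) := by
  obtain ⟨b, hb⟩ := ht
  refine ⟨(b.baseChange A').map (tensorKaehlerEquivOfFormallyEtale ℂ A A'), fun i => ?_⟩
  simp [hb]

/-- Derivations are determined by, and can be prescribed on, coordinates. -/
theorem IsCoords.existsUnique_derivation {A : Type} [CommRing A] [Algebra ℂ A] {t : Fin 3 → A}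
    (ht : IsCoords t) (c : Fin 3 → A) : ∃! d : Derivation ℂ A A, ∀ i, d (t i) = c i := by
  obtain ⟨b, hb⟩ := ht
  refine ⟨(b.constr ℂ c).compDer (D ℂ A), fun i => ?_, fun d hd => ?_⟩
  · simp [← hb]
  · have : d.liftKaehlerDifferential = b.constr ℂ c := b.ext fun i => by
      rw [Module.Basis.constr_basis, hb, Derivation.liftKaehlerDifferential_comp_D, hd]
    rw [← this, Derivation.liftKaehlerDifferential_comp]

theorem IsCoords.derivation_ext {A M : Type} [CommRing A] [Algebra ℂ A] {t : Fin 3 → A}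
    [AddCommGroup M] [Module A M] [Module ℂ M] [IsScalarTower ℂ A M]
    (ht : IsCoords t) {d d' : Derivation ℂ A M} (h : ∀ i, d (t i) = d' (t i)) : d = d' := by
  obtain ⟨b, hb⟩ := ht
  have : d.liftKaehlerDifferential = d'.liftKaehlerDifferential := b.ext fun i => by
    rw [hb, Derivation.liftKaehlerDifferential_comp_D, Derivation.liftKaehlerDifferential_comp_D, h]
  rw [← Derivation.liftKaehlerDifferential_comp d, this, Derivation.liftKaehlerDifferential_comp]

/-- The coordinates identify the pulled back differentials of affine space with `Ω[A⁄ℂ]`. The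
cotangent sequence then kills the relative differentials and, `A` being smooth over ℂ, also the
first cotangent homology relative to affine space. -/
theorem IsCoords.etale {A : Type} [CommRing A] [Algebra ℂ A] [Algebra.Smooth ℂ A]
    {t : Fin 3 → A} (ht : IsCoords t) [Algebra (MvPolynomial (Fin 3) ℂ) A]
    [IsScalarTower ℂ (MvPolynomial (Fin 3) ℂ) A]
    (hX : ∀ i, algebraMap (MvPolynomial (Fin 3) ℂ) A (MvPolynomial.X i) = t i) :
    Algebra.Etale (MvPolynomial (Fin 3) ℂ) A := by
  obtain ⟨b, hb⟩ := ht
  let b' := (mvPolynomialBasis ℂ (Fin 3)).baseChange A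
  have hbb : ∀ i, mapBaseChange ℂ (MvPolynomial (Fin 3) ℂ) A (b' i) = b i := by
    intro i
    simp [b', hb, hX, mvPolynomialBasis_apply]
  have hbij : Function.Bijective (mapBaseChange ℂ (MvPolynomial (Fin 3) ℂ) A) := by
    have : mapBaseChange ℂ (MvPolynomial (Fin 3) ℂ) A = (b'.equiv b (Equiv.refl _)).toLinearMap :=
      b'.ext fun i => by simp [hbb]
    rw [this]
    exact (b'.equiv b (Equiv.refl _)).bijective
  have hΩ : Subsingleton Ω[A⁄MvPolynomial (Fin 3) ℂ] := by
    refine subsingleton_of_forall_eq 0 fun x => ?_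
    obtain ⟨y, rfl⟩ := KaehlerDifferential.map_surjective ℂ (MvPolynomial (Fin 3) ℂ) A x
    obtain ⟨z, rfl⟩ := hbij.2 y
    exact (exact_mapBaseChange_map ℂ (MvPolynomial (Fin 3) ℂ) A).apply_apply_eq_zero z
  have hH : Subsingleton (Algebra.H1Cotangent (MvPolynomial (Fin 3) ℂ) A) := by
    refine subsingleton_of_forall_eq 0 fun x => ?_
    have h1 : Algebra.H1Cotangent.δ ℂ (MvPolynomial (Fin 3) ℂ) A x = 0 := by
      refine hbij.1 ?_
      rw [map_zero]
      exact (Algebra.H1Cotangent.exact_δ_mapBaseChange ℂ (MvPolynomial (Fin 3) ℂ)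
        A).apply_apply_eq_zero x
    obtain ⟨y, rfl⟩ := (Algebra.H1Cotangent.exact_map_δ ℂ (MvPolynomial (Fin 3) ℂ) A x).1 h1
    rw [Subsingleton.elim y 0, map_zero]
  have h1 : Algebra.FormallyEtale (MvPolynomial (Fin 3) ℂ) A := ⟨hΩ, hH⟩
  have h2 : Algebra.FinitePresentation (MvPolynomial (Fin 3) ℂ) A :=
    Algebra.FinitePresentation.of_restrict_scalars_finitePresentation ℂ _ A
  exact ⟨h1, h2⟩

/-- Replacing some variables by constants alters a polynomial only by an element of the ideal of the
corresponding `X i - C (c i)`. Applied to a relation, the substitution kills one side, and the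
domain property cancels the remaining factor on the other. -/
theorem MvPolynomial.regTriple_X_sub_C (c : Fin 3 → ℂ) :
    RegTriple (R := MvPolynomial (Fin 3) ℂ) (MvPolynomial (Fin 3) ℂ)
      (MvPolynomial.X 0 - MvPolynomial.C (c 0))
      (MvPolynomial.X 1 - MvPolynomial.C (c 1)) (MvPolynomial.X 2 - MvPolynomial.C (c 2)) := by
  have hX : ∀ i, (MvPolynomial.X i - MvPolynomial.C (c i) : MvPolynomial (Fin 3) ℂ) ≠ 0 := by
    intro i h
    have := congrArg (MvPolynomial.eval (fun _ => c i + 1)) h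
    simp at this
  have key : ∀ (s : Fin 3 → MvPolynomial (Fin 3) ℂ) (I : Ideal (MvPolynomial (Fin 3) ℂ)),
      (∀ i, MvPolynomial.X i - s i ∈ I) → ∀ m, m - MvPolynomial.aeval s m ∈ I := by
    intro s I hI m
    have : (Ideal.Quotient.mkₐ ℂ I).comp (MvPolynomial.aeval s) = Ideal.Quotient.mkₐ ℂ I := by
      refine MvPolynomial.algHom_ext fun i => ?_
      simp only [AlgHom.comp_apply, MvPolynomial.aeval_X, Ideal.Quotient.mkₐ_eq_mk]
      exact (Ideal.Quotient.eq.2 (hI i)).symm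
    refine Ideal.Quotient.eq.1 ?_
    exact (DFunLike.congr_fun this m).symm
  refine ⟨fun m hm => (mul_eq_zero.1 hm).resolve_left (hX 0), fun m n hm => ?_,
    fun m n n' hm => ?_⟩
  · let s : Fin 3 → MvPolynomial (Fin 3) ℂ := ![MvPolynomial.C (c 0), MvPolynomial.X 1,
      MvPolynomial.X 2]
    have h1 := congrArg (MvPolynomial.aeval s) hm
    have h0 : MvPolynomial.aeval s m = 0 := by
      simp [s, MvPolynomial.algebraMap_eq] at h1
      exact h1.resolve_left (hX 1)
    have h2 := key s (Ideal.span {MvPolynomial.X 0 - MvPolynomial.C (c 0)}) (fun i => by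
      fin_cases i
      · exact Ideal.mem_span_singleton_self _
      · simp [s]
      · simp [s]) m
    rw [h0, sub_zero, Ideal.mem_span_singleton'] at h2
    obtain ⟨k, rfl⟩ := h2
    exact ⟨k, mul_comm _ _⟩
  · let s : Fin 3 → MvPolynomial (Fin 3) ℂ := ![MvPolynomial.C (c 0), MvPolynomial.C (c 1),
      MvPolynomial.X 2]
    have h1 := congrArg (MvPolynomial.aeval s) hm
    have h0 : MvPolynomial.aeval s m = 0 := by
      simp [s, MvPolynomial.algebraMap_eq] at h1
      exact h1.resolve_left (hX 2)
    have h2 := key s (Ideal.span {MvPolynomial.X 0 - MvPolynomial.C (c 0),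
        MvPolynomial.X 1 - MvPolynomial.C (c 1)}) (fun i => by
      fin_cases i
      · exact Ideal.subset_span (by simp [s])
      · exact Ideal.subset_span (by simp [s])
      · simp [s]) m
    rw [h0, sub_zero, Ideal.mem_span_pair] at h2
    obtain ⟨k, k', rfl⟩ := h2
    exact ⟨k, k', by rw [smul_eq_mul, smul_eq_mul]; ring⟩

open RingTheory.Sequence in
/-- The local ring of a smooth threefold at a closed point is regular of dimension three. -/
theorem IsCoords.exists_regTriple {A : Type} [CommRing A] [Algebra ℂ A] [Algebra.Smooth ℂ A]
    {t : Fin 3 → A} (ht : IsCoords t) (p : Ideal A) [hp : p.IsMaximal] :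
    ∃ x y z : Localization.AtPrime p, RegTriple (Localization.AtPrime p) x y z ∧
      Ideal.ofList [x, y, z] = IsLocalRing.maximalIdeal (Localization.AtPrime p) := by
  let alg : Algebra (MvPolynomial (Fin 3) ℂ) A := (MvPolynomial.aeval t).toAlgebra
  have tow : IsScalarTower ℂ (MvPolynomial (Fin 3) ℂ) A :=
    IsScalarTower.of_algebraMap_eq fun r => (AlgHom.commutes (MvPolynomial.aeval t) r).symm
  have hX : ∀ i, algebraMap (MvPolynomial (Fin 3) ℂ) A (MvPolynomial.X i) = t i :=
    fun i => MvPolynomial.aeval_X t i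
  have het := ht.etale hX
  let K := Ideal.Quotient.field p
  -- By the Nullstellensatz the residue field is ℂ, so each coordinate takes a constant value `c i`
  -- at `p`.
  have hfin : Module.Finite ℂ (A ⧸ p) := finite_of_finite_type_of_isJacobsonRing ℂ (A ⧸ p)
  have hsurj : Function.Surjective (algebraMap ℂ (A ⧸ p)) :=
    (IsAlgClosed.algebraMap_bijective_of_isIntegral (k := ℂ) (K := A ⧸ p)).2
  choose c hc using fun i => hsurj (Ideal.Quotient.mk p (t i))
  let x : Fin 3 → MvPolynomial (Fin 3) ℂ := fun i => MvPolynomial.X i - MvPolynomial.C (c i)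
  let n : Ideal (MvPolynomial (Fin 3) ℂ) := p.under _
  have hxn : ∀ i, x i ∈ n := by
    intro i
    change algebraMap _ A _ ∈ p
    rw [map_sub, hX, ← MvPolynomial.algebraMap_eq, ← IsScalarTower.algebraMap_apply,
      ← Ideal.Quotient.eq, ← hc]
    rfl
  have hn : n = Ideal.ofList [x 0, x 1, x 2] := by
    refine le_antisymm (fun m hm => ?_) ?_
    · have h0 : Ideal.ofList [x 0, x 1, x 2] ≤ n := by
        refine Ideal.span_le.2 ?_
        simpa [Set.insert_subset_iff, Set.subset_def] using ⟨hxn 0, hxn 1, hxn 2⟩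
      have h1 : m - MvPolynomial.C (MvPolynomial.aeval c m) ∈ Ideal.ofList [x 0, x 1, x 2] := by
        refine Ideal.Quotient.eq.1 ?_
        have : ((Ideal.Quotient.mkₐ ℂ (Ideal.ofList [x 0, x 1, x 2])).comp
            (Algebra.ofId ℂ (MvPolynomial (Fin 3) ℂ))).comp (MvPolynomial.aeval c) =
            Ideal.Quotient.mkₐ ℂ (Ideal.ofList [x 0, x 1, x 2]) := by
          refine MvPolynomial.algHom_ext fun i => ?_
          simp only [AlgHom.comp_apply, MvPolynomial.aeval_X, Ideal.Quotient.mkₐ_eq_mk]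
          refine (Ideal.Quotient.eq.2 (Ideal.subset_span ?_)).symm
          fin_cases i <;> simp [x, Algebra.ofId_apply, MvPolynomial.algebraMap_eq]
        exact (DFunLike.congr_fun this m).symm
      have h2 : MvPolynomial.aeval c m = 0 := by
        by_contra h3
        have h4 : MvPolynomial.C (MvPolynomial.aeval c m) ∈ n := by
          simpa using sub_mem hm (h0 h1)
        have h5 : n.IsPrime := inferInstance
        exact h5.ne_top (Ideal.eq_top_of_isUnit_mem _ h4 ((isUnit_iff_ne_zero.2 h3).map _))
      simpa [h2] using h1
    · refine Ideal.span_le.2 ?_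
      simpa [Set.insert_subset_iff, Set.subset_def] using ⟨hxn 0, hxn 1, hxn 2⟩
  have : n.IsPrime := inferInstance
  have lies : p.LiesOver n := ⟨rfl⟩
  -- An étale map is unramified, so the translated coordinates generate the maximal ideal upstairs;
  -- it is flat, so they remain a regular sequence.
  have hmax : n.map (algebraMap (MvPolynomial (Fin 3) ℂ) (Localization.AtPrime p)) =
      IsLocalRing.maximalIdeal _ := by
    let := Localization.AtPrime.algebraOfLiesOver n p
    exact ((Algebra.isUnramifiedAt_iff_map_eq (MvPolynomial (Fin 3) ℂ) n p).1 inferInstance).2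
  have hflat : Module.Flat (MvPolynomial (Fin 3) ℂ) (Localization.AtPrime p) :=
    Module.Flat.trans _ A _
  have hreg : IsWeaklyRegular (MvPolynomial (Fin 3) ℂ) [x 0, x 1, x 2] :=
    regTriple_iff.1 (MvPolynomial.regTriple_X_sub_C c)
  refine ⟨_, _, _, regTriple_iff.2 (hreg.of_flat (S := Localization.AtPrime p)), ?_⟩
  rw [← hmax, hn, Ideal.map_ofList]
  rfl

end EtaleCoordinates

/-! ### Restriction, gluing, local bases and evaluation of forms and vector fields. -/

section Toolkit

variable {X : Scheme.{0}} {U V W : X.Opens}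

@[simp] theorem resO_rfl (a : Γ(X, V)) (h : V ≤ V) : resO h a = a := by
  simp only [resO]
  rw [show (homOfLE h).op = 𝟙 (op V) from rfl, CategoryTheory.Functor.map_id]
  rfl

@[simp] theorem resM_rfl (M : X.Modules) (m : Γ(M, V)) (h : V ≤ V) : resM M h m = m := by
  simp only [resM]
  rw [show (homOfLE h).op = 𝟙 (op V) from rfl, CategoryTheory.Functor.map_id]
  rfl

theorem resO_injective [IsIntegral X] (h : W ≤ V) (hW : (W : Set X).Nonempty) :
    Function.Injective (resO h) := by
  have : Nonempty W := hW.to_subtype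
  exact map_injective_of_isIntegral X (homOfLE h)

theorem isDomain_section [IsIntegral X] (hV : (V : Set X).Nonempty) : IsDomain Γ(X, V) := by
  have : Nonempty V := hV.to_subtype
  infer_instance

theorem subsingleton_section (hV : ¬ (V : Set X).Nonempty) : Subsingleton Γ(X, V) :=
  ⟨fun _ _ => resO_ext fun x hx => (hV ⟨x, hx⟩).elim⟩

theorem resM_ext {M : X.Modules} {a b : Γ(M, V)}
    (h : ∀ x ∈ V, ∃ (W : X.Opens) (hWV : W ≤ V), x ∈ W ∧ resM M hWV a = resM M hWV b) : a = b := by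
  choose W hW hx he using h
  refine TopCat.Sheaf.eq_of_locally_eq' ⟨M.presheaf, M.isSheaf⟩ (fun x : V => W x.1 x.2) V
    (fun x => homOfLE (hW x.1 x.2)) ?_ a b ?_
  · intro x hxV
    exact Opens.mem_iSup.mpr ⟨⟨x, hxV⟩, hx x hxV⟩
  · intro x
    exact he x.1 x.2

theorem resM_glue (M : X.Modules) {ι : Type} (W : ι → X.Opens) (hW : ∀ i, W i ≤ V)
    (hc : V ≤ iSup W) (a : ∀ i, Γ(M, W i))
    (h : ∀ i j, resM M (inf_le_left : W i ⊓ W j ≤ W i) (a i) = resM M inf_le_right (a j)) :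
    ∃ b : Γ(M, V), ∀ i, resM M (hW i) b = a i := by
  obtain ⟨b, hb, -⟩ := TopCat.Sheaf.existsUnique_gluing' ⟨M.presheaf, M.isSheaf⟩ W V
    (fun i => homOfLE (hW i)) hc a h
  exact ⟨b, hb⟩

theorem subsingleton_sectionM (M : X.Modules) (hV : ¬ (V : Set X).Nonempty) :
    Subsingleton Γ(M, V) :=
  ⟨fun _ _ => resM_ext fun x hx => (hV ⟨x, hx⟩).elim⟩

/-- A section of the structure sheaf characterized by a local property. -/
theorem exists_section_of_local (R : ∀ W : X.Opens, W ≤ V → Γ(X, W) → Prop)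
    (hres : ∀ {W W' : X.Opens} (h : W ≤ V) (h' : W' ≤ W) a, R W h a → R W' (h'.trans h) (resO h' a))
    (huniq : ∀ {W : X.Opens} (h : W ≤ V) a b, R W h a → R W h b → a = b)
    (hloc : ∀ x ∈ V, ∃ (W : X.Opens) (h : W ≤ V), x ∈ W ∧ ∃ a, R W h a) :
    ∃ a : Γ(X, V), ∀ W h b, R W h b → resO h a = b := by
  choose W hW hx a ha using hloc
  obtain ⟨b, hb⟩ := resO_glue (V := V) (fun x : V => W x.1 x.2) (fun x => hW x.1 x.2)
    (fun x hxV => Opens.mem_iSup.mpr ⟨⟨x, hxV⟩, hx x hxV⟩) (fun x => a x.1 x.2)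
    (fun i j => huniq (inf_le_left.trans (hW i.1 i.2)) _ _ (hres _ _ _ (ha i.1 i.2))
      (hres (hW j.1 j.2) _ _ (ha j.1 j.2)))
  refine ⟨b, fun W' h c hc => resO_ext fun x hxW => ?_⟩
  refine ⟨W' ⊓ W x (h hxW), inf_le_left, ⟨hxW, hx _ _⟩, ?_⟩
  rw [resO_resO]
  refine Eq.trans ?_ (huniq (inf_le_left.trans h) _ _
    (hres (hW x (h hxW)) inf_le_right _ (ha x (h hxW))) (hres h inf_le_left _ hc))
  rw [← hb ⟨x, h hxW⟩, resO_resO]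

/-- A section of a sheaf of modules characterized by a local property. -/
theorem exists_sectionM_of_local (M : X.Modules) (R : ∀ W : X.Opens, W ≤ V → Γ(M, W) → Prop)
    (hres : ∀ {W W' : X.Opens} (h : W ≤ V) (h' : W' ≤ W) a, R W h a →
      R W' (h'.trans h) (resM M h' a))
    (huniq : ∀ {W : X.Opens} (h : W ≤ V) a b, R W h a → R W h b → a = b)
    (hloc : ∀ x ∈ V, ∃ (W : X.Opens) (h : W ≤ V), x ∈ W ∧ ∃ a, R W h a) :
    ∃ a : Γ(M, V), ∀ W h b, R W h b → resM M h a = b := by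
  choose W hW hx a ha using hloc
  obtain ⟨b, hb⟩ := resM_glue (V := V) M (fun x : V => W x.1 x.2) (fun x => hW x.1 x.2)
    (fun x hxV => Opens.mem_iSup.mpr ⟨⟨x, hxV⟩, hx x hxV⟩) (fun x => a x.1 x.2)
    (fun i j => huniq (inf_le_left.trans (hW i.1 i.2)) _ _ (hres _ _ _ (ha i.1 i.2))
      (hres (hW j.1 j.2) _ _ (ha j.1 j.2)))
  refine ⟨b, fun W' h c hc => resM_ext fun x hxW => ?_⟩
  refine ⟨W' ⊓ W x (h hxW), inf_le_left, ⟨hxW, hx _ _⟩, ?_⟩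
  rw [resM_resM]
  refine Eq.trans ?_ (huniq (inf_le_left.trans h) _ _
    (hres (hW x (h hxW)) inf_le_right _ (ha x (h hxW))) (hres h inf_le_left _ hc))
  rw [← hb ⟨x, h hxW⟩, resM_resM]

/-- Nonzero functions on an integral scheme can be cancelled. -/
theorem eq_zero_of_resO_mul [IsIntegral X] (h : V ≤ U) {a : Γ(X, U)} (ha : a ≠ 0) {b : Γ(X, V)}
    (hab : resO h a * b = 0) : b = 0 := by
  by_cases hV : (V : Set X).Nonempty
  · have := isDomain_section hV
    refine (mul_eq_zero.1 hab).resolve_left fun h0 => ha ?_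
    exact resO_injective h hV (h0.trans (map_zero _).symm)
  · have := subsingleton_section hV
    exact Subsingleton.elim _ _

theorem resM_app {M N : X.Modules} (φ : M ⟶ N) (h : W ≤ V) (m : Γ(M, V)) :
    resM N h (φ.app V m) = φ.app W (resM M h m) :=
  (ConcreteCategory.congr_hom (φ.mapPresheaf.naturality (homOfLE h).op) m).symm

theorem sum_smul_resM {ι : Type} [Fintype ι] (M : X.Modules) (h : W ≤ V) (c : ι → Γ(X, V))
    (e : ι → Γ(M, V)) : resM M h (∑ i, c i • e i) = ∑ i, resO h (c i) • resM M h (e i) := by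
  simp only [map_sum, resM_smul]

/-- The sections `e i` of `M` over `U` form a basis over every open `V ≤ U`. -/
def IsBasisOver {ι : Type} [Fintype ι] (M : X.Modules) (U : X.Opens) (e : ι → Γ(M, U)) : Prop :=
  ∀ (V : X.Opens) (h : V ≤ U),
    Function.Bijective fun c : ι → Γ(X, V) => ∑ i, c i • resM M h (e i)

/-- The section `g` of `M` over `U` generates `M` freely over every open `V ≤ U`. -/
def IsGen (M : X.Modules) (U : X.Opens) (g : Γ(M, U)) : Prop :=
  ∀ (V : X.Opens) (h : V ≤ U), Function.Bijective fun c : Γ(X, V) => c • resM M h g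

theorem IsGen.isBasisOver {M : X.Modules} {g : Γ(M, U)} (hg : IsGen M U g) :
    IsBasisOver M U fun _ : Unit => g := by
  intro V h
  have := (hg V h).comp (Equiv.funUnique Unit Γ(X, V)).bijective
  convert this using 2 with c
  simp

theorem IsGen.res {M : X.Modules} {g : Γ(M, U)} (hg : IsGen M U g) (h : V ≤ U) :
    IsGen M V (resM M h g) := by
  intro W hW
  simpa only [resM_resM] using hg W (hW.trans h)

theorem IsGen.exists_smul {M : X.Modules} {g : Γ(M, U)} (hg : IsGen M U g) (h : V ≤ U)
    (m : Γ(M, V)) : ∃ c : Γ(X, V), m = c • resM M h g := by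
  obtain ⟨c, hc⟩ := (hg V h).2 m
  exact ⟨c, hc.symm⟩

/-- The coefficient of a section of `M` with respect to a generator. -/
def IsGen.coef {M : X.Modules} {g : Γ(M, U)} (hg : IsGen M U g) (h : V ≤ U) (m : Γ(M, V)) :
    Γ(X, V) := (hg.exists_smul h m).choose

theorem IsGen.coef_smul {M : X.Modules} {g : Γ(M, U)} (hg : IsGen M U g) (h : V ≤ U)
    (m : Γ(M, V)) : hg.coef h m • resM M h g = m := (hg.exists_smul h m).choose_spec.symm

theorem IsGen.coef_eq {M : X.Modules} {g : Γ(M, U)} (hg : IsGen M U g) (h : V ≤ U)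
    {m : Γ(M, V)} {c : Γ(X, V)} (hc : m = c • resM M h g) : hg.coef h m = c :=
  (hg V h).1 ((hg.coef_smul h m).trans hc)

theorem IsGen.coef_add {M : X.Modules} {g : Γ(M, U)} (hg : IsGen M U g) (h : V ≤ U)
    (m n : Γ(M, V)) : hg.coef h (m + n) = hg.coef h m + hg.coef h n :=
  hg.coef_eq h (by rw [add_smul, hg.coef_smul, hg.coef_smul])

theorem IsGen.coef_smul_left {M : X.Modules} {g : Γ(M, U)} (hg : IsGen M U g) (h : V ≤ U)
    (a : Γ(X, V)) (m : Γ(M, V)) : hg.coef h (a • m) = a * hg.coef h m :=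
  hg.coef_eq h (by rw [mul_smul, hg.coef_smul])

theorem IsGen.coef_res {M : X.Modules} {g : Γ(M, U)} (hg : IsGen M U g) (h : V ≤ U) (hW : W ≤ V)
    (m : Γ(M, V)) : hg.coef (hW.trans h) (resM M hW m) = resO hW (hg.coef h m) :=
  hg.coef_eq _ (by rw [← resM_resM M hW h, ← resM_smul, hg.coef_smul])

theorem IsGen.coef_self {M : X.Modules} {g : Γ(M, U)} (hg : IsGen M U g) (h : V ≤ U) :
    hg.coef h (resM M h g) = 1 :=
  hg.coef_eq h (one_smul _ _).symm

theorem IsBasisOver.res {ι : Type} [Fintype ι] {M : X.Modules} {e : ι → Γ(M, U)}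
    (he : IsBasisOver M U e) (h : V ≤ U) : IsBasisOver M V fun i => resM M h (e i) := by
  intro W hW
  simpa only [resM_resM] using he W (hW.trans h)

/-- The module of sections over `V` is free. -/
def IsBasisOver.coord {ι : Type} [Fintype ι] {M : X.Modules} {e : ι → Γ(M, U)}
    (he : IsBasisOver M U e) (h : V ≤ U) : Γ(M, V) ≃ₗ[Γ(X, V)] (ι → Γ(X, V)) :=
  (LinearEquiv.ofBijective
    { toFun := fun c => ∑ i, c i • resM M h (e i)
      map_add' := fun c d => by simp only [Pi.add_apply, add_smul, Finset.sum_add_distrib]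
      map_smul' := fun a c => by
        simp only [Pi.smul_apply, smul_eq_mul, mul_smul, Finset.smul_sum, RingHom.id_apply] }
    (he V h)).symm

theorem IsBasisOver.coord_symm_apply {ι : Type} [Fintype ι] {M : X.Modules} {e : ι → Γ(M, U)}
    (he : IsBasisOver M U e) (h : V ≤ U) (c : ι → Γ(X, V)) :
    (he.coord h).symm c = ∑ i, c i • resM M h (e i) := rfl

theorem IsBasisOver.coord_res {ι : Type} [Fintype ι] {M : X.Modules} {e : ι → Γ(M, U)}
    (he : IsBasisOver M U e) (h : V ≤ U) (hW : W ≤ V) (m : Γ(M, V)) :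
    he.coord (hW.trans h) (resM M hW m) = fun i => resO hW (he.coord h m i) := by
  rw [← (he.coord h).symm_apply_apply m, LinearEquiv.apply_symm_apply, ← LinearEquiv.eq_symm_apply,
    he.coord_symm_apply, he.coord_symm_apply, sum_smul_resM]
  simp only [resM_resM]

theorem IsBasisOver.coord_basis {ι : Type} [Fintype ι] [DecidableEq ι] {M : X.Modules}
    {e : ι → Γ(M, U)} (he : IsBasisOver M U e) (h : V ≤ U) (i : ι) :
    he.coord h (resM M h (e i)) = Pi.single i 1 := by
  rw [← LinearEquiv.eq_symm_apply, he.coord_symm_apply]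
  simp [Pi.single_apply, ite_smul]

theorem IsBasisOver.resM_injective [IsIntegral X] {ι : Type} [Fintype ι] {M : X.Modules}
    {e : ι → Γ(M, U)} (he : IsBasisOver M U e) (h : V ≤ U) (hW : W ≤ V)
    (hW0 : (W : Set X).Nonempty) : Function.Injective (resM M hW) := by
  intro m n hmn
  refine (he.coord h).injective (funext fun i => resO_injective hW hW0 ?_)
  have := congrFun (congrArg (he.coord (hW.trans h)) hmn) i
  rwa [he.coord_res, he.coord_res] at this

/-- A local criterion for generators. -/
theorem IsGen.of_local {M : X.Modules} {g : Γ(M, U)}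
    (hinj : ∀ (V : X.Opens) (h : V ≤ U) (c : Γ(X, V)), c • resM M h g = 0 → c = 0)
    (hsurj : ∀ (V : X.Opens) (h : V ≤ U) (m : Γ(M, V)), ∀ x ∈ V, ∃ (W : X.Opens) (hW : W ≤ V),
      x ∈ W ∧ ∃ c : Γ(X, W), resM M hW m = c • resM M (hW.trans h) g) : IsGen M U g := by
  have hinj' : ∀ (V : X.Opens) (h : V ≤ U) (c d : Γ(X, V)), c • resM M h g = d • resM M h g →
      c = d := fun V h c d hcd => sub_eq_zero.1 (hinj V h _ (by rw [sub_smul, hcd, sub_self]))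
  refine fun V h => ⟨fun c d => hinj' V h c d, fun m => ?_⟩
  obtain ⟨c, hc⟩ := exists_section_of_local (V := V)
    (fun W hW c => resM M hW m = c • resM M (hW.trans h) g)
    (fun hW hW' c hc => by rw [← resM_resM M hW' hW, hc, resM_smul, resM_resM])
    (fun hW c d hc hd => hinj' _ _ _ _ (hc.symm.trans hd)) (hsurj V h m)
  refine ⟨c, resM_ext fun x hx => ?_⟩
  obtain ⟨W, hW, hxW, d, hd⟩ := hsurj V h m x hx
  exact ⟨W, hW, hxW, by rw [hd, resM_smul, resM_resM, hc W hW d hd]⟩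

/-- The value of a linear form. -/
def lev {M : X.Modules} (l : Γ(dual M, U)) (h : V ≤ U) (m : Γ(M, V)) : Γ(X, V) :=
  LocalOps.Sec.fn (D := linOps M) l V h m

section

variable {M : X.Modules}

@[simp] theorem lev_add (a b : Γ(dual M, U)) (h : V ≤ U) (m : Γ(M, V)) :
    lev (a + b) h m = lev a h m + lev b h m := rfl

@[simp] theorem lev_smul (c : Γ(X, U)) (a : Γ(dual M, U)) (h : V ≤ U) (m : Γ(M, V)) :
    lev (c • a) h m = resO h c * lev a h m := rfl

@[simp] theorem lev_zero (h : V ≤ U) (m : Γ(M, V)) :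
    lev (0 : Γ(dual M, U)) h m = 0 := rfl

@[simp] theorem lev_res (hV : V ≤ U) (a : Γ(dual M, U)) (h : W ≤ V) (m : Γ(M, W)) :
    lev (resM (dual M) hV a) h m = lev a (h.trans hV) m := rfl

theorem lev_ext {a b : Γ(dual M, U)}
    (H : ∀ V (h : V ≤ U) m, lev a h m = lev b h m) : a = b :=
  LocalOps.Sec.ext (funext fun V => funext fun hV => funext fun m => H V hV m)

@[simp] theorem lev_sum {ι : Type} (t : Finset ι) (a : ι → Γ(dual M, U)) (h : V ≤ U)
    (m : Γ(M, V)) : lev (∑ i ∈ t, a i) h m = ∑ i ∈ t, lev (a i) h m :=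
  map_sum (AddMonoidHom.mk' (fun a : Γ(dual M, U) => lev a h m)
    fun a b => lev_add a b h m) _ _

@[simp] theorem resO_lev (l : Γ(dual M, U)) (h : V ≤ U) (hW : W ≤ V) (m : Γ(M, V)) :
    resO hW (lev l h m) = lev l (hW.trans h) (resM M hW m) :=
  LocalOps.Sec.compat (D := linOps M) l hW h m

theorem lev_map_add (l : Γ(dual M, U)) (h : V ≤ U) (m n : Γ(M, V)) :
    lev l h (m + n) = lev l h m + lev l h n :=
  (LocalOps.Sec.mem (D := linOps M) l V h).1 m n

theorem lev_map_smul (l : Γ(dual M, U)) (h : V ≤ U) (a : Γ(X, V)) (m : Γ(M, V)) :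
    lev l h (a • m) = a * lev l h m :=
  (LocalOps.Sec.mem (D := linOps M) l V h).2 a m

/-- The value of a linear form over `V`, as a linear map. -/
def levₗ (l : Γ(dual M, U)) (h : V ≤ U) : Γ(M, V) →ₗ[Γ(X, V)] Γ(X, V) where
  toFun := lev l h
  map_add' := lev_map_add l h
  map_smul' := lev_map_smul l h

@[simp] theorem levₗ_apply (l : Γ(dual M, U)) (h : V ≤ U) (m : Γ(M, V)) :
    levₗ l h m = lev l h m := rfl

theorem evalLin_eq (l : Γ(dual M, V)) (m : Γ(M, V)) : evalLin l m = lev l le_rfl m := rfl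

/-- Linear forms over `U` from a compatible family of linear maps. -/
theorem exists_lev (g : ∀ V : X.Opens, V ≤ U → Γ(M, V) → Γ(X, V))
    (hadd : ∀ V h m n, g V h (m + n) = g V h m + g V h n)
    (hsmul : ∀ V h (a : Γ(X, V)) m, g V h (a • m) = a * g V h m)
    (hres : ∀ {W V : X.Opens} (hW : W ≤ V) (h : V ≤ U) m,
      resO hW (g V h m) = g W (hW.trans h) (resM M hW m)) :
    ∃ l : Γ(dual M, U), ∀ V (h : V ≤ U) m, lev l h m = g V h m :=
  ⟨(show (linOps M).Sec U from ⟨g, fun V h => ⟨hadd V h, hsmul V h⟩, hres⟩), fun _ _ _ => rfl⟩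

end

/-- The value of an alternating form. -/
def aev {M : X.Modules} {r : ℕ} (l : Γ(altSheaf M r, U)) (h : V ≤ U) (m : Fin r → Γ(M, V)) : Γ(X, V) :=
  LocalOps.Sec.fn (D := altOps M r) l V h m

section

variable {M : X.Modules} {r : ℕ}

@[simp] theorem aev_add (a b : Γ(altSheaf M r, U)) (h : V ≤ U) (m : Fin r → Γ(M, V)) :
    aev (a + b) h m = aev a h m + aev b h m := rfl

@[simp] theorem aev_smul (c : Γ(X, U)) (a : Γ(altSheaf M r, U)) (h : V ≤ U) (m : Fin r → Γ(M, V)) :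
    aev (c • a) h m = resO h c * aev a h m := rfl

@[simp] theorem aev_res (hV : V ≤ U) (a : Γ(altSheaf M r, U)) (h : W ≤ V) (m : Fin r → Γ(M, W)) :
    aev (resM (altSheaf M r) hV a) h m = aev a (h.trans hV) m := rfl

theorem aev_ext {a b : Γ(altSheaf M r, U)}
    (H : ∀ V (h : V ≤ U) m, aev a h m = aev b h m) : a = b :=
  LocalOps.Sec.ext (funext fun V => funext fun hV => funext fun m => H V hV m)

@[simp] theorem resO_aev (l : Γ(altSheaf M r, U)) (h : V ≤ U) (hW : W ≤ V) (m : Fin r → Γ(M, V)) :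
    resO hW (aev l h m) = aev l (hW.trans h) (fun i => resM M hW (m i)) :=
  LocalOps.Sec.compat (D := altOps M r) l hW h m

/-- The value of an alternating form over `V`, as an alternating map. -/
def aevₗ (l : Γ(altSheaf M r, U)) (h : V ≤ U) : Γ(M, V) [⋀^Fin r]→ₗ[Γ(X, V)] Γ(X, V) where
  toFun := aev l h
  map_update_add' {inst} m i x y := by
    obtain rfl : inst = instDecidableEqFin r := Subsingleton.elim _ _
    exact (LocalOps.Sec.mem (D := altOps M r) l V h).1 m i x y
  map_update_smul' {inst} m i a x := by
    obtain rfl : inst = instDecidableEqFin r := Subsingleton.elim _ _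
    exact (LocalOps.Sec.mem (D := altOps M r) l V h).2.1 m i a x
  map_eq_zero_of_eq' m i j := (LocalOps.Sec.mem (D := altOps M r) l V h).2.2 m i j

@[simp] theorem aevₗ_apply (l : Γ(altSheaf M r, U)) (h : V ≤ U) (m : Fin r → Γ(M, V)) :
    aevₗ l h m = aev l h m := rfl

/-- Alternating forms over `U` from a compatible family of alternating maps. -/
theorem exists_aev (g : ∀ V : X.Opens, V ≤ U → Γ(M, V) [⋀^Fin r]→ₗ[Γ(X, V)] Γ(X, V))
    (hres : ∀ {W V : X.Opens} (hW : W ≤ V) (h : V ≤ U) m,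
      resO hW (g V h m) = g W (hW.trans h) fun i => resM M hW (m i)) :
    ∃ l : Γ(altSheaf M r, U), ∀ V (h : V ≤ U) m, aev l h m = g V h m :=
  ⟨(show (altOps M r).Sec U from ⟨fun V h => g V h, fun V h => ⟨fun m i x y =>
    (g V h).map_update_add m i x y, fun m i a x => (g V h).map_update_smul m i a x,
    fun m _ _ hm hij => (g V h).map_eq_zero_of_eq m hm hij⟩, hres⟩), fun _ _ _ => rfl⟩

end

/-- The value of a derivation. -/
def dev {f : X ⟶ Spec (.of ℂ)} (l : Γ(tangentSheaf f, U)) (h : V ≤ U) (m : Γ(X, V)) : Γ(X, V) :=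
  LocalOps.Sec.fn (D := derOps f) l V h m

section

variable {f : X ⟶ Spec (.of ℂ)}

@[simp] theorem dev_add (a b : Γ(tangentSheaf f, U)) (h : V ≤ U) (m : Γ(X, V)) :
    dev (a + b) h m = dev a h m + dev b h m := rfl

@[simp] theorem dev_smul (c : Γ(X, U)) (a : Γ(tangentSheaf f, U)) (h : V ≤ U) (m : Γ(X, V)) :
    dev (c • a) h m = resO h c * dev a h m := rfl

@[simp] theorem dev_zero (h : V ≤ U) (m : Γ(X, V)) :
    dev (0 : Γ(tangentSheaf f, U)) h m = 0 := rfl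

@[simp] theorem dev_res (hV : V ≤ U) (a : Γ(tangentSheaf f, U)) (h : W ≤ V) (m : Γ(X, W)) :
    dev (resM (tangentSheaf f) hV a) h m = dev a (h.trans hV) m := rfl

theorem dev_ext {a b : Γ(tangentSheaf f, U)}
    (H : ∀ V (h : V ≤ U) m, dev a h m = dev b h m) : a = b :=
  LocalOps.Sec.ext (funext fun V => funext fun hV => funext fun m => H V hV m)

@[simp] theorem dev_sum {ι : Type} (t : Finset ι) (a : ι → Γ(tangentSheaf f, U)) (h : V ≤ U)
    (m : Γ(X, V)) : dev (∑ i ∈ t, a i) h m = ∑ i ∈ t, dev (a i) h m :=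
  map_sum (AddMonoidHom.mk' (fun a : Γ(tangentSheaf f, U) => dev a h m)
    fun a b => dev_add a b h m) _ _

@[simp] theorem resO_dev (d : Γ(tangentSheaf f, U)) (h : V ≤ U) (hW : W ≤ V) (a : Γ(X, V)) :
    resO hW (dev d h a) = dev d (hW.trans h) (resO hW a) :=
  LocalOps.Sec.compat (D := derOps f) d hW h a

theorem dev_mem (d : Γ(tangentSheaf f, U)) (h : V ≤ U) :
    (∀ a b, dev d h (a + b) = dev d h a + dev d h b) ∧
    (∀ a b, dev d h (a * b) = a * dev d h b + b * dev d h a) ∧ ∀ c : ℂ, dev d h (cst f V c) = 0 :=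
  LocalOps.Sec.mem (D := derOps f) d V h

end

/-- The basic opens of an affine open form a basis of its topology. -/
theorem exists_basicOpen_le {U : X.Opens} (hU : IsAffineOpen U) {V : X.Opens} {x : X} (hx : x ∈ V)
    (hxU : x ∈ U) : ∃ a : Γ(X, U), X.basicOpen a ≤ V ∧ x ∈ X.basicOpen a :=
  hU.exists_basicOpen_le ⟨x, hx⟩ hxU

end Toolkit

/-! ### Morphisms of sheaves of modules on sections, sheafification and tensor products. -/

section SheafTheory

variable {X : Scheme.{0}} {U V W : X.Opens}

/-- Sections over `V`, as a functor. -/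
def sectionsFunctor (V : X.Opens) : X.Modules ⥤ Ab :=
  Scheme.Modules.toPresheaf X ⋙ (evaluation _ _).obj (op V)

instance (V : X.Opens) : Limits.PreservesFiniteLimits (sectionsFunctor V) :=
  have : Limits.PreservesFiniteLimits ((evaluation (Opens X)ᵒᵖ Ab.{0}).obj (op V)) :=
    ⟨fun _ _ _ => Limits.evaluation_preservesLimitsOfShape _⟩
  Limits.comp_preservesFiniteLimits (Scheme.Modules.toPresheaf X) ((evaluation _ _).obj (op V))

instance (V : X.Opens) : (sectionsFunctor V).PreservesZeroMorphisms where
  map_zero _ _ := rfl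

theorem app_injective {M N : X.Modules} (φ : M ⟶ N) [Mono φ] (V : X.Opens) :
    Function.Injective (φ.app V) := by
  have : Mono ((sectionsFunctor V).map φ) := inferInstance
  exact (AddCommGrpCat.mono_iff_injective _).1 this

theorem exists_app_eq {S : ShortComplex X.Modules} (hS : S.Exact) [Mono S.f] (V : X.Opens)
    {m : Γ(S.X₂, V)} (hm : S.g.app V m = 0) : ∃ n : Γ(S.X₁, V), S.f.app V n = m := by
  have := hS.map_of_mono_of_preservesKernel (sectionsFunctor V) inferInstance inferInstance
  exact (ShortComplex.ab_exact_iff _).1 this m hm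

theorem app_comp_apply {M N K : X.Modules} (φ : M ⟶ N) (ψ : N ⟶ K) (V : X.Opens) (m : Γ(M, V)) :
    (φ ≫ ψ).app V m = ψ.app V (φ.app V m) := rfl

theorem modules_hom_ext {M N : X.Modules} {φ ψ : M ⟶ N}
    (h : ∀ (V : X.Opens) (m : Γ(M, V)), φ.app V m = ψ.app V m) : φ = ψ :=
  Scheme.Modules.hom_ext _ _ fun V => ConcreteCategory.hom_ext _ _ (h V)

/-- A morphism of sheaves of modules from its action on sections. -/
def homOfApp {M N : X.Modules} (g : ∀ V : X.Opens, Γ(M, V) → Γ(N, V))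
    (hadd : ∀ V m n, g V (m + n) = g V m + g V n)
    (hsmul : ∀ V (a : Γ(X, V)) m, g V (a • m) = a • g V m)
    (hres : ∀ {W V : X.Opens} (h : W ≤ V) m, resM N h (g V m) = g W (resM M h m)) : M ⟶ N :=
  SheafOfModules.Hom.mk
    { app := fun V => ModuleCat.ofHom
        { toFun := g V.unop
          map_add' := hadd V.unop
          map_smul' := hsmul V.unop }
      naturality := fun {V W} i => by
        ext m
        exact (hres i.unop.le m).symm }

theorem homOfApp_app {M N : X.Modules} (g : ∀ V : X.Opens, Γ(M, V) → Γ(N, V)) (hadd hsmul)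
    (hres : ∀ {W V : X.Opens} (h : W ≤ V) m, resM N h (g V m) = g W (resM M h m)) (V : X.Opens)
    (m : Γ(M, V)) : (homOfApp g hadd hsmul hres).app V m = g V m := rfl

theorem isIso_of_bijective {M N : X.Modules} (φ : M ⟶ N)
    (h : ∀ V, Function.Bijective (φ.app V)) : IsIso φ :=
  Scheme.Modules.Hom.isIso_iff_isIso_app.2 fun V => (ConcreteCategory.isIso_iff_bijective _).2 (h V)

theorem app_bijective {M N : X.Modules} (φ : M ⟶ N) [IsIso φ] (V : X.Opens) :
    Function.Bijective (φ.app V) :=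
  (ConcreteCategory.isIso_iff_bijective _).1 inferInstance

abbrev shf (P : X.PresheafOfModules) : X.Modules :=
  (PresheafOfModules.sheafification (𝟙 X.ringCatSheaf.obj)).obj P

/-- Apart from linearity and compatibility with restriction, the only facts used about
sheafification are that this map is locally injective and locally surjective. -/
def shUnit (P : X.PresheafOfModules) (V : X.Opens) (m : P.obj (op V)) : Γ(shf P, V) :=
  ((PresheafOfModules.sheafificationAdjunction (𝟙 X.ringCatSheaf.obj)).unit.app P).app (op V) m

theorem shUnit_add (P : X.PresheafOfModules) (V : X.Opens) (m n : P.obj (op V)) :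
   shUnit P V (m+n) = shUnit P V m + shUnit P V n := map_add _ m n

theorem shUnit_smul (P : X.PresheafOfModules) (V : X.Opens) (a : Γ(X, V)) (m : P.obj (op V)) :
   shUnit P V (show P.obj (op V) from (show X.ringCatSheaf.obj.obj (op V) from a) • m) = a • shUnit P V m := 
  ((((PresheafOfModules.sheafificationAdjunction (𝟙 X.ringCatSheaf.obj)).unit.app P).app (op V)).hom).map_smul _ _

theorem resM_shUnit (P : X.PresheafOfModules) (h : W ≤ V) (m : P.obj (op V)) :
   resM (shf P) h (shUnit P V m) = shUnit P W (P.map (homOfLE h).op m) := 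
  (PresheafOfModules.naturality_apply ((PresheafOfModules.sheafificationAdjunction (𝟙 X.ringCatSheaf.obj)).unit.app P) (homOfLE h).op m).symm

theorem shUnit_locally_injective (P : X.PresheafOfModules) (m n : P.obj (op V)) (h : shUnit P V m = shUnit P V n) :
   ∀ x ∈ V, ∃ (W : X.Opens) (hW : W ≤ V), x ∈ W ∧ P.map (homOfLE hW).op m = P.map (homOfLE hW).op n := by
  intro x hx
  have := Presheaf.equalizerSieve_mem (Opens.grothendieckTopology X) (CategoryTheory.toSheafify (Opens.grothendieckTopology X) P.presheaf) m n h x hx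
  obtain ⟨W, i, hi, hxW⟩ := this
  exact ⟨W, i.le, hxW, hi⟩

theorem shUnit_locally_surjective (P : X.PresheafOfModules) (m : Γ(shf P, V)) :
   ∀ x ∈ V, ∃ (W : X.Opens) (hW : W ≤ V), x ∈ W ∧ ∃ n : P.obj (op W), resM (shf P) hW m = shUnit P W n := by
  intro x hx
  have := Presheaf.imageSieve_mem (Opens.grothendieckTopology X) (CategoryTheory.toSheafify (Opens.grothendieckTopology X) P.presheaf) m x hx
  obtain ⟨W, i, ⟨t, ht⟩, hxW⟩ := this
  exact ⟨W, i.le, hxW, t, ht.symm⟩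

/-- `N` maps to the sheafification of the presheaf cokernel of `φ`. This map vanishes after
composition with the epimorphism `φ`, so it is zero, and every section of `N` dies locally in the
presheaf cokernel. -/
theorem exists_app_eq_of_epi {M N : X.Modules} (φ : M ⟶ N) [Epi φ] (n : Γ(N, V)) :
    ∀ x ∈ V, ∃ (W : X.Opens) (hW : W ≤ V), x ∈ W ∧ ∃ m : Γ(M, W), φ.app W m = resM N hW n := by
  intro x hx
  let p := (Scheme.Modules.toPresheafOfModules X).map φ
  let adj := PresheafOfModules.sheafificationAdjunction (𝟙 X.ringCatSheaf.obj)
  let c := Limits.cokernel.π p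
  let g : N ⟶ shf (Limits.cokernel p) :=
    homOfApp (fun V n => shUnit _ V (c.app (op V) n)) (fun V m n =>
      (congrArg (shUnit _ V) (map_add (c.app (op V)).hom m n)).trans (shUnit_add _ V _ _)) (fun V a m => by
      rw [← shUnit_smul]; exact congrArg _ ((c.app (op V)).hom.map_smul _ _)) (fun h m => by
      rw [resM_shUnit]
      exact congrArg _ (PresheafOfModules.naturality_apply c (homOfLE h).op m).symm)
  have hg : g = 0 := by
    rw [← cancel_epi φ]
    refine modules_hom_ext fun V m => ?_
    have h1 : c.app (op V) (p.app (op V) m) = 0 := by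
      have := congrArg (fun k => (PresheafOfModules.Hom.app k (op V)).hom m) (Limits.cokernel.condition p)
      exact this
    rw [Limits.comp_zero]
    refine (congrArg (shUnit _ V) h1).trans ?_
    exact map_zero _
  have h2 : shUnit _ V (c.app (op V) n) = shUnit _ V 0 := by
    have := congrArg (fun k => Scheme.Modules.Hom.app k V n) hg
    exact this.trans (map_zero _).symm
  obtain ⟨W, hW, hxW, h3⟩ := shUnit_locally_injective _ _ _ h2 x hx
  refine ⟨W, hW, hxW, ?_⟩
  have h4 : c.app (op W) (resM N hW n) = 0 :=
    (PresheafOfModules.naturality_apply c (homOfLE hW).op n).trans (h3.trans (map_zero _))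
  have h5 := (ShortComplex.exact_cokernel p).map_of_epi_of_preservesCokernel
    (PresheafOfModules.evaluation _ (op W)) inferInstance inferInstance
  exact (ShortComplex.moduleCat_exact_iff _).1 h5 _ h4


/-- Two sheaves of modules with local generators that correspond to each other are isomorphic. -/
theorem nonempty_iso_of_generators {M N : X.Modules}
    (P : ∀ W : X.Opens, Γ(M, W) → Γ(N, W) → Prop)
    (hgen : ∀ {W g g'}, P W g g' → IsGen M W g ∧ IsGen N W g')
    (hres : ∀ {W W' : X.Opens} (h : W' ≤ W) {g g'}, P W g g' → P W' (resM M h g) (resM N h g'))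
    (hcov : ∀ x : X, ∃ (W : X.Opens) (g : Γ(M, W)) (g' : Γ(N, W)), x ∈ W ∧ P W g g')
    (hP : ∀ {W g₁ g₁' g₂ g₂'}, P W g₁ g₁' → P W g₂ g₂' → ∃ c : Γ(X, W), g₁ = c • g₂ ∧ g₁' = c • g₂') :
    Nonempty (M ≅ N) := by
  -- `R` says that two sections have the same coefficient in every pair of corresponding generators.
  -- It will be the graph of the isomorphism.
  let R : ∀ W : X.Opens, Γ(M, W) → Γ(N, W) → Prop := fun W m n =>
    ∀ (W' : X.Opens) (h : W' ≤ W) (g g'), P W' g g' → ∀ c : Γ(X, W'),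
      resM M h m = c • g ↔ resM N h n = c • g'
  -- Equality of coefficients need only be tested for one pair near each point, because `hP` gives
  -- both generators of a pair the same transition function.
  have loc : ∀ {W : X.Opens} {m : Γ(M, W)} {n : Γ(N, W)},
      (∀ x ∈ W, ∃ (W' : X.Opens) (h : W' ≤ W) (g : Γ(M, W')) (g' : Γ(N, W')), x ∈ W' ∧ P W' g g' ∧
        ∃ c : Γ(X, W'), resM M h m = c • g ∧ resM N h n = c • g') → R W m n := by
    intro W m n H W' h g g' hg c
    have key : ∀ x ∈ W', ∃ (W₀ : X.Opens) (h₀ : W₀ ≤ W'), x ∈ W₀ ∧ ∃ d : Γ(X, W₀),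
        resM M (h₀.trans h) m = d • resM M h₀ g ∧ resM N (h₀.trans h) n = d • resM N h₀ g' := by
      intro x hx
      obtain ⟨W₁, h₁, k, k', hx₁, hk, b, hb, hb'⟩ := H x (h hx)
      obtain ⟨a, ha, ha'⟩ := hP (hres (inf_le_right : W' ⊓ W₁ ≤ W₁) hk)
        (hres (inf_le_left : W' ⊓ W₁ ≤ W') hg)
      refine ⟨W' ⊓ W₁, inf_le_left, ⟨hx, hx₁⟩, resO inf_le_right b * a, ?_, ?_⟩
      · rw [mul_smul, ← ha, ← resM_smul, ← hb, resM_resM]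
      · rw [mul_smul, ← ha', ← resM_smul, ← hb', resM_resM]
    constructor
    · refine fun hm => resM_ext fun x hx => ?_
      obtain ⟨W₀, h₀, hx₀, d, hd, hd'⟩ := key x hx
      refine ⟨W₀, h₀, hx₀, ?_⟩
      rw [resM_resM, hd', resM_smul]
      congr 1
      refine ((hgen hg).1 W₀ h₀).1 ?_
      change d • _ = _ • _
      rw [← hd, ← resM_resM M h₀ h, hm, resM_smul]
    · refine fun hn => resM_ext fun x hx => ?_
      obtain ⟨W₀, h₀, hx₀, d, hd, hd'⟩ := key x hx
      refine ⟨W₀, h₀, hx₀, ?_⟩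
      rw [resM_resM, hd, resM_smul]
      congr 1
      refine ((hgen hg).2 W₀ h₀).1 ?_
      change d • _ = _ • _
      rw [← hd', ← resM_resM N h₀ h, hn, resM_smul]
  have Rres : ∀ {W W' : X.Opens} (h : W' ≤ W) {m n}, R W m n → R W' (resM M h m) (resM N h n) := by
    intro W W' h m n H W₀ h₀ g g' hg c
    rw [resM_resM, resM_resM]
    exact H W₀ _ g g' hg c
  have loc' : ∀ {W : X.Opens} {m : Γ(M, W)} {n : Γ(N, W)}, R W m n → 
      (∀ x ∈ W, ∃ (W' : X.Opens) (h : W' ≤ W) (g : Γ(M, W')) (g' : Γ(N, W')), x ∈ W' ∧ P W' g g' ∧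
        ∃ c : Γ(X, W'), resM M h m = c • g ∧ resM N h n = c • g') := by
    intro W m n H x hx
    obtain ⟨W₁, g, g', hx₁, hg⟩ := hcov x
    have h := hres (inf_le_right : W ⊓ W₁ ≤ W₁) hg
    have hc := ((hgen h).1.coef_smul le_rfl (resM M inf_le_left m)).symm
    rw [resM_rfl] at hc
    exact ⟨_, inf_le_left, _, _, ⟨hx, hx₁⟩, h, _, hc, (H _ inf_le_left _ _ h _).1 hc⟩
  have ex : ∀ (W : X.Opens) (m : Γ(M, W)), ∃ n, R W m n := by
    intro W m
    obtain ⟨n, hn⟩ := exists_sectionM_of_local N (V := W) (fun W' h n => R W' (resM M h m) n)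
      (fun h h' n hn => by rw [← resM_resM M h' h]; exact Rres h' hn)
      (fun {W'} h n n' hn hn' => resM_ext fun x hx => by
        obtain ⟨W₁, h₁, g, g', hx₁, hg, c, hc, hc'⟩ := loc' hn x hx
        exact ⟨W₁, h₁, hx₁, hc'.trans ((hn' W₁ h₁ g g' hg c).1 hc).symm⟩)
      (fun x hx => by
        obtain ⟨W₁, g, g', hx₁, hg⟩ := hcov x
        have h := hres (inf_le_right : W ⊓ W₁ ≤ W₁) hg
        have hc := ((hgen h).1.coef_smul le_rfl (resM M inf_le_left m)).symm
        rw [resM_rfl] at hc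
        refine ⟨_, inf_le_left, ⟨hx, hx₁⟩, _ • resM N inf_le_right g', loc fun y hy =>
          ⟨_, le_rfl, _, _, hy, h, _, (resM_rfl ..).trans hc, resM_rfl ..⟩⟩)
    refine ⟨n, loc fun x hx => ?_⟩
    obtain ⟨W₁, g, g', hx₁, hg⟩ := hcov x
    have h := hres (inf_le_right : W ⊓ W₁ ≤ W₁) hg
    have hc := ((hgen h).1.coef_smul le_rfl (resM M inf_le_left m)).symm
    rw [resM_rfl] at hc
    refine ⟨_, inf_le_left, _, _, ⟨hx, hx₁⟩, h, _, hc, hn _ _ _ (loc fun y hy =>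
      ⟨_, le_rfl, _, _, hy, h, _, (resM_rfl ..).trans hc, resM_rfl ..⟩)⟩
  have ex' : ∀ (W : X.Opens) (n : Γ(N, W)), ∃ m, R W m n := by
    intro W n
    obtain ⟨m, hm⟩ := exists_sectionM_of_local M (V := W) (fun W' h m => R W' m (resM N h n))
      (fun h h' m hm => by rw [← resM_resM N h' h]; exact Rres h' hm)
      (fun {W'} h m m' hm hm' => resM_ext fun x hx => by
        obtain ⟨W₁, h₁, g, g', hx₁, hg, c, hc, hc'⟩ := loc' hm x hx
        exact ⟨W₁, h₁, hx₁, hc.trans ((hm' W₁ h₁ g g' hg c).2 hc').symm⟩)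
      (fun x hx => by
        obtain ⟨W₁, g, g', hx₁, hg⟩ := hcov x
        have h := hres (inf_le_right : W ⊓ W₁ ≤ W₁) hg
        have hc := ((hgen h).2.coef_smul le_rfl (resM N inf_le_left n)).symm
        rw [resM_rfl] at hc
        refine ⟨_, inf_le_left, ⟨hx, hx₁⟩, _ • resM M inf_le_right g, loc fun y hy =>
          ⟨_, le_rfl, _, _, hy, h, _, resM_rfl .., (resM_rfl ..).trans hc⟩⟩)
    refine ⟨m, loc fun x hx => ?_⟩
    obtain ⟨W₁, g, g', hx₁, hg⟩ := hcov x
    have h := hres (inf_le_right : W ⊓ W₁ ≤ W₁) hg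
    have hc := ((hgen h).2.coef_smul le_rfl (resM N inf_le_left n)).symm
    rw [resM_rfl] at hc
    refine ⟨_, inf_le_left, _, _, ⟨hx, hx₁⟩, h, _, hm _ _ _ (loc fun y hy =>
      ⟨_, le_rfl, _, _, hy, h, _, resM_rfl .., (resM_rfl ..).trans hc⟩), hc⟩
  have uniq : ∀ {W : X.Opens} {m n n'}, R W m n → R W m n' → n = n' := by
    intro W m n n' hn hn'
    refine resM_ext fun x hx => ?_
    obtain ⟨W₁, h₁, g, g', hx₁, hg, c, hc, hc'⟩ := loc' hn x hx
    exact ⟨W₁, h₁, hx₁, hc'.trans ((hn' W₁ h₁ g g' hg c).1 hc).symm⟩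
  have uniq' : ∀ {W : X.Opens} {m m' n}, R W m n → R W m' n → m = m' := by
    intro W m m' n hm hm'
    refine resM_ext fun x hx => ?_
    obtain ⟨W₁, h₁, g, g', hx₁, hg, c, hc, hc'⟩ := loc' hm x hx
    exact ⟨W₁, h₁, hx₁, hc.trans ((hm' W₁ h₁ g g' hg c).2 hc').symm⟩
  choose φ hφ using ex
  let Φ : M ⟶ N := homOfApp φ
    (fun W m n => uniq (hφ W _) (loc fun x hx => by
      obtain ⟨W₁, h₁, g, g', hx₁, hg, c, hc, hc'⟩ := loc' (hφ W m) x hx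
      obtain ⟨d, hd⟩ := (hgen hg).1.exists_smul le_rfl (resM M h₁ n)
      rw [resM_rfl] at hd
      refine ⟨W₁, h₁, g, g', hx₁, hg, c + d, ?_, ?_⟩
      · rw [map_add, hc, hd, ← add_smul]
      · rw [map_add, hc', (hφ W n W₁ h₁ g g' hg _).1 hd, ← add_smul]))
    (fun W a m => uniq (hφ W _) (loc fun x hx => by
      obtain ⟨W₁, h₁, g, g', hx₁, hg, c, hc, hc'⟩ := loc' (hφ W m) x hx
      refine ⟨W₁, h₁, g, g', hx₁, hg, resO h₁ a * c, ?_, ?_⟩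
      · rw [resM_smul, hc, mul_smul]
      · rw [resM_smul, hc', mul_smul]))
    (fun h m => uniq (Rres h (hφ _ m)) (hφ _ _))
  have : IsIso Φ := isIso_of_bijective Φ fun V =>
    ⟨fun m m' h => uniq' (hφ V m) (by
      have h' : φ V m = φ V m' := h
      rw [h']; exact hφ V m'), fun n => by
      obtain ⟨m, hm⟩ := ex' V n
      exact ⟨m, uniq (hφ V m) hm⟩⟩
  exact ⟨asIso Φ⟩

/-- The tensor product of two sections. -/
def tmul {M N : X.Modules} (m : Γ(M, V)) (n : Γ(N, V)) : Γ(tensor M N, V) :=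
  shUnit (PresheafOfModules.Monoidal.tensorObj (R := X.presheaf) M.val N.val) V
    (TensorProduct.tmul Γ(X, V) m n)

theorem smul_tmul {M N : X.Modules} (a : Γ(X, V)) (m : Γ(M, V)) (n : Γ(N, V)) :
    tmul (a • m) n = a • tmul m n :=
  shUnit_smul (PresheafOfModules.Monoidal.tensorObj (R := X.presheaf) M.val N.val) V a
    (TensorProduct.tmul Γ(X, V) m n)

theorem tmul_smul {M N : X.Modules} (a : Γ(X, V)) (m : Γ(M, V)) (n : Γ(N, V)) :
    tmul m (a • n) = a • tmul m n :=
  (congrArg (shUnit (PresheafOfModules.Monoidal.tensorObj (R := X.presheaf) M.val N.val) V)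
    (TensorProduct.tmul_smul (R := Γ(X, V)) a m n)).trans
  (shUnit_smul (PresheafOfModules.Monoidal.tensorObj (R := X.presheaf) M.val N.val) V a
    (TensorProduct.tmul Γ(X, V) m n))

theorem resM_tmul {M N : X.Modules} (h : W ≤ V) (m : Γ(M, V)) (n : Γ(N, V)) :
    resM (tensor M N) h (tmul m n) = tmul (resM M h m) (resM N h n) :=
  (resM_shUnit _ h _)

/-- On the presheaf tensor product the pure tensor generates, and the product of the two coefficient
maps shows that it has no annihilator. Both facts are local, so they survive sheafification. -/
theorem IsGen.tmul {M N : X.Modules} {m : Γ(M, U)} {n : Γ(N, U)} (hm : IsGen M U m)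
    (hn : IsGen N U n) : IsGen (tensor M N) U (tmul m n) := by
  let P := PresheafOfModules.Monoidal.tensorObj (R := X.presheaf) M.val N.val
  have hg : ∀ (V : X.Opens) (h : V ≤ U) (y : TensorProduct Γ(X, V) Γ(M, V) Γ(N, V)),
      ∃ c : Γ(X, V), y = c • TensorProduct.tmul Γ(X, V) (resM M h m) (resM N h n) := by
    intro V h y
    induction y using TensorProduct.induction_on with
    | zero => exact ⟨0, (zero_smul ..).symm⟩
    | tmul a b =>
      obtain ⟨c, rfl⟩ := hm.exists_smul h a
      obtain ⟨d, rfl⟩ := hn.exists_smul h b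
      exact ⟨c * d, by rw [TensorProduct.tmul_smul, ← TensorProduct.smul_tmul', smul_smul, mul_comm]⟩
    | add a b ha hb =>
      obtain ⟨c, rfl⟩ := ha
      obtain ⟨d, rfl⟩ := hb
      exact ⟨c + d, (add_smul ..).symm⟩
  have hz : ∀ (V : X.Opens) (h : V ≤ U) (c : Γ(X, V)),
      c • TensorProduct.tmul Γ(X, V) (resM M h m) (resM N h n) = 0 → c = 0 := by
    intro V h c hc
    let f : Γ(M, V) →ₗ[Γ(X, V)] Γ(X, V) := ⟨⟨hm.coef h, hm.coef_add h⟩, hm.coef_smul_left h⟩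
    let g : Γ(N, V) →ₗ[Γ(X, V)] Γ(X, V) := ⟨⟨hn.coef h, hn.coef_add h⟩, hn.coef_smul_left h⟩
    have := congrArg ((TensorProduct.lid _ _).toLinearMap ∘ₗ TensorProduct.map f g) hc
    simpa [f, g, hm.coef_self, hn.coef_self] using this
  refine IsGen.of_local (fun V h c hc => ?_) fun V h y x hx => ?_
  · rw [resM_tmul, ← smul_tmul] at hc
    refine resO_ext fun x hx => ?_
    obtain ⟨W, hW, hxW, h1⟩ := shUnit_locally_injective P _ 0 (hc.trans (map_zero _).symm) x hx
    refine ⟨W, hW, hxW, ?_⟩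
    rw [map_zero]
    refine hz W (hW.trans h) _ ?_
    rw [TensorProduct.smul_tmul', ← resM_resM M hW h, ← resM_resM N hW h, ← resM_smul]
    exact h1.trans (map_zero _)
  · obtain ⟨W, hW, hxW, y', hy'⟩ := shUnit_locally_surjective P y x hx
    obtain ⟨c, hc⟩ := hg W (hW.trans h) y'
    refine ⟨W, hW, hxW, c, ?_⟩
    rw [resM_tmul, ← smul_tmul]
    exact hy'.trans (congrArg _ (hc.trans (TensorProduct.smul_tmul' ..)))

end SheafTheory

/-! ### Frames of the tangent sheaf, and charts of a smooth threefold. -/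

section Frames

/-- Derivations that agree on coordinates agree. -/
theorem IsCoords.map_derivation_eq {A A' : Type} [CommRing A] [CommRing A'] [Algebra ℂ A]
    [Algebra ℂ A'] (φ : A →+* A') (hφ : ∀ c, φ (algebraMap ℂ A c) = algebraMap ℂ A' c)
    {t : Fin 3 → A} (ht : IsCoords t) (d : Derivation ℂ A A) (d' : Derivation ℂ A' A')
    (h : ∀ i, φ (d (t i)) = d' (φ (t i))) (a : A) : φ (d a) = d' (φ a) := by
  algebraize [φ]
  have : IsScalarTower ℂ A A' := IsScalarTower.of_algebraMap_eq fun c => (hφ c).symm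
  let d₁ : Derivation ℂ A A' := (Algebra.linearMap A A').compDer d
  let d₂ : Derivation ℂ A A' := d'.compAlgebraMap A
  have : d₁ = d₂ := ht.derivation_ext h
  exact DFunLike.congr_fun this a

variable {X : Scheme.{0}} {f : X ⟶ Spec (.of ℂ)} {U V W : X.Opens}

theorem resO_isLocalization (hU : IsAffineOpen U) (a : Γ(X, U)) :
    letI := (resO (X.basicOpen_le a)).toAlgebra
    IsLocalization.Away a Γ(X, X.basicOpen a) :=
  hU.isLocalization_basicOpen a

theorem isCoords_basicOpen (hU : IsAffineOpen U) {t : Fin 3 → Γ(X, U)}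
    (ht : letI := (cst f U).toAlgebra; IsCoords t) (a : Γ(X, U)) :
    letI := (cst f (X.basicOpen a)).toAlgebra
    IsCoords fun i => resO (X.basicOpen_le a) (t i) := by
  let := (cst f U).toAlgebra
  let := (cst f (X.basicOpen a)).toAlgebra
  let := (resO (X.basicOpen_le a)).toAlgebra
  have : IsScalarTower ℂ Γ(X, U) Γ(X, X.basicOpen a) :=
    IsScalarTower.of_algebraMap_eq fun c => (resO_cst f (X.basicOpen_le a) c).symm
  have := resO_isLocalization hU a
  have : Algebra.FormallyEtale Γ(X, U) Γ(X, X.basicOpen a) :=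
    Algebra.FormallyEtale.of_isLocalization (Submonoid.powers a)
  exact ht.localization

/-- A vector field as a derivation. -/
def devDer (d : Γ(tangentSheaf f, U)) (h : V ≤ U) :
    letI := (cst f V).toAlgebra
    Derivation ℂ Γ(X, V) Γ(X, V) :=
  letI := (cst f V).toAlgebra
  Derivation.mk'
    { toFun := dev d h
      map_add' := (dev_mem d h).1
      map_smul' := fun c a => by
        change dev d h (cst f V c * a) = cst f V c * dev d h a
        rw [(dev_mem d h).2.1, (dev_mem d h).2.2, mul_zero, add_zero] }
    (dev_mem d h).2.1

theorem dev_eq_of_coords (hU : IsAffineOpen U) {t : Fin 3 → Γ(X, U)}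
    (ht : letI := (cst f U).toAlgebra; IsCoords t) (h : V ≤ U) {d d' : Γ(tangentSheaf f, V)}
    (hd : ∀ i, dev d le_rfl (resO h (t i)) = dev d' le_rfl (resO h (t i))) : d = d' := by
  refine dev_ext fun W hW g => resO_ext fun x hx => ?_
  obtain ⟨a, ha, hxa⟩ := exists_basicOpen_le hU hx (h (hW hx))
  refine ⟨_, ha, hxa, ?_⟩
  rw [resO_dev, resO_dev]
  let := (cst f (X.basicOpen a)).toAlgebra
  have := (isCoords_basicOpen (f := f) hU ht a).derivation_ext
    (d := devDer d (ha.trans hW)) (d' := devDer d' (ha.trans hW)) (fun i => by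
      have := congrArg (resO (ha.trans hW)) (hd i)
      rwa [resO_dev, resO_dev, resO_resO] at this)
  exact DFunLike.congr_fun this _

/-- On each basic open the restricted coordinates determine a unique derivation with the prescribed
values. Uniqueness makes these derivations compatible, so their values glue over every smaller open.
-/
theorem exists_dev_of_coords (hU : IsAffineOpen U) {t : Fin 3 → Γ(X, U)}
    (ht : letI := (cst f U).toAlgebra; IsCoords t) (c : Fin 3 → Γ(X, U)) :
    ∃ d : Γ(tangentSheaf f, U), ∀ i, dev d le_rfl (t i) = c i := by
  let inst : ∀ a : Γ(X, U), Algebra ℂ Γ(X, X.basicOpen a) := fun a =>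
    (cst f (X.basicOpen a)).toAlgebra
  have hD : ∀ a : Γ(X, U), ∃ d : Derivation ℂ Γ(X, X.basicOpen a) Γ(X, X.basicOpen a),
        ∀ i, d (resO (X.basicOpen_le a) (t i)) = resO (X.basicOpen_le a) (c i) := fun a =>
    ((isCoords_basicOpen (f := f) hU ht a).existsUnique_derivation _).exists
  choose D hD using hD
  have hDD : ∀ (a b : Γ(X, U)) (hab : X.basicOpen a ≤ X.basicOpen b) g,
      resO hab (D b g) = D a (resO hab g) := by
    intro a b hab g
    refine (isCoords_basicOpen (f := f) hU ht b).map_derivation_eq (resO hab)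
      (fun c => resO_cst f hab c) (D b) (D a) (fun i => ?_) g
    rw [hD, resO_resO, resO_resO, hD]
  have key : ∀ (V : X.Opens), V ≤ U → ∀ g : Γ(X, V), ∃ y : Γ(X, V),
      ∀ a (ha : X.basicOpen a ≤ V), resO ha y = D a (resO ha g) := by
    intro V hV g
    obtain ⟨y, hy⟩ := exists_section_of_local (V := V)
      (fun W hW y => ∀ a (ha : X.basicOpen a ≤ W), resO ha y = D a (resO (ha.trans hW) g))
      (fun h h' y hy a ha => by rw [resO_resO, hy])
      (fun {W} h y y' hy hy' => resO_ext fun x hx => by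
        obtain ⟨a, ha, hxa⟩ := exists_basicOpen_le hU hx (hV (h hx))
        exact ⟨_, ha, hxa, (hy a ha).trans (hy' a ha).symm⟩)
      (fun x hx => by
        obtain ⟨a, ha, hxa⟩ := exists_basicOpen_le hU hx (hV hx)
        refine ⟨_, ha, hxa, D a (resO ha g), fun b hb => ?_⟩
        rw [hDD, resO_resO])
    refine ⟨y, fun a ha => hy _ ha _ fun b hb => ?_⟩
    rw [hDD, resO_resO]
  choose y hy using key
  have ext : ∀ {V : X.Opens} (_ : V ≤ U) {g g' : Γ(X, V)},
      (∀ (a : Γ(X, U)) (ha : X.basicOpen a ≤ V), resO ha g = resO ha g') → g = g' := by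
    intro V hV g g' h
    refine resO_ext fun x hx => ?_
    obtain ⟨a, ha, hxa⟩ := exists_basicOpen_le hU hx (hV hx)
    exact ⟨_, ha, hxa, h a ha⟩
  refine ⟨(show (derOps f).Sec U from
    { fn := y
      mem := fun V hV => ⟨fun g g' => ext hV fun a ha => ?_, fun g g' => ext hV fun a ha => ?_,
        fun k => ext hV fun a ha => ?_⟩
      compat := fun {W V} hW hV g => ext (hW.trans hV) fun a ha => ?_ }), fun i => ?_⟩
  · simp only [hy, map_add]
  · simp only [hy, map_mul, map_add, Derivation.leibniz, smul_eq_mul]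
  · rw [hy, resO_cst, map_zero]
    exact (D a).map_algebraMap k
  · exact (resO_resO _ _ _).trans ((hy V hV g a _).trans ((hy W _ _ a ha).trans
      (congrArg (D a) (resO_resO ha hW g))).symm)
  · exact ext le_rfl fun a ha => (hy U le_rfl (t i) a ha).trans (hD a i)

/-- Coordinates give a frame of the tangent sheaf. -/
theorem exists_frame_of_coords (hU : IsAffineOpen U) {t : Fin 3 → Γ(X, U)}
    (ht : letI := (cst f U).toAlgebra; IsCoords t) :
    ∃ e : Fin 3 → Γ(tangentSheaf f, U), IsBasisOver (tangentSheaf f) U e := by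
  choose e he using fun j : Fin 3 =>
    exists_dev_of_coords (f := f) hU ht (fun i => if j = i then 1 else 0)
  have key : ∀ (V : X.Opens) (h : V ≤ U) (c : Fin 3 → Γ(X, V)) i,
      dev (∑ j, c j • resM (tangentSheaf f) h (e j)) le_rfl (resO h (t i)) = c i := by
    intro V h c i
    have h1 : ∀ j, dev (e j) h (resO h (t i)) = if j = i then 1 else 0 := by
      intro j
      rw [← resO_dev (e j) le_rfl h, he]
      split_ifs <;> simp
    simp only [dev_sum, dev_smul, dev_res, h1, resO_rfl]
    simp
  refine ⟨e, fun V h => ⟨fun c c' hc => funext fun i => ?_, fun d => ?_⟩⟩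
  · rw [← key V h c i, ← key V h c' i]
    exact congrArg (fun d : Γ(tangentSheaf f, V) => dev d le_rfl (resO h (t i))) hc
  · exact ⟨fun i => dev d le_rfl (resO h (t i)), dev_eq_of_coords hU ht h fun i => key V h _ i⟩

/-- Affine charts of a smooth threefold. -/
structure IsChart (f : X ⟶ Spec (.of ℂ)) (U : X.Opens) (e : Fin 3 → Γ(tangentSheaf f, U)) :
    Prop where
  isAffineOpen : IsAffineOpen U
  isBasisOver : IsBasisOver (tangentSheaf f) U e
  smooth : letI := (cst f U).toAlgebra; Algebra.Smooth ℂ Γ(X, U)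
  exists_coords : letI := (cst f U).toAlgebra; ∃ t : Fin 3 → Γ(X, U), IsCoords t

theorem IsChart.isNoetherianRing {e : Fin 3 → Γ(tangentSheaf f, U)} (h : IsChart f U e) :
    IsNoetherianRing Γ(X, U) := by
  let := (cst f U).toAlgebra
  have : Algebra.Smooth ℂ Γ(X, U) := h.smooth
  exact Algebra.FiniteType.isNoetherianRing ℂ _

theorem IsChart.exists_regTriple {e : Fin 3 → Γ(tangentSheaf f, U)} (h : IsChart f U e)
    (p : Ideal Γ(X, U)) [p.IsMaximal] : ∃ x y z : Localization.AtPrime p,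
      RegTriple (Localization.AtPrime p) x y z ∧
        Ideal.ofList [x, y, z] = IsLocalRing.maximalIdeal (Localization.AtPrime p) := by
  let := (cst f U).toAlgebra
  have : Algebra.Smooth ℂ Γ(X, U) := h.smooth
  obtain ⟨t, ht⟩ := h.exists_coords
  exact ht.exists_regTriple p

theorem IsChart.basicOpen {e : Fin 3 → Γ(tangentSheaf f, U)} (h : IsChart f U e) (a : Γ(X, U)) :
    IsChart f (X.basicOpen a) fun i => resM _ (X.basicOpen_le a) (e i) where
  isAffineOpen := h.isAffineOpen.basicOpen a
  isBasisOver := h.isBasisOver.res _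
  smooth := by
    let := (cst f U).toAlgebra
    let := (cst f (X.basicOpen a)).toAlgebra
    let := (resO (X.basicOpen_le a)).toAlgebra
    have : IsScalarTower ℂ Γ(X, U) Γ(X, X.basicOpen a) :=
      IsScalarTower.of_algebraMap_eq fun c => (resO_cst f (X.basicOpen_le a) c).symm
    have := resO_isLocalization h.isAffineOpen a
    have : Algebra.Smooth ℂ Γ(X, U) := h.smooth
    have : Algebra.Smooth Γ(X, U) Γ(X, X.basicOpen a) := Algebra.Smooth.of_isLocalization_Away a
    exact Algebra.Smooth.comp ℂ Γ(X, U) Γ(X, X.basicOpen a)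
  exists_coords := by
    obtain ⟨t, ht⟩ := h.exists_coords
    exact ⟨_, isCoords_basicOpen h.isAffineOpen ht a⟩

theorem exists_isChart (f : X ⟶ Spec (.of ℂ)) [SmoothOfRelativeDimension 3 f] (x : X) :
    ∃ (U : X.Opens) (e : Fin 3 → Γ(tangentSheaf f, U)), x ∈ U ∧ IsChart f U e := by
  obtain ⟨U', hU', V, hV, hxV, i, hs⟩ :=
    SmoothOfRelativeDimension.exists_isStandardSmoothOfRelativeDimension (n := 3) (f := f) x
  have : Subsingleton (Spec (.of ℂ)) := inferInstanceAs (Subsingleton (PrimeSpectrum ℂ))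
  -- Spec ℂ has a single point, so the affine neighbourhood in the base is the whole base.
  obtain rfl : U' = ⊤ := by
    refine top_unique fun y _ => ?_
    rw [Subsingleton.elim y (f x)]
    exact i hxV
  have hc : cst f V = (f.appLE ⊤ V i).hom.comp
      ((Scheme.ΓSpecIso (.of ℂ)).symm.commRingCatIsoToRingEquiv : ℂ →+* _) := rfl
  have hs' : RingHom.IsStandardSmoothOfRelativeDimension 3 (cst f V) := by
    rw [hc]
    exact hs.comp (RingHom.IsStandardSmoothOfRelativeDimension.equiv _)
  let := (cst f V).toAlgebra
  have : Algebra.IsStandardSmoothOfRelativeDimension 3 ℂ Γ(X, V) := hs'.toAlgebra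
  have : Algebra.IsStandardSmooth ℂ Γ(X, V) :=
    Algebra.IsStandardSmoothOfRelativeDimension.isStandardSmooth 3
  have : Nontrivial Γ(X, V) := by
    have : Nonempty V := ⟨⟨x, hxV⟩⟩
    infer_instance
  obtain ⟨t, ht⟩ := exists_isCoords Γ(X, V)
  obtain ⟨e, he⟩ := exists_frame_of_coords (f := f) hV ht
  exact ⟨V, e, hxV, hV, he, inferInstance, t, ht⟩

end Frames

/-! ### Further identities for cross products, and denominators of submodules. -/

section VectorAlgebra

open Matrix

variable {R : Type*} [CommRing R]

theorem smul_cross_cross (a b m : Fin 3 → R) (i : Fin 3) :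
    (a ⨯₃ b) i • m = (b ⬝ᵥ (Pi.single i 1 ⨯₃ m)) • a - (a ⬝ᵥ (Pi.single i 1 ⨯₃ m)) • b +
      (m ⬝ᵥ (a ⨯₃ b)) • Pi.single i 1 := by
  fin_cases i <;> ext j <;> fin_cases j <;>
    simp [cross_apply, vecHead, vecTail] <;> ring

/-- Over the locus where `w i` is invertible, the vectors orthogonal to `w` are combinations of the
products of `w` with the basis vectors. Statements about the kernel of a form are reduced to those
vectors and then freed of the factor `w i`. -/
theorem smul_eq_cross (w m : Fin 3 → R) (i : Fin 3) (hm : w ⬝ᵥ m = 0) :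
    w i • m = w ⨯₃ (m ⨯₃ Pi.single i 1) := by
  simp only [vec3_dotProduct] at hm
  fin_cases i <;> ext j <;> fin_cases j <;>
    simp [cross_apply] <;> first | ring1 | linear_combination hm

theorem cross_cross_perp {w a b : Fin 3 → R} (ha : w ⬝ᵥ a = 0) (hb : w ⬝ᵥ b = 0) :
    w ⨯₃ (a ⨯₃ b) = 0 := by
  simp only [vec3_dotProduct] at ha hb
  ext j
  fin_cases j <;> simp [cross_apply]
  · linear_combination a 0 * hb - b 0 * ha
  · linear_combination a 1 * hb - b 1 * ha
  · linear_combination a 2 * hb - b 2 * ha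

theorem cross_smul_eq {a b : Fin 3 → R} (h : a ⨯₃ b = 0) (i j : Fin 3) : a i * b j = a j * b i := by
  have h0 := congrFun h 0
  have h1 := congrFun h 1
  have h2 := congrFun h 2
  simp [cross_apply] at h0 h1 h2
  fin_cases i <;> fin_cases j <;> simp <;>
    first
    | ring
    | linear_combination h0
    | linear_combination -h0
    | linear_combination h1
    | linear_combination -h1
    | linear_combination h2
    | linear_combination -h2

theorem cross_eq_zero_of {a b : Fin 3 → R} (h : ∀ i j, a i * b j = a j * b i) : a ⨯₃ b = 0 := by
  ext j
  fin_cases j <;> simp [cross_apply]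
  · linear_combination h 1 2
  · linear_combination h 2 0
  · linear_combination h 0 1

theorem cross_eq_zero_trans [IsDomain R] {w a b : Fin 3 → R} (hw : w ≠ 0) (ha : w ⨯₃ a = 0)
    (hb : w ⨯₃ b = 0) : a ⨯₃ b = 0 := by
  obtain ⟨k, hk⟩ := Function.ne_iff.1 hw
  have hk : w k ≠ 0 := hk
  refine cross_eq_zero_of fun i j => mul_left_cancel₀ hk ?_
  have h1 := cross_smul_eq ha k i
  have h2 := cross_smul_eq hb k j
  have h3 := cross_smul_eq ha k j
  have h4 := cross_smul_eq hb k i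
  refine mul_left_cancel₀ hk ?_
  calc w k * (w k * (a i * b j)) = (w k * a i) * (w k * b j) := by ring
    _ = (w k * a j) * (w k * b i) := by rw [h1, h2, h3, h4]; ring
    _ = _ := by ring

theorem dot_eq_zero_of_cross [IsDomain R] {w w' m : Fin 3 → R} (hw : w ≠ 0) (h : w ⨯₃ w' = 0)
    (hm : w ⬝ᵥ m = 0) : w' ⬝ᵥ m = 0 := by
  obtain ⟨k, hk⟩ := Function.ne_iff.1 hw
  have hk : w k ≠ 0 := hk
  refine (mul_eq_zero.1 ?_).resolve_left hk
  simp only [vec3_dotProduct] at hm ⊢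
  linear_combination w' k * hm + cross_smul_eq h k 0 * m 0 + cross_smul_eq h k 1 * m 1 +
    cross_smul_eq h k 2 * m 2

/-- Linear independence of two vectors, through the cross product. -/
theorem cross_ne_zero [IsDomain R] {a b : Fin 3 → R} (h : LinearIndependent R ![a, b]) :
    a ⨯₃ b ≠ 0 := by
  intro h0
  rw [LinearIndependent.pair_iff] at h
  have ha : ∀ i, a i = 0 := fun i => by
    have := (h (b i) (-(a i)) (by
      ext j
      simp only [Pi.add_apply, Pi.smul_apply, smul_eq_mul, Pi.zero_apply]
      linear_combination -(cross_smul_eq h0 i j))).2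
    simpa using this
  have := (h 1 0 (by ext j; simp [ha])).1
  exact one_ne_zero this

/-- A common denominator for a finitely generated module: the product over finitely many generators
avoids `p` because `p` is prime. -/
theorem exists_pow_smul_mem {A M : Type*} [CommRing A] [AddCommGroup M] [Module A M]
    {p : Ideal A} [p.IsPrime] {N K : Submodule A M} (hN : N.FG)
    (h : ∀ m ∈ N, ∃ s ∉ p, s • m ∈ K) : ∃ s ∉ p, ∀ m ∈ N, s • m ∈ K := by
  classical
  obtain ⟨S, rfl⟩ := hN
  choose s hs hsK using fun m : S => h m (Submodule.subset_span m.2)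
  refine ⟨∏ m, s m, fun hp => ?_, fun m hm => ?_⟩
  · obtain ⟨m, -, hm⟩ := Ideal.IsPrime.prod_mem_iff.1 hp
    exact hs m hm
  · have : Submodule.span A (S : Set M) ≤ K.comap (LinearMap.lsmul A M (∏ m, s m)) := by
      refine Submodule.span_le.2 fun m hm => ?_
      change (∏ m, s m) • m ∈ K
      rw [← Finset.prod_erase_mul _ _ (Finset.mem_univ ⟨m, hm⟩), mul_smul]
      exact K.smul_mem _ (hsK ⟨m, hm⟩)
    exact this hm

end VectorAlgebra

/-! ### Restriction of vectors of functions, and clearing of denominators. -/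

section VectorRestriction

open Matrix

variable {X : Scheme.{0}} {U V W : X.Opens}

/-- Restriction of vectors of functions. -/
def vres (h : W ≤ V) (w : Fin 3 → Γ(X, V)) : Fin 3 → Γ(X, W) := fun i => resO h (w i)

theorem vres_apply (h : W ≤ V) (w : Fin 3 → Γ(X, V)) (i : Fin 3) : vres h w i = resO h (w i) := rfl

@[simp] theorem vres_vres (h : W ≤ V) (h' : V ≤ U) (w : Fin 3 → Γ(X, U)) :
    vres h (vres h' w) = vres (h.trans h') w := funext fun _ => resO_resO _ _ _

@[simp] theorem vres_rfl (h : V ≤ V) (w : Fin 3 → Γ(X, V)) : vres h w = w :=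
  funext fun _ => resO_rfl _ _

@[simp] theorem vres_cross (h : W ≤ V) (a b : Fin 3 → Γ(X, V)) :
    vres h (a ⨯₃ b) = vres h a ⨯₃ vres h b := by
  ext j
  fin_cases j <;> simp [cross_apply, vres_apply]

@[simp] theorem resO_dot (h : W ≤ V) (a b : Fin 3 → Γ(X, V)) :
    resO h (a ⬝ᵥ b) = vres h a ⬝ᵥ vres h b := by
  simp [vec3_dotProduct, vres_apply]

@[simp] theorem vres_smul (h : W ≤ V) (c : Γ(X, V)) (a : Fin 3 → Γ(X, V)) :
    vres h (c • a) = resO h c • vres h a := by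
  ext j
  simp [vres_apply]

@[simp] theorem vres_add (h : W ≤ V) (a b : Fin 3 → Γ(X, V)) :
    vres h (a + b) = vres h a + vres h b := by
  ext j
  simp [vres_apply]

@[simp] theorem vres_zero (h : W ≤ V) : vres h (0 : Fin 3 → Γ(X, V)) = 0 := by
  ext j
  simp [vres_apply]

theorem vres_injective [IsIntegral X] (h : W ≤ V) (hW : (W : Set X).Nonempty) :
    Function.Injective (vres h) :=
  fun _ _ hab => funext fun i => resO_injective h hW (congrFun hab i)

theorem vres_ne_zero [IsIntegral X] (h : W ≤ V) (hW : (W : Set X).Nonempty) {w : Fin 3 → Γ(X, V)}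
    (hw : w ≠ 0) : vres h w ≠ 0 := fun h0 => hw (vres_injective h hW (h0.trans (vres_zero h).symm))

/-- Functions on a basic open extend after multiplication by a power. -/
theorem exists_resO_eq (hU : IsAffineOpen U) (a : Γ(X, U)) (g : Γ(X, X.basicOpen a)) :
    ∃ (n : ℕ) (g' : Γ(X, U)), resO (X.basicOpen_le a) g' = resO (X.basicOpen_le a) a ^ n * g := by
  let := (resO (X.basicOpen_le a)).toAlgebra
  have := resO_isLocalization hU a
  obtain ⟨n, g', h⟩ := IsLocalization.Away.surj a g
  exact ⟨n, g', by rw [mul_comm]; exact h.symm⟩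

theorem exists_vres_eq (hU : IsAffineOpen U) (a : Γ(X, U)) (g : Fin 3 → Γ(X, X.basicOpen a)) :
    ∃ (n : ℕ) (g' : Fin 3 → Γ(X, U)),
      vres (X.basicOpen_le a) g' = resO (X.basicOpen_le a) a ^ n • g := by
  choose n g' h using fun i => exists_resO_eq hU a (g i)
  -- The sum of the exponents serves as a common exponent; each entry is multiplied by the powers
  -- required by the others.
  refine ⟨∑ i, n i, fun i => a ^ (∑ j ∈ Finset.univ.erase i, n j) * g' i, funext fun i => ?_⟩
  simp only [vres_apply, map_mul, map_pow, h, Pi.smul_apply, smul_eq_mul]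
  rw [← mul_assoc, ← pow_add, Finset.sum_erase_add _ _ (Finset.mem_univ i)]

theorem isUnit_resO_basicOpen (a : Γ(X, U)) : IsUnit (resO (X.basicOpen_le a) a) :=
  RingedSpace.isUnit_res_basicOpen _ a

end VectorRestriction

/-! ### Points of an affine open as prime ideals. -/

section Points

variable {X : Scheme.{0}} {U V W : X.Opens}

theorem exists_point (hU : IsAffineOpen U) (q : Ideal Γ(X, U)) [hq : q.IsPrime] :
    ∃ y ∈ U, ∀ s : Γ(X, U), y ∈ X.basicOpen s ↔ s ∉ q := by
  have key : ∀ s : Γ(X, U), hU.fromSpec ⟨q, hq⟩ ∈ X.basicOpen s ↔ s ∉ q := by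
    intro s
    have := congrArg (fun V : Opens _ => (⟨q, hq⟩ : PrimeSpectrum Γ(X, U)) ∈ V)
      (hU.fromSpec_preimage_basicOpen s)
    exact Iff.of_eq this
  exact ⟨_, X.basicOpen_le 1 ((key 1).2 fun h => hq.ne_top ((Ideal.eq_top_iff_one q).2 h)), key⟩

theorem exists_prime (hU : IsAffineOpen U) {x : X} (hx : x ∈ U) :
    ∃ q : Ideal Γ(X, U), q.IsPrime ∧ ∀ s : Γ(X, U), x ∈ X.basicOpen s ↔ s ∉ q := by
  refine ⟨(hU.primeIdealOf ⟨x, hx⟩).asIdeal, inferInstance, fun s => ?_⟩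
  have := congrArg (fun V : Opens _ => hU.primeIdealOf ⟨x, hx⟩ ∈ V)
    (hU.fromSpec_preimage_basicOpen s)
  refine Iff.trans ?_ (Iff.of_eq this)
  change x ∈ X.basicOpen s ↔ hU.fromSpec (hU.primeIdealOf ⟨x, hx⟩) ∈ X.basicOpen s
  rw [hU.fromSpec_primeIdealOf]

theorem specializes_of_prime_le (hU : IsAffineOpen U) {q p : Ideal Γ(X, U)} (hqp : q ≤ p) {y z : X}
    (hz : z ∈ U) (hyq : ∀ s : Γ(X, U), y ∈ X.basicOpen s ↔ s ∉ q)
    (hzp : ∀ s : Γ(X, U), z ∈ X.basicOpen s ↔ s ∉ p) : y ⤳ z := by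
  refine specializes_iff_forall_open.2 fun W hW hzW => ?_
  obtain ⟨a, ha, hza⟩ := exists_basicOpen_le hU (V := ⟨W, hW⟩) hzW hz
  exact ha ((hyq a).2 fun h => (hzp a).1 hza (hqp h))

theorem mem_support_of_prime {I : X.IdealSheafData} {U : X.affineOpens} {q : Ideal Γ(X, U)}
    (hI : I.ideal U ≤ q) {y : X} (hy : y ∈ U.1)
    (hyq : ∀ s : Γ(X, U.1), y ∈ X.basicOpen s ↔ s ∉ q) : y ∈ I.support := by
  rw [Scheme.IdealSheafData.mem_support_iff_of_mem hy, Scheme.mem_zeroLocus_iff]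
  exact fun s hs h => (hyq s).1 h (hI hs)

/-- The prime ideals in the support of a zero-dimensional closed subscheme are incomparable. -/
theorem prime_eq_of_krullDim_le_zero {I : X.IdealSheafData}
    (hI : topologicalKrullDim (I.support : Set X) ≤ 0) (U : X.affineOpens)
    {q p : Ideal Γ(X, U)} [q.IsPrime] [p.IsPrime] (hIq : I.ideal U ≤ q) (hqp : q ≤ p) : q = p := by
  obtain ⟨y, hy, hyq⟩ := exists_point U.2 q
  obtain ⟨z, hz, hzp⟩ := exists_point U.2 p
  have hyz := specializes_of_prime_le U.2 hqp hz hyq hzp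
  let y' : (I.support : Set X) := ⟨y, mem_support_of_prime hIq hy hyq⟩
  let z' : (I.support : Set X) := ⟨z, mem_support_of_prime (hIq.trans hqp) hz hzp⟩
  have h1 : y' ⤳ z' := Topology.IsInducing.subtypeVal.specializes_iff.1 hyz
  let Y : IrreducibleCloseds (I.support : Set X) :=
    ⟨closure {y'}, isIrreducible_singleton.closure, isClosed_closure⟩
  let Z : IrreducibleCloseds (I.support : Set X) :=
    ⟨closure {z'}, isIrreducible_singleton.closure, isClosed_closure⟩
  have h2 : Z ≤ Y := specializes_iff_closure_subset.1 h1
  have h3 : Z = Y := le_antisymm h2 (Order.krullDim_nonpos_iff_forall_isMin.1 hI Y h2)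
  have h4 : y' = z' := by
    refine (inseparable_iff_closure_eq.2 ?_).eq
    exact (congrArg IrreducibleCloseds.carrier h3).symm
  have h5 : y = z := congrArg Subtype.val h4
  ext s
  rw [← not_iff_not, ← hyq, ← hzp, h5]

end Points

/-! ### A one-form that defines a codimension one distribution. -/

section Normal

open Matrix

variable {X : Scheme.{0}} {f : X ⟶ Spec (.of ℂ)} {U V W : X.Opens}
  {e : Fin 3 → Γ(tangentSheaf f, U)}

theorem Distribution.app_injective {r : ℕ} (F : Distribution f r) (V : X.Opens) :
    Function.Injective (F.φ.app V) :=
  have : Mono F.φ := F.exact.mono_f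
  Foliated.app_injective F.φ V

theorem Distribution.exists_app_eq {r : ℕ} (F : Distribution f r) (V : X.Opens)
    {m : Γ(tangentSheaf f, V)} (h : F.π.app V m = 0) : ∃ t, F.φ.app V t = m :=
  have : Mono F.φ := F.exact.mono_f
  Foliated.exists_app_eq F.exact.exact V h

theorem Distribution.app_app {r : ℕ} (F : Distribution f r) (V : X.Opens) (t : Γ(F.T, V)) :
    F.π.app V (F.φ.app V t) = 0 := by
  rw [← app_comp_apply, F.zero]
  rfl

theorem Distribution.π_eq_zero_of_smul {r : ℕ} (F : Distribution f r) {a : Γ(X, V)} (ha : a ≠ 0)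
    {m : Γ(tangentSheaf f, V)} (h : F.π.app V (a • m) = 0) : F.π.app V m = 0 := by
  rw [Scheme.Modules.Hom.app_smul] at h
  exact (F.torsionFree.2 V a _ h).resolve_left ha

variable [IsIntegral X]

/-- A codimension one distribution is generically the kernel of a one-form. -/
theorem exists_normal (F : Distribution f 1) (hU : IsChart f U e) (hU0 : (U : Set X).Nonempty) :
    ∃ w : Fin 3 → Γ(X, U), w ≠ 0 ∧ ∀ (V : X.Opens) (h : V ≤ U) (m : Γ(tangentSheaf f, V)),
      F.π.app V m = 0 ↔ vres h w ⬝ᵥ hU.isBasisOver.coord h m = 0 := by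
  have hd := isDomain_section hU0
  have hr := F.rank ⟨U, hU.isAffineOpen⟩ hU0
  obtain ⟨t, ht⟩ := (Module.le_rank_iff (n := 2)).1 (le_of_eq hr.symm)
  let c := fun (V : X.Opens) (h : V ≤ U) (s : Γ(F.T, V)) => hU.isBasisOver.coord h (F.φ.app V s)
  have cres : ∀ {V W : X.Opens} (h : V ≤ U) (h' : W ≤ V) s,
      vres h' (c V h s) = c W (h'.trans h) (resM _ h' s) := by
    intro V W h h' s
    simp only [c]
    rw [← resM_app, hU.isBasisOver.coord_res]
    rfl
  let cl : Γ(F.T, U) →ₗ[Γ(X, U)] (Fin 3 → Γ(X, U)) :=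
    { toFun := c U le_rfl
      map_add' := fun a b => by simp only [c, map_add]
      map_smul' := fun a b => by simp only [c, Scheme.Modules.Hom.app_smul, map_smul, RingHom.id_apply] }
  have hcl : Function.Injective cl := by
    intro a b hab
    exact F.app_injective U ((hU.isBasisOver.coord le_rfl).injective hab)
  -- `w` is the cross product of two independent sections of the tangent sheaf of `F`. It is correct
  -- up to a factor and may vanish along a divisor.
  have hw : c U le_rfl (t 0) ⨯₃ c U le_rfl (t 1) ≠ 0 := by
    refine cross_ne_zero ?_
    have := ht.map' cl (LinearMap.ker_eq_bot.2 hcl)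
    have e2 : ![c U le_rfl (t 0), c U le_rfl (t 1)] = cl ∘ t := by
      ext i
      fin_cases i <;> rfl
    rw [e2]
    exact this
  set w := c U le_rfl (t 0) ⨯₃ c U le_rfl (t 1) with hwdef
  have hwV : ∀ {V : X.Opens} (h : V ≤ U), vres h w =
      c V h (resM _ h (t 0)) ⨯₃ c V h (resM _ h (t 1)) := by
    intro V h
    rw [hwdef, vres_cross, cres, cres]
  refine ⟨w, hw, fun V h m => ⟨fun hm => ?_, fun hm => ?_⟩⟩
  · obtain ⟨s, rfl⟩ := F.exists_app_eq V hm
    refine resO_ext fun x hx => ?_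
    obtain ⟨a, ha, hxa⟩ := exists_basicOpen_le hU.isAffineOpen hx (h hx)
    refine ⟨_, ha, hxa, ?_⟩
    rw [resO_dot, vres_vres, map_zero, hwV]
    have hne : (X.basicOpen a : Set X).Nonempty := ⟨x, hxa⟩
    have hd' := isDomain_section hne
    have hr' := F.rank ⟨_, hU.isAffineOpen.basicOpen a⟩ hne
    change _ ⬝ᵥ vres ha (c V h s) = 0
    rw [cres]
    -- Three sections of a rank two module satisfy a relation. The coefficient of `s` is nonzero
    -- since the other two sections are independent, and pairing the relation with their cross
    -- product leaves only the term of `s`.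
    have hdep : ¬ LinearIndependent Γ(X, X.basicOpen a) ![resM F.T (ha.trans h) (t 0),
        resM F.T (ha.trans h) (t 1), resM F.T ha s] := by
      intro hli
      have := hli.cardinal_le_rank
      rw [hr'] at this
      norm_num at this
    rw [Fintype.not_linearIndependent_iff] at hdep
    obtain ⟨g, hg, hg0⟩ := hdep
    have hg' := congrArg (fun s => hU.isBasisOver.coord (ha.trans h) (F.φ.app _ s)) hg
    simp only [Fin.sum_univ_three, map_add, Scheme.Modules.Hom.app_smul, map_smul, map_zero] at hg'
    change g 0 • c _ (ha.trans h) (resM F.T (ha.trans h) (t 0)) +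
      g 1 • c _ (ha.trans h) (resM F.T (ha.trans h) (t 1)) +
      g 2 • c _ (ha.trans h) (resM F.T ha s) = 0 at hg'
    have hw' := vres_ne_zero (ha.trans h) hne hw
    rw [hwV] at hw'
    generalize c _ (ha.trans h) (resM F.T (ha.trans h) (t 0)) = a₀ at hg' hw' ⊢
    generalize c _ (ha.trans h) (resM F.T (ha.trans h) (t 1)) = a₁ at hg' hw' ⊢
    generalize c _ (ha.trans h) (resM F.T ha s) = a₂ at hg' hw' ⊢
    by_cases h2 : g 2 = 0
    · exfalso
      rw [h2, zero_smul, add_zero] at hg'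
      have e0 : g 0 • (a₀ ⨯₃ a₁) = 0 := by
        have := congrArg (fun v => v ⨯₃ a₁) hg'
        simpa [cross_self] using this
      have e1 : g 1 • (a₀ ⨯₃ a₁) = 0 := by
        have := congrArg (fun v => a₀ ⨯₃ v) hg'
        simpa [cross_self] using this
      have z0 := (smul_eq_zero.1 e0).resolve_right hw'
      have z1 := (smul_eq_zero.1 e1).resolve_right hw'
      obtain ⟨i, hi⟩ := hg0
      fin_cases i
      · exact hi z0
      · exact hi z1
      · exact hi h2
    · have := congrArg (fun v => (a₀ ⨯₃ a₁) ⬝ᵥ v) hg'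
      simp only [dotProduct_add, dotProduct_smul, dotProduct_zero] at this
      rw [dotProduct_comm _ a₀, dot_self_cross, dotProduct_comm _ a₁, dot_cross_self] at this
      simpa [h2] using this
  -- If `w` annihilates `m`, then `smul_cross_cross` writes `w i • m` through the two chosen tangent
  -- sections; torsion-freeness of the normal sheaf removes the factor `w i`.
  · by_cases hV : (V : Set X).Nonempty
    · have hd' := isDomain_section hV
      obtain ⟨i, hi⟩ := Function.ne_iff.1 (vres_ne_zero h hV hw)
      refine F.π_eq_zero_of_smul (a := vres h w i) hi ?_
      rw [hwV] at hm ⊢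
      have key := smul_cross_cross (c V h (resM _ h (t 0))) (c V h (resM _ h (t 1)))
        (hU.isBasisOver.coord h m) i
      rw [dotProduct_comm] at hm
      rw [hm, zero_smul, add_zero] at key
      have key' : (c V h (resM _ h (t 0)) ⨯₃ c V h (resM _ h (t 1))) i • m = F.φ.app V
          ((c V h (resM _ h (t 1)) ⬝ᵥ (Pi.single i 1 ⨯₃ hU.isBasisOver.coord h m)) • resM _ h (t 0) -
            (c V h (resM _ h (t 0)) ⬝ᵥ (Pi.single i 1 ⨯₃ hU.isBasisOver.coord h m)) •
              resM _ h (t 1)) := by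
        refine (hU.isBasisOver.coord h).injective ?_
        simp only [map_sub, Scheme.Modules.Hom.app_smul, map_smul]
        exact key
      rw [key', F.app_app]
    · have := subsingleton_sectionM F.N hV
      exact Subsingleton.elim _ _

end Normal

/-! ### Saturating a one-form near a closed point. -/

section LocalAlgebra

open Matrix

theorem comp_cross {A B : Type*} [CommRing A] [CommRing B] (φ : A →+* B) (a b : Fin 3 → A) :
    φ ∘ (a ⨯₃ b) = (φ ∘ a) ⨯₃ (φ ∘ b) := by
  ext j
  fin_cases j <;> simp [cross_apply]

theorem smul_eq_of_cross {R : Type*} [CommRing R] {m μ : Fin 3 → R} (h : m ⨯₃ μ = 0)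
    (u : Fin 3 → R) : (u ⬝ᵥ μ) • m = (u ⬝ᵥ m) • μ := by
  ext j
  simp only [vec3_dotProduct, Pi.smul_apply, smul_eq_mul]
  linear_combination u 0 * cross_smul_eq h j 0 + u 1 * cross_smul_eq h j 1 +
    u 2 * cross_smul_eq h j 2

theorem mem_span_range_three {R : Type*} [CommRing R] {v : Fin 3 → R} {a : R} :
    a ∈ Ideal.span (Set.range v) ↔ ∃ b, a = b ⬝ᵥ v := by
  rw [Ideal.mem_span_range_iff_exists_fun]
  simp only [dotProduct, eq_comm]

variable {A : Type} [CommRing A] {p : Ideal A} [p.IsPrime]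

theorem exists_vec_eq_algebraMap (v : Fin 3 → Localization.AtPrime p) :
    ∃ s ∉ p, ∃ v' : Fin 3 → A, algebraMap A (Localization.AtPrime p) ∘ v' =
      algebraMap A (Localization.AtPrime p) s • v := by
  obtain ⟨s, hs⟩ := IsLocalization.exist_integer_multiples_of_finite p.primeCompl v
  choose v' hv' using hs
  exact ⟨s, s.2, v', funext fun i => (hv' i).trans (Algebra.smul_def _ _)⟩

theorem isUnit_algebraMap {s : A} (hs : s ∉ p) : IsUnit (algebraMap A (Localization.AtPrime p) s) :=
  IsLocalization.map_units _ (⟨s, hs⟩ : p.primeCompl)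

/-- The saturation of a line near the zero-dimensional base locus of its ideal of coordinates. -/
theorem exists_saturation [IsDomain A] [IsNoetherianRing A] {x y z : Localization.AtPrime p}
    (reg : RegTriple (Localization.AtPrime p) x y z)
    (hm : Ideal.ofList [x, y, z] = IsLocalRing.maximalIdeal (Localization.AtPrime p))
    {w : Fin 3 → A} (hw : w ≠ 0) (H : Set A)
    (hH : ∀ h ∈ H, ∃ μ, w ⨯₃ μ = 0 ∧ ∃ u, h = u ⬝ᵥ μ)
    (hrad : ∀ Q : Ideal A, Q.IsPrime → H ⊆ Q → Q ≤ p → Q = p) :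
    ∃ v : Fin 3 → A, v ≠ 0 ∧ w ⨯₃ v = 0 ∧ ∃ a ∉ p, (∀ m, w ⨯₃ m = 0 → ∃ c : A, a • m = c • v) ∧
      ∀ u, u ⬝ᵥ v = 0 → ∃ t, a • u = v ⨯₃ t := by
  let φ := algebraMap A (Localization.AtPrime p)
  have hφ : Function.Injective φ :=
    IsLocalization.injective _ p.primeCompl_le_nonZeroDivisors
  have hφc : Function.Injective fun v : Fin 3 → A => φ ∘ v := hφ.comp_left
  have : IsDomain (Localization.AtPrime p) := IsLocalization.isDomain_localization p.primeCompl_le_nonZeroDivisors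
  have hwB : φ ∘ w ≠ 0 := fun h0 => hw (hφc (h0.trans (funext fun i => (map_zero φ).symm)))
  have cross0 : ∀ {a b : Fin 3 → A}, a ⨯₃ b = 0 ↔ (φ ∘ a) ⨯₃ (φ ∘ b) = 0 := by
    intro a b
    rw [← comp_cross]
    refine ⟨fun h => ?_, fun h => hφc (h.trans (funext fun i => (map_zero φ).symm))⟩
    rw [h]
    exact funext fun i => map_zero φ
  have hHB : ∀ h ∈ φ '' H, ∃ μ, (φ ∘ w) ⨯₃ μ = 0 ∧ ∃ u, h = u ⬝ᵥ μ := by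
    rintro _ ⟨h, hh, rfl⟩
    obtain ⟨μ, hμ, u, rfl⟩ := hH h hh
    exact ⟨φ ∘ μ, cross0.1 hμ, φ ∘ u, φ.map_dotProduct u μ⟩
  -- Every prime of the local ring that contains the image of `H` comes from a prime inside `p`,
  -- which by `hrad` is `p` itself. If there is none, the ideal is trivial and the bound still
  -- holds.
  have hradB : IsLocalRing.maximalIdeal (Localization.AtPrime p) ≤ (Ideal.span (φ '' H)).radical := by
    rw [Ideal.radical_eq_sInf]
    refine le_sInf ?_
    rintro Q ⟨hQ, hQp⟩
    have h1 := hrad (Q.comap φ) inferInstance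
      (fun h hh => hQ (Ideal.subset_span ⟨h, hh, rfl⟩))
      (fun a ha => by
        by_contra hap
        exact hQp.ne_top (Ideal.eq_top_of_isUnit_mem _ ha (isUnit_algebraMap hap)))
    rw [← Localization.AtPrime.map_eq_maximalIdeal]
    exact (Ideal.map_mono h1.ge).trans Ideal.map_comap_le
  obtain ⟨v₀, hv₀, hgen₀⟩ := exists_line_le_span reg hm hwB (φ '' H) (fun h hh => by
    obtain ⟨μ, hμ, u, rfl⟩ := hHB h hh
    exact ⟨μ, hμ, fun m hm' => ⟨_, smul_eq_of_cross (cross_eq_zero_trans hwB hm' hμ) u⟩⟩) hradB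
  obtain ⟨s, hs, v, hv⟩ := exists_vec_eq_algebraMap v₀
  have hsu := isUnit_algebraMap hs
  have hwv : w ⨯₃ v = 0 := by
    rw [cross0]
    change _ ⨯₃ (algebraMap _ _ ∘ v) = 0
    rw [hv, map_smul, mem_line.1 hv₀, smul_zero]
  have hgen : ∀ m, (φ ∘ w) ⨯₃ m = 0 → ∃ c : Localization.AtPrime p, m = c • (φ ∘ v) := by
    intro m hm'
    obtain ⟨c, hc⟩ := hgen₀ m hm'
    obtain ⟨t, ht⟩ := hsu.exists_left_inv
    refine ⟨c * t, ?_⟩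
    change m = (c * t) • (algebraMap _ _ ∘ v)
    rw [hv, smul_smul, mul_assoc, ht, mul_one, hc]
  have hv0 : v ≠ 0 := by
    rintro rfl
    obtain ⟨c, hc⟩ := hgen _ (cross_self _)
    refine hwB (hc.trans ?_)
    ext i
    simp
  -- The conclusions over the local ring concern finitely generated modules, so one element outside
  -- `p` clears all the denominators.
  obtain ⟨a₁, ha₁, h₁⟩ := exists_pow_smul_mem (p := p) (N := line w) (K := A ∙ v)
    (IsNoetherian.noetherian _) (fun m hm' => by
      obtain ⟨c, hc⟩ := hgen _ (cross0.1 (mem_line.1 hm'))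
      obtain ⟨⟨c', s'⟩, hcs⟩ := IsLocalization.surj p.primeCompl c
      refine ⟨s', s'.2, Submodule.mem_span_singleton.2 ⟨c', hφc ?_⟩⟩
      ext i
      have := congrFun hc i
      simp only [Function.comp_apply, Pi.smul_apply, smul_eq_mul, map_mul] at this ⊢
      rw [this]
      linear_combination -φ (v i) * hcs)
  -- Each `μ` is a multiple of `v`, so the ideal of coordinates of `v` contains `H` and hence powers
  -- of `x`, `y` and `z`. Those powers are again a regular sequence, as Koszul exactness requires.
  have key : ∀ r ∈ IsLocalRing.maximalIdeal (Localization.AtPrime p),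
      ∃ n, ∃ b, r ^ n = b ⬝ᵥ (φ ∘ v) := by
    intro r hr
    obtain ⟨n, hn⟩ := hradB hr
    refine ⟨n, mem_span_range_three.1 (Ideal.span_le.2 ?_ hn)⟩
    intro h hh
    obtain ⟨μ, hμ, u, rfl⟩ := hHB h hh
    obtain ⟨c, rfl⟩ := hgen μ hμ
    rw [SetLike.mem_coe, mem_span_range_three]
    exact ⟨c • u, by simp⟩
  obtain ⟨n₁, b₁, hb₁⟩ := key x (by rw [← hm]; exact Ideal.subset_span (by simp))
  obtain ⟨n₂, b₂, hb₂⟩ := key y (by rw [← hm]; exact Ideal.subset_span (by simp))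
  obtain ⟨n₃, b₃, hb₃⟩ := key z (by rw [← hm]; exact Ideal.subset_span (by simp))
  obtain ⟨a₂, ha₂, h₂⟩ := exists_pow_smul_mem (p := p)
    (N := LinearMap.ker (dotProductBilin A A v)) (K := LinearMap.range (crossProduct v))
    (IsNoetherian.noetherian _) (fun u hu => by
      have hu' : u ⬝ᵥ v = 0 := (dotProduct_comm _ _).trans hu
      obtain ⟨t, ht⟩ := exists_eq_cross (reg.pow n₁ n₂ n₃) hb₁ hb₂ hb₃ (u := φ ∘ u)
        (by rw [← φ.map_dotProduct, hu', map_zero])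
      obtain ⟨s', hs', t', ht'⟩ := exists_vec_eq_algebraMap t
      refine ⟨s', hs', t', hφc ?_⟩
      change φ ∘ (v ⨯₃ t') = φ ∘ (s' • u)
      rw [comp_cross]
      change _ ⨯₃ (algebraMap _ _ ∘ t') = _
      rw [ht', map_smul, ← ht]
      ext i
      simp [φ])
  refine ⟨v, hv0, hwv, a₁ * a₂, fun h => (Ideal.IsPrime.mem_or_mem inferInstance h).elim ha₁ ha₂,
    fun m hm' => ?_, fun u hu => ?_⟩
  · obtain ⟨c, hc⟩ := Submodule.mem_span_singleton.1 (h₁ m hm')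
    exact ⟨a₂ * c, by rw [mul_comm a₁, mul_smul, ← hc, mul_smul]⟩
  · obtain ⟨t, ht⟩ := h₂ u ((dotProduct_comm _ _).trans hu)
    exact ⟨a₁ • t, by rw [mul_smul, ← ht, map_smul]⟩

end LocalAlgebra

/-! ### Alternating maps in two variables. -/

section Alternating

open Matrix

variable {R M N : Type*} [CommRing R] [AddCommGroup M] [Module R M] [AddCommGroup N] [Module R N]

/-- The bilinear map of an alternating map in two variables. -/
def altBilin (g : M [⋀^Fin 2]→ₗ[R] N) : M →ₗ[R] M →ₗ[R] N :=
  LinearMap.mk₂ R (fun x y => g ![x, y])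
    (fun x x' y => g.map_vecCons_add ![y] x x')
    (fun a x y => g.map_vecCons_smul ![y] a x)
    (fun x y y' => by
      have h : ∀ z, Function.update ![x, y] 1 z = ![x, z] := fun z => by
        ext i
        fin_cases i <;> rfl
      have := g.map_update_add ![x, y] 1 y y'
      rwa [h, h, h] at this)
    (fun a x y => by
      have h : ∀ z, Function.update ![x, y] 1 z = ![x, z] := fun z => by
        ext i
        fin_cases i <;> rfl
      have := g.map_update_smul ![x, y] 1 a y
      rwa [h, h] at this)

theorem altBilin_apply (g : M [⋀^Fin 2]→ₗ[R] N) (x y : M) : altBilin g x y = g ![x, y] := rfl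

theorem altBilin_self (g : M [⋀^Fin 2]→ₗ[R] N) (x : M) : altBilin g x x = 0 :=
  g.map_eq_zero_of_eq _ (i := 0) (j := 1) rfl (by simp)

theorem altBilin_swap (g : M [⋀^Fin 2]→ₗ[R] N) (x y : M) : altBilin g y x = - altBilin g x y := by
  have := altBilin_self g (x + y)
  simp only [map_add, LinearMap.add_apply, altBilin_self, zero_add, add_zero] at this
  exact eq_neg_of_add_eq_zero_left this

theorem altBilin_sum (g : M [⋀^Fin 2]→ₗ[R] N) (e : Fin 3 → M) (a b : Fin 3 → R) :
    altBilin g (∑ i, a i • e i) (∑ i, b i • e i) = (a ⨯₃ b) 0 • altBilin g (e 1) (e 2) +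
      (a ⨯₃ b) 1 • altBilin g (e 2) (e 0) + (a ⨯₃ b) 2 • altBilin g (e 0) (e 1) := by
  simp only [Fin.sum_univ_three, map_add, LinearMap.add_apply, map_smul, LinearMap.smul_apply,
    altBilin_self]
  rw [altBilin_swap g (e 0) (e 1), altBilin_swap g (e 1) (e 2), altBilin_swap g (e 2) (e 0)]
  simp only [cross_apply, cons_val]
  module

/-- An alternating map in two variables, from a bilinear map. -/
def altOfBilin (B : M →ₗ[R] M →ₗ[R] N) (hB : ∀ x, B x x = 0) : M [⋀^Fin 2]→ₗ[R] N where
  toFun m := B (m 0) (m 1)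
  map_update_add' := by
    intro _ m i x y
    fin_cases i <;> simp
  map_update_smul' := by
    intro _ m i x y
    fin_cases i <;> simp
  map_eq_zero_of_eq' := by
    intro m i j h hij
    have : m 0 = m 1 := by
      fin_cases i <;> fin_cases j <;> simp_all
    rw [this, hB]

end Alternating

/-! ### Local normal form of a generic codimension one distribution. -/

section Model

open Matrix

variable {X : Scheme.{0}} {f : X ⟶ Spec (.of ℂ)} {U V W : X.Opens}
  {e : Fin 3 → Γ(tangentSheaf f, U)}

/-- An affine open `U` with a frame `e` of the tangent sheaf, over which the codimension one
distribution `F` is the kernel of a primitive one-form `w` whose Koszul complex is exact. -/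
structure FModel (F : Distribution f 1) (U : X.Opens) (e : Fin 3 → Γ(tangentSheaf f, U))
    (w : Fin 3 → Γ(X, U)) : Prop where
  isChart : IsChart f U e
  mem_iff : ∀ (V : X.Opens) (h : V ≤ U) (m : Γ(tangentSheaf f, V)),
    F.π.app V m = 0 ↔ vres h w ⬝ᵥ isChart.isBasisOver.coord h m = 0
  ne_zero : w ≠ 0
  prim : ∀ (V : X.Opens) (h : V ≤ U) (m : Fin 3 → Γ(X, V)), vres h w ⨯₃ m = 0 →
    ∃ c : Γ(X, V), m = c • vres h w
  koszul : ∀ u : Fin 3 → Γ(X, U), u ⬝ᵥ w = 0 → ∃ t, u = w ⨯₃ t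

/-- The ideal of the base locus of `F`, in terms of a one-form defining `F`. -/
theorem exists_normal_of_sing (F : Distribution f 1) (hU : IsBasisOver (tangentSheaf f) U e)
    {w : Fin 3 → Γ(X, U)} (hw : ∀ (V : X.Opens) (h : V ≤ U) (m : Γ(tangentSheaf f, V)),
      F.π.app V m = 0 → vres h w ⬝ᵥ hU.coord h m = 0)
    (l : Γ(dual (altSheaf F.T 2), U)) (η : Γ(altSheaf (tangentSheaf f) 2, U)) :
    ∃ μ, w ⨯₃ μ = 0 ∧ ∃ u, evalLin l (pullForm F.φ 2 U η) = u ⬝ᵥ μ := by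
  let cl : ∀ (V : X.Opens) (h : V ≤ U), Γ(F.T, V) →ₗ[Γ(X, V)] (Fin 3 → Γ(X, V)) := fun V h =>
    { toFun := fun t => hU.coord h (F.φ.app V t)
      map_add' := fun a b => by simp only [map_add]
      map_smul' := fun a b => by
        simp only [Scheme.Modules.Hom.app_smul, map_smul, RingHom.id_apply] }
  have cres : ∀ {V W : X.Opens} (h' : W ≤ V) (h : V ≤ U) s,
      vres h' (cl V h s) = cl W (h'.trans h) (resM _ h' s) := by
    intro V W h' h s
    change vres h' (hU.coord h (F.φ.app V s)) = hU.coord _ (F.φ.app W (resM F.T h' s))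
    rw [← resM_app, hU.coord_res]
    rfl
  have hcw : ∀ {V : X.Opens} (h : V ≤ U) s, vres h w ⬝ᵥ cl V h s = 0 := fun h s =>
    hw _ h _ (F.app_app _ _)
  -- The coordinates of the cross product of two sections of `F.T` are two-forms on `F.T`. As such a
  -- product is parallel to `w`, so is the vector of these two-forms.
  have hex : ∀ i : Fin 3, ∃ ε : Γ(altSheaf F.T 2, U), ∀ V (h : V ≤ U) m,
      aev ε h m = (cl V h (m 0) ⨯₃ cl V h (m 1)) i := fun i =>
    exists_aev (fun V h => altOfBilin
      ((crossProduct.compl₁₂ (cl V h) (cl V h)).compr₂ (LinearMap.proj i))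
      fun t => congrFun (cross_self _) i) fun h' h m => by
        change vres h' (cl _ h (m 0) ⨯₃ cl _ h (m 1)) i = (cl _ _ _ ⨯₃ cl _ _ _) i
        rw [vres_cross, cres, cres]
  choose ε hε using hex
  let u : Fin 3 → Γ(X, U) := ![aev η le_rfl ![e 1, e 2], aev η le_rfl ![e 2, e 0],
    aev η le_rfl ![e 0, e 1]]
  have hη : pullForm F.φ 2 U η = ∑ i, u i • ε i := by
    refine aev_ext fun V h m => ?_
    have h1 : aev (pullForm F.φ 2 U η) h m =
        altBilin (aevₗ η h) (F.φ.app V (m 0)) (F.φ.app V (m 1)) :=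
      congrArg (aev η h) (funext fun i => by fin_cases i <;> rfl)
    have h2 : ∀ t, F.φ.app V t = ∑ i, cl V h t i • resM _ h (e i) := fun t => by
      rw [← hU.coord_symm_apply]
      exact ((hU.coord h).symm_apply_apply _).symm
    have h3 : ∀ i j, resO h (aev η le_rfl ![e i, e j]) =
        altBilin (aevₗ η h) (resM _ h (e i)) (resM _ h (e j)) := fun i j => by
      rw [resO_aev]
      exact congrArg (aev η h) (funext fun i => by fin_cases i <;> rfl)
    rw [h1, h2, h2, altBilin_sum, ← h3, ← h3, ← h3]
    simp only [aev_add, aev_smul, hε, Fin.sum_univ_three, u, cons_val, smul_eq_mul]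
    ring
  -- Applying `l` turns the vector of two-forms into a vector of functions parallel to `w`. The
  -- values of `η` on pairs of frame vectors supply `u`.
  refine ⟨fun i => lev l le_rfl (ε i), cross_eq_zero_of fun i j => ?_, u, ?_⟩
  · rw [← lev_map_smul, ← lev_map_smul]
    refine congrArg _ (aev_ext fun V h m => ?_)
    rw [aev_smul, aev_smul, hε, hε]
    exact cross_smul_eq (cross_cross_perp (hcw h (m 0)) (hcw h (m 1))) i j
  · rw [evalLin_eq, ← levₗ_apply, hη, map_sum]
    simp only [map_smul, levₗ_apply, dotProduct, smul_eq_mul]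

variable [IsIntegral X]

/-- A power of `b` clears the denominators of `u`, the hypothesis applies over `U`, and both `a` and
that power become units on the smaller basic open. -/
theorem exists_cross_eq_of_basicOpen {w : Fin 3 → Γ(X, U)} (hU : IsAffineOpen U) {a : Γ(X, U)}
    (hk : ∀ u : Fin 3 → Γ(X, U), u ⬝ᵥ w = 0 → ∃ t, a • u = w ⨯₃ t) (b : Γ(X, U))
    (hab : X.basicOpen b ≤ X.basicOpen a) (u : Fin 3 → Γ(X, X.basicOpen b))
    (hu : u ⬝ᵥ vres (X.basicOpen_le b) w = 0) : ∃ t, u = vres (X.basicOpen_le b) w ⨯₃ t := by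
  by_cases hne : (X.basicOpen b : Set X).Nonempty
  · obtain ⟨n, u', hu'⟩ := exists_vres_eq hU b u
    obtain ⟨t, ht⟩ := hk u' (resO_injective (X.basicOpen_le b) hne (by
      rw [resO_dot, hu', smul_dotProduct, hu, smul_zero, map_zero]))
    have hb : IsUnit (resO (X.basicOpen_le b) b ^ n) := (isUnit_resO_basicOpen b).pow n
    have ha' : IsUnit (resO (X.basicOpen_le b) a) := by
      rw [← resO_resO hab (X.basicOpen_le a)]
      exact (isUnit_resO_basicOpen a).map _
    obtain ⟨r, hr⟩ := (ha'.mul hb).exists_left_inv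
    refine ⟨r • vres (X.basicOpen_le b) t, ?_⟩
    have := congrArg (vres (X.basicOpen_le b)) ht
    rw [vres_smul, vres_cross, hu', smul_smul] at this
    rw [map_smul, ← this, smul_smul, hr, one_smul]
  · have := subsingleton_section hne
    exact ⟨0, Subsingleton.elim _ _⟩

/-- Over basic opens the coefficient comes from clearing denominators. It is unique because `w` is
nonzero on an integral scheme, so the local coefficients glue over an arbitrary smaller open. -/
theorem exists_smul_eq_of_cross {w : Fin 3 → Γ(X, U)} (hU : IsAffineOpen U) (hw : w ≠ 0)
    {a : Γ(X, U)} (hp : ∀ m : Fin 3 → Γ(X, U), w ⨯₃ m = 0 → ∃ c : Γ(X, U), a • m = c • w)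
    (hV : V ≤ X.basicOpen a) (m : Fin 3 → Γ(X, V))
    (hm : vres (hV.trans (X.basicOpen_le a)) w ⨯₃ m = 0) :
    ∃ c : Γ(X, V), m = c • vres (hV.trans (X.basicOpen_le a)) w := by
  have hVU := hV.trans (X.basicOpen_le a)
  have hloc : ∀ x ∈ V, ∃ (W : X.Opens) (h : W ≤ V), x ∈ W ∧
      ∃ c : Γ(X, W), vres h m = c • vres (h.trans hVU) w := by
    intro x hx
    obtain ⟨b, hb, hxb⟩ := exists_basicOpen_le hU hx (hVU hx)
    have hne : (X.basicOpen b : Set X).Nonempty := ⟨x, hxb⟩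
    refine ⟨_, hb, hxb, ?_⟩
    obtain ⟨n, m', hm'⟩ := exists_vres_eq hU b (vres hb m)
    obtain ⟨c, hc⟩ := hp m' (vres_injective (X.basicOpen_le b) hne (by
      have := congrArg (vres hb) hm
      rw [vres_cross, vres_vres, vres_zero] at this
      rw [vres_cross, hm', map_smul, this, smul_zero, vres_zero]))
    have hbu : IsUnit (resO (X.basicOpen_le b) b ^ n) := (isUnit_resO_basicOpen b).pow n
    have ha' : IsUnit (resO (X.basicOpen_le b) a) := by
      rw [← resO_resO (hb.trans hV) (X.basicOpen_le a)]
      exact (isUnit_resO_basicOpen a).map _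
    obtain ⟨r, hr⟩ := (ha'.mul hbu).exists_left_inv
    refine ⟨r * resO (X.basicOpen_le b) c, ?_⟩
    have := congrArg (vres (X.basicOpen_le b)) hc
    rw [vres_smul, vres_smul, hm', smul_smul] at this
    rw [mul_smul, ← this, smul_smul, hr, one_smul]
  obtain ⟨c, hc⟩ := exists_section_of_local (V := V)
    (fun W h c => vres h m = c • vres (h.trans hVU) w)
    (fun h h' c hc => by
      rw [← vres_vres h' h, hc, vres_smul, vres_vres])
    (fun {W} h c d hc hd => by
      by_cases hne : (W : Set X).Nonempty
      · have := isDomain_section hne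
        exact smul_left_injective _ (vres_ne_zero (h.trans hVU) hne hw) (hc.symm.trans hd)
      · have := subsingleton_section hne
        exact Subsingleton.elim _ _) hloc
  refine ⟨c, funext fun i => resO_ext fun x hx => ?_⟩
  obtain ⟨W, h, hxW, d, hd⟩ := hloc x hx
  refine ⟨W, h, hxW, ?_⟩
  rw [← hc W h d hd, ← vres_vres h hVU, ← vres_smul] at hd
  exact congrFun hd i

/-- A generically correct normal form is replaced by its saturation. The ideal of Sing(`F`) is
generated by functions `u ⬝ᵥ μ` with `μ` parallel to `w`, and genericity says that a closed point of
the support has no smaller prime containing this ideal; this is what `exists_saturation` needs. -/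
theorem exists_fmodel [SmoothOfRelativeDimension 3 f] (F : Distribution f 1) (hF : F.IsGeneric)
    (x : X) : ∃ U e w, x ∈ U ∧ FModel F U e w := by
  obtain ⟨U, e, hx, hU⟩ := exists_isChart f x
  have hU0 : (U : Set X).Nonempty := ⟨x, hx⟩
  have := isDomain_section hU0
  have := hU.isNoetherianRing
  obtain ⟨w, hw0, hw⟩ := exists_normal F hU hU0
  obtain ⟨q, hq, hxq⟩ := exists_prime hU.isAffineOpen hx
  -- The depth argument takes place at a closed specialization `p` of `x`. The denominator `a`
  -- avoids `p`, hence also the smaller prime `q`, so its basic open still contains `x`.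
  obtain ⟨p, hp, hqp⟩ := q.exists_le_maximal hq.ne_top
  obtain ⟨x₁, x₂, x₃, reg, hm⟩ := hU.exists_regTriple p
  obtain ⟨v, hv0, hwv, a, ha, h₁, h₂⟩ := exists_saturation reg hm hw0
    {h | ∃ (l : Γ(det F.T 2, U)) (η : Γ(formSheaf f 2, U)), h = evalLin l (pullForm F.φ 2 U η)}
    (by
      rintro _ ⟨l, η, rfl⟩
      exact exists_normal_of_sing F hU.isBasisOver (fun V h m => (hw V h m).1) l η)
    (fun Q hQ hHQ hQp => by
      refine prime_eq_of_krullDim_le_zero hF ⟨U, hU.isAffineOpen⟩ ?_ hQp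
      exact (Scheme.IdealSheafData.ideal_ofIdeals_le _ _).trans (Ideal.span_le.2 hHQ))
  have hxa : x ∈ X.basicOpen a := (hxq a).2 fun h => ha (hqp h)
  refine ⟨_, _, vres (X.basicOpen_le a) v, hxa, hU.basicOpen a, fun V h m => ?_, ?_, ?_, ?_⟩
  · rw [hw V (h.trans (X.basicOpen_le a))]
    by_cases hne : (V : Set X).Nonempty
    · have := isDomain_section hne
      have e1 := vres_ne_zero (h.trans (X.basicOpen_le a)) hne hw0
      have e2 := vres_ne_zero (h.trans (X.basicOpen_le a)) hne hv0
      have e3 := congrArg (vres (h.trans (X.basicOpen_le a))) hwv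
      have e4 : hU.isBasisOver.coord (h.trans (X.basicOpen_le a)) m =
          (hU.basicOpen a).isBasisOver.coord h m := by
        rw [← LinearEquiv.eq_symm_apply]
        refine ((((hU.basicOpen a).isBasisOver.coord h).symm_apply_apply m).symm.trans ?_)
        rw [IsBasisOver.coord_symm_apply, IsBasisOver.coord_symm_apply]
        simp only [resM_resM]
      rw [vres_cross, vres_zero] at e3
      rw [vres_vres, ← e4]
      exact ⟨dot_eq_zero_of_cross e1 e3, dot_eq_zero_of_cross e2 (by
        rw [← cross_anticomm, e3, neg_zero])⟩
    · have := subsingleton_section hne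
      exact iff_of_true (Subsingleton.elim _ _) (Subsingleton.elim _ _)
  · exact vres_ne_zero _ ⟨x, hxa⟩ hv0
  · intro V h m hm
    rw [vres_vres] at hm ⊢
    refine exists_smul_eq_of_cross hU.isAffineOpen hv0 (fun m hm => ?_) h m hm
    exact h₁ m (cross_eq_zero_trans hv0 (by rw [← cross_anticomm, hwv, neg_zero]) hm)
  · exact exists_cross_eq_of_basicOpen hU.isAffineOpen h₂ a le_rfl

end Model

/-! ### Generators of invertible sheaves, stalks of ideals, and extension of sections from basic
opens. -/

section Lifting

variable {X : Scheme.{0}} {U V W : X.Opens}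

theorem IsInvertible.exists_isGen {L : X.Modules} (hL : IsInvertible L) (x : X) :
    ∃ (U : X.Opens) (g : Γ(L, U)), x ∈ U ∧ IsGen L U g := by
  obtain ⟨U, hx, ⟨i⟩⟩ := hL x
  let O : U.toScheme.Modules := SheafOfModules.unit U.toScheme.ringCatSheaf
  let φ : O ⟶ L.restrict U.ι := i.inv
  have hφ : IsIso φ := Iso.isIso_inv i
  let I : Γ(L.restrict U.ι, ⊤) := φ.app ⊤ (show Γ(U.toScheme, ⊤) from 1)
  refine ⟨U.ι ''ᵁ ⊤, I, by simpa using hx, fun V h => ?_⟩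
  obtain ⟨V', rfl⟩ : ∃ V' : U.toScheme.Opens, U.ι ''ᵁ V' = V :=
    ⟨U.ι ⁻¹ᵁ V, by
      rw [Scheme.Hom.image_preimage_eq_opensRange_inf, inf_eq_right]
      exact h.trans (Scheme.Hom.image_le_opensRange _ _)⟩
  have key : (fun c : Γ(X, U.ι ''ᵁ V') => c • resM L h I) =
      (fun d => φ.app V' (show Γ(U.toScheme, V') from d)) ∘ (U.ι.appIso V').hom := by
    funext c
    have h1 : (show Γ(O, V') from (U.ι.appIso V').hom c) =
        (show Γ(U.toScheme, V') from (U.ι.appIso V').hom c) • resM O le_top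
          (show Γ(U.toScheme, ⊤) from 1) := by
      have : resM O (le_top : V' ≤ ⊤) (show Γ(U.toScheme, ⊤) from 1) =
        (show Γ(U.toScheme, V') from 1) := map_one (resO (le_top : V' ≤ ⊤))
      rw [this]
      exact (mul_one ((U.ι.appIso V').hom c)).symm
    have h2 := congrArg (φ.app V') h1
    rw [Scheme.Modules.Hom.app_smul] at h2
    refine Eq.trans ?_ (h2.trans (congrArg _ (resM_app φ le_top
      (show Γ(U.toScheme, ⊤) from 1)).symm)).symm
    change _ = (U.ι.appIso V').inv ((U.ι.appIso V').hom c) • resM L h I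
    rw [Iso.hom_inv_id_apply]
  rw [key]
  exact (app_bijective φ V').comp ((ConcreteCategory.isIso_iff_bijective _).1 inferInstance)

theorem germ_mem_map_iff (hU : IsAffineOpen U) {x : X} (hx : x ∈ U) (I : Ideal Γ(X, U))
    (a : Γ(X, U)) : X.presheaf.germ U x hx a ∈ I.map (X.presheaf.germ U x hx).hom ↔
      ∃ r : Γ(X, U), x ∈ X.basicOpen r ∧ r * a ∈ I := by
  let : Algebra Γ(X, U) (X.presheaf.stalk x) := (X.presheaf.germ U x hx).hom.toAlgebra
  have hloc : IsLocalization.AtPrime (X.presheaf.stalk x) (hU.primeIdealOf ⟨x, hx⟩).asIdeal :=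
    hU.isLocalization_stalk ⟨x, hx⟩
  have hr : ∀ r : Γ(X, U), x ∈ X.basicOpen r ↔ r ∈ (hU.primeIdealOf ⟨x, hx⟩).asIdeal.primeCompl :=
    fun r => (Scheme.mem_basicOpen X r x hx).trans (IsLocalization.AtPrime.isUnit_to_map_iff _ _ r)
  change algebraMap _ (X.presheaf.stalk x) a ∈ I.map (algebraMap _ _) ↔ _
  rw [IsLocalization.mem_map_algebraMap_iff (hU.primeIdealOf ⟨x, hx⟩).asIdeal.primeCompl]
  constructor
  · rintro ⟨⟨i, s⟩, h⟩
    rw [← map_mul] at h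
    obtain ⟨c, hc⟩ := (IsLocalization.eq_iff_exists
      (hU.primeIdealOf ⟨x, hx⟩).asIdeal.primeCompl (X.presheaf.stalk x)).1 h
    refine ⟨c * s, (hr _).2 (mul_mem c.2 s.2), ?_⟩
    have : (c : Γ(X, U)) * s * a = c * i := by rw [← hc]; ring
    rw [this]
    exact I.mul_mem_left _ i.2
  · rintro ⟨r, hxr, h⟩
    exact ⟨⟨⟨_, h⟩, ⟨r, (hr r).1 hxr⟩⟩, by rw [← map_mul, mul_comm]⟩

theorem exists_resO_eq_of_eq (hU : IsAffineOpen U) (a : Γ(X, U)) (hW : W = X.basicOpen a)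
    (h : W ≤ U) (g : Γ(X, W)) :
    ∃ (n : ℕ) (g' : Γ(X, U)), resO h g' = resO h a ^ n * g := by
  subst hW
  exact exists_resO_eq hU a g

/-- Sections of a locally free sheaf over a basic open extend, after multiplication by a power. -/
theorem exists_resM_eq [IsIntegral X] {ι : Type} [Fintype ι] {M : X.Modules}
    (hM : ∀ x : X, ∃ (W : X.Opens) (e : ι → Γ(M, W)), x ∈ W ∧ IsBasisOver M W e)
    (hU : IsAffineOpen U) (a : Γ(X, U)) (m : Γ(M, X.basicOpen a)) :
    ∃ (n : ℕ) (m' : Γ(M, U)), resM M (X.basicOpen_le a) m' = resO (X.basicOpen_le a) a ^ n • m := by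
  classical
  by_cases hne : (X.basicOpen a : Set X).Nonempty
  swap
  · have := subsingleton_sectionM M hne
    exact ⟨0, 0, Subsingleton.elim _ _⟩
  have hloc : ∀ x : U, ∃ b : Γ(X, U), x.1 ∈ X.basicOpen b ∧
      (∃ e : ι → Γ(M, X.basicOpen b), IsBasisOver M (X.basicOpen b) e) := by
    intro x
    obtain ⟨W, e, hxW, he⟩ := hM x.1
    obtain ⟨b, hb, hxb⟩ := exists_basicOpen_le hU hxW x.2
    exact ⟨b, hxb, _, he.res hb⟩
  choose b hxb e he using hloc
  obtain ⟨t, ht⟩ := hU.isCompact.elim_finite_subcover (fun x : U => (X.basicOpen (b x) : Set X))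
    (fun x => (X.basicOpen (b x)).2) (fun x hx => Set.mem_iUnion.2 ⟨⟨x, hx⟩, hxb _⟩)
  have hlift : ∀ x : U, ∃ (n : ℕ) (m' : Γ(M, X.basicOpen (b x))),
      resM M (inf_le_left : X.basicOpen (b x) ⊓ X.basicOpen a ≤ _) m' =
        (resO (inf_le_left.trans (X.basicOpen_le (b x))) a ^ n :
          Γ(X, X.basicOpen (b x) ⊓ X.basicOpen a)) •
          resM M (inf_le_right : X.basicOpen (b x) ⊓ X.basicOpen a ≤ _) m := by
    intro x
    choose n c hc using fun i => exists_resO_eq_of_eq (hU.basicOpen (b x))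
      (resO (X.basicOpen_le (b x)) a) (Scheme.basicOpen_res X a _).symm inf_le_left
      ((he x).coord inf_le_left (resM M inf_le_right m) i)
    refine ⟨∑ i, n i, ∑ i, (resO (X.basicOpen_le (b x)) a ^ (∑ j ∈ Finset.univ.erase i, n j) * c i) •
      e x i, ?_⟩
    rw [sum_smul_resM, ← (he x).coord_symm_apply, LinearEquiv.symm_apply_eq, map_smul]
    funext i
    simp only [map_mul, map_pow, hc, Pi.smul_apply, smul_eq_mul, resO_resO]
    rw [← mul_assoc, ← pow_add, Finset.sum_erase_add _ _ (Finset.mem_univ i)]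
  choose n m' hm' using hlift
  let N := ∑ x ∈ t, n x
  have hN : ∀ x ∈ t, ∃ k, N = k + n x := fun x hx =>
    ⟨∑ y ∈ t.erase x, n y, (Finset.sum_erase_add _ _ hx).symm⟩
  choose k hk using hN
  have hres : ∀ (x : t) (W : X.Opens) (h : W ≤ X.basicOpen (b x)) (h' : W ≤ X.basicOpen a),
      resM M h (resO (X.basicOpen_le (b x)) a ^ k x x.2 • m' x) =
        resO (h.trans (X.basicOpen_le _)) a ^ N • resM M h' m := by
    intro x W h h'
    have := congrArg (resM M (le_inf h h')) (hm' x)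
    rw [resM_resM, resM_smul, resM_resM, map_pow, resO_resO] at this
    rw [resM_smul, this, smul_smul, map_pow, resO_resO, ← pow_add, ← hk]
  obtain ⟨s, hs⟩ := resM_glue M (V := U) (fun x : t => X.basicOpen (b x))
    (fun x => X.basicOpen_le (b x)) (fun x hx => by
      obtain ⟨y, hy, hxy⟩ := Set.mem_iUnion₂.1 (ht hx)
      exact Opens.mem_iSup.2 ⟨⟨y, hy⟩, hxy⟩)
    (fun x => resO (X.basicOpen_le (b x)) a ^ k x x.2 • m' x) (fun x y => by
      -- Agreement on an overlap is tested after restriction to the basic open of `a`. This loses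
      -- nothing: on an integral scheme nonempty opens meet, and restriction is injective for a
      -- sheaf with local bases.
      by_cases hxy : ((X.basicOpen (b x) ⊓ X.basicOpen (b y) : X.Opens) : Set X).Nonempty
      · have hne' := nonempty_preirreducible_inter
          (X.basicOpen (b x) ⊓ X.basicOpen (b y)).2 (X.basicOpen a).2 hxy hne
        refine (he x).resM_injective inf_le_left
          (inf_le_left : (X.basicOpen (b x) ⊓ X.basicOpen (b y)) ⊓ X.basicOpen a ≤ _) hne' ?_
        rw [resM_resM, resM_resM, hres x _ _ inf_le_right, hres y _ _ inf_le_right]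
      · have := subsingleton_sectionM M hxy
        exact Subsingleton.elim _ _)
  refine ⟨N, s, resM_ext fun x hx => ?_⟩
  obtain ⟨y, hy, hxy⟩ := Set.mem_iUnion₂.1 (ht (X.basicOpen_le a hx))
  refine ⟨X.basicOpen a ⊓ X.basicOpen (b y), inf_le_left, ⟨hx, hxy⟩, ?_⟩
  rw [resM_resM, ← resM_resM M (inf_le_right : X.basicOpen a ⊓ X.basicOpen (b y) ≤ _)
    (X.basicOpen_le (b y)), hs ⟨y, hy⟩, hres ⟨y, hy⟩ _ _ inf_le_left, resM_smul, map_pow, resO_resO]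

end Lifting

/-! ### One-forms as linear forms, and the dual of a locally free sheaf. -/

section OneForms

variable {X : Scheme.{0}} {U V W : X.Opens} {M : X.Modules}

/-- The value of a section of `altSheaf M 1`, as a linear map. -/
def alev (l : Γ(altSheaf M 1, U)) (h : V ≤ U) : Γ(M, V) →ₗ[Γ(X, V)] Γ(X, V) :=
  (AlternatingMap.ofSubsingleton Γ(X, V) Γ(M, V) Γ(X, V) (0 : Fin 1)).symm (aevₗ l h)

theorem aev_eq_alev (l : Γ(altSheaf M 1, U)) (h : V ≤ U) (m : Fin 1 → Γ(M, V)) :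
    aev l h m = alev l h (m 0) :=
  congrArg (aev l h) (funext fun i => by rw [Subsingleton.elim i 0])

theorem resO_alev (l : Γ(altSheaf M 1, U)) (hW : W ≤ V) (h : V ≤ U) (m : Γ(M, V)) :
    resO hW (alev l h m) = alev l (hW.trans h) (resM M hW m) :=
  resO_aev l h hW fun _ => m

theorem alev_res (l : Γ(altSheaf M 1, U)) (hW : W ≤ V) (h : V ≤ U) (m : Γ(M, W)) :
    alev (resM (altSheaf M 1) h l) hW m = alev l (hW.trans h) m := rfl

theorem alev_add (l l' : Γ(altSheaf M 1, U)) (h : V ≤ U) (m : Γ(M, V)) :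
    alev (l + l') h m = alev l h m + alev l' h m := rfl

theorem alev_smul (a : Γ(X, U)) (l : Γ(altSheaf M 1, U)) (h : V ≤ U) (m : Γ(M, V)) :
    alev (a • l) h m = resO h a * alev l h m := rfl

theorem alev_ext {l l' : Γ(altSheaf M 1, U)}
    (H : ∀ V (h : V ≤ U) m, alev l h m = alev l' h m) : l = l' :=
  aev_ext fun V h m => by rw [aev_eq_alev, aev_eq_alev, H]

theorem exists_alev (g : ∀ V : X.Opens, V ≤ U → Γ(M, V) →ₗ[Γ(X, V)] Γ(X, V))
    (hres : ∀ {W V : X.Opens} (hW : W ≤ V) (h : V ≤ U) m,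
      resO hW (g V h m) = g W (hW.trans h) (resM M hW m)) :
    ∃ l : Γ(altSheaf M 1, U), ∀ V (h : V ≤ U) m, alev l h m = g V h m := by
  obtain ⟨l, hl⟩ := exists_aev (M := M) (r := 1)
    (fun V h => AlternatingMap.ofSubsingleton Γ(X, V) Γ(M, V) Γ(X, V) (0 : Fin 1) (g V h))
    (fun hW h m => hres hW h (m 0))
  exact ⟨l, fun V h m => hl V h fun _ => m⟩

theorem IsBasisOver.coord_frame_res {ι : Type} [Fintype ι] {e : ι → Γ(M, U)}
    (he : IsBasisOver M U e) (h : V ≤ U) (hW : W ≤ V) (m : Γ(M, W)) :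
    (he.res h).coord hW m = he.coord (hW.trans h) m := by
  rw [← LinearEquiv.eq_symm_apply, IsBasisOver.coord_symm_apply]
  refine ((he.coord (hW.trans h)).symm_apply_apply m).symm.trans ?_
  rw [IsBasisOver.coord_symm_apply]
  simp only [resM_resM]

open Matrix

/-- Linear forms on a sheaf with a basis, from their values on the basis. -/
theorem IsBasisOver.exists_alev_eq {e : Fin 3 → Γ(M, U)} (he : IsBasisOver M U e)
    (b : Fin 3 → Γ(X, U)) : ∃ l : Γ(altSheaf M 1, U), ∀ V (h : V ≤ U) m,
      alev l h m = vres h b ⬝ᵥ he.coord h m :=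
  exists_alev (fun V h => (dotProductBilin Γ(X, V) Γ(X, V) (vres h b)).comp (he.coord h).toLinearMap)
    fun hW h m => by
      change resO hW (vres h b ⬝ᵥ he.coord h m) = vres _ b ⬝ᵥ he.coord _ (resM M hW m)
      rw [resO_dot, vres_vres, he.coord_res]
      rfl

theorem IsBasisOver.alev_eq {e : Fin 3 → Γ(M, U)} (he : IsBasisOver M U e)
    (l : Γ(altSheaf M 1, U)) (h : V ≤ U) (m : Γ(M, V)) :
    alev l h m = vres h (fun i => alev l le_rfl (e i)) ⬝ᵥ he.coord h m := by
  conv_lhs => rw [← (he.coord h).symm_apply_apply m, he.coord_symm_apply, map_sum]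
  refine Finset.sum_congr rfl fun i _ => ?_
  rw [map_smul, smul_eq_mul, mul_comm, vres_apply, resO_alev]

/-- The dual of a locally free sheaf is locally free. -/
theorem IsBasisOver.exists_dual {e : Fin 3 → Γ(M, U)} (he : IsBasisOver M U e) :
    ∃ ε : Fin 3 → Γ(altSheaf M 1, U), IsBasisOver (altSheaf M 1) U ε ∧
      ∀ i V (h : V ≤ U) m, alev (ε i) h m = he.coord h m i := by
  choose ε hε using fun i => he.exists_alev_eq (Pi.single i 1)
  have hε' : ∀ i V (h : V ≤ U) m, alev (ε i) h m = he.coord h m i := by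
    intro i V h m
    rw [hε]
    have : vres h (Pi.single i 1) = Pi.single i 1 := by
      funext j
      by_cases hij : j = i
      · subst hij; simp [vres_apply]
      · simp [vres_apply, hij]
    rw [this, single_one_dotProduct]
  refine ⟨ε, fun V h => ?_, hε'⟩
  have hsum : ∀ (c : Fin 3 → Γ(X, V)) (W : X.Opens) (hW : W ≤ V) m,
      alev (∑ i, c i • resM _ h (ε i)) hW m = vres hW c ⬝ᵥ he.coord (hW.trans h) m := by
    intro c W hW m
    simp only [Fin.sum_univ_three, alev_add, alev_smul, alev_res, hε', vec3_dotProduct, vres_apply]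
  refine ⟨fun c d hcd => funext fun i => ?_, fun l => ?_⟩
  · have := congrArg (fun l => alev l le_rfl (resM M h (e i))) hcd
    simp only [hsum, he.coord_basis, dotProduct_single_one] at this
    simpa using this
  · refine ⟨fun i => alev l le_rfl (resM M h (e i)), alev_ext fun W hW m => ?_⟩
    simp only [hsum]
    rw [(he.res h).alev_eq l hW m, he.coord_frame_res]

end OneForms

/-! ### Sections of `F.T` in coordinates, and extension of linear forms from `F.T`. -/

section Models

open Matrix

variable {X : Scheme.{0}} {f : X ⟶ Spec (.of ℂ)} {U V W : X.Opens}
  {e : Fin 3 → Γ(tangentSheaf f, U)} {w : Fin 3 → Γ(X, U)} {F : Distribution f 1}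

namespace FModel

theorem basicOpen [IsIntegral X] (hU : FModel F U e w) (b : Γ(X, U))
    (hb : (X.basicOpen b : Set X).Nonempty) :
    FModel F (X.basicOpen b) (fun i => resM _ (X.basicOpen_le b) (e i))
      (vres (X.basicOpen_le b) w) where
  isChart := hU.isChart.basicOpen b
  mem_iff V h m := by
    rw [hU.mem_iff V (h.trans (X.basicOpen_le b)), vres_vres,
      hU.isChart.isBasisOver.coord_frame_res]
  ne_zero := vres_ne_zero _ hb hU.ne_zero
  prim V h m hm := by
    rw [vres_vres] at hm ⊢
    exact hU.prim V _ m hm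
  koszul := exists_cross_eq_of_basicOpen hU.isChart.isAffineOpen (a := 1)
    (fun u hu => by rw [one_smul]; exact hU.koszul u hu) b
      ((X.basicOpen_le b).trans_eq (X.basicOpen_of_isUnit isUnit_one).symm)

/-- The coordinates of a section of `F.T`. -/
def coordT (hU : FModel F U e w) (h : V ≤ U) : Γ(F.T, V) →ₗ[Γ(X, V)] (Fin 3 → Γ(X, V)) where
  toFun t := hU.isChart.isBasisOver.coord h (F.φ.app V t)
  map_add' a b := by simp only [map_add]
  map_smul' a b := by simp only [Scheme.Modules.Hom.app_smul, map_smul, RingHom.id_apply]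

theorem coordT_apply (hU : FModel F U e w) (h : V ≤ U) (t : Γ(F.T, V)) :
    hU.coordT h t = hU.isChart.isBasisOver.coord h (F.φ.app V t) := rfl

theorem coordT_res (hU : FModel F U e w) (h : V ≤ U) (hW : W ≤ V) (t : Γ(F.T, V)) :
    vres hW (hU.coordT h t) = hU.coordT (hW.trans h) (resM _ hW t) := by
  rw [coordT_apply, coordT_apply, ← resM_app, hU.isChart.isBasisOver.coord_res]
  rfl

theorem dot_coordT (hU : FModel F U e w) (h : V ≤ U) (t : Γ(F.T, V)) :
    vres h w ⬝ᵥ hU.coordT h t = 0 :=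
  (hU.mem_iff V h _).1 (F.app_app V t)

theorem coordT_injective (hU : FModel F U e w) (h : V ≤ U) : Function.Injective (hU.coordT h) :=
  (hU.isChart.isBasisOver.coord h).injective.comp (F.app_injective V)

theorem exists_coordT_eq (hU : FModel F U e w) (h : V ≤ U) {m : Fin 3 → Γ(X, V)}
    (hm : vres h w ⬝ᵥ m = 0) : ∃ t, hU.coordT h t = m := by
  obtain ⟨t, ht⟩ := F.exists_app_eq V (m := (hU.isChart.isBasisOver.coord h).symm m) (by
    rw [hU.mem_iff V h, LinearEquiv.apply_symm_apply, hm])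
  exact ⟨t, by rw [coordT_apply, ht, LinearEquiv.apply_symm_apply]⟩

/-- Linear forms on `F.T` are restrictions of one-forms. -/
theorem exists_lev_eq [IsIntegral X] (hU : FModel F U e w) (l : Γ(dual F.T, U)) :
    ∃ b : Fin 3 → Γ(X, U), ∀ V (h : V ≤ U) t, lev l h t = vres h b ⬝ᵥ hU.coordT h t := by
  -- The products of `w` with the basis vectors are tangent to `F`. The relation `∑ w i • τ i = 0`,
  -- which is `w ⨯₃ w = 0`, makes the vector of values of `l` orthogonal to `w`, so the Koszul
  -- complex provides `b`.
  choose τ hτ using fun i : Fin 3 => hU.exists_coordT_eq le_rfl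
    (m := w ⨯₃ Pi.single i 1) (by rw [vres_rfl, dot_self_cross])
  have hsingle : ∀ i : Fin 3, ∀ V (h : V ≤ U), vres h (Pi.single i 1) = Pi.single i 1 := by
    intro i V h
    funext j
    by_cases hij : j = i
    · subst hij; simp [vres_apply]
    · simp [vres_apply, hij]
  have hτ' : ∀ V (h : V ≤ U) i, hU.coordT h (resM _ h (τ i)) = vres h w ⨯₃ Pi.single i 1 := by
    intro V h i
    rw [← hU.coordT_res le_rfl h, hτ, vres_cross, hsingle]
  obtain ⟨b, hb⟩ := hU.koszul (fun i => lev l le_rfl (τ i)) (by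
    have h0 : ∑ i, w i • τ i = 0 := hU.coordT_injective le_rfl (by
      rw [map_zero, map_sum]
      simp only [map_smul, hτ]
      simp only [← map_smul, ← map_sum]
      have : ∑ i, w i • Pi.single i (1 : Γ(X, U)) = w := by
        funext j
        simp [Pi.single_apply]
      rw [this, cross_self])
    have := congrArg (levₗ l le_rfl) h0
    simp only [map_sum, map_smul, map_zero, levₗ_apply, smul_eq_mul] at this
    rw [dotProduct_comm]
    exact this)
  -- The sign comes from `b ⬝ᵥ (w ⨯₃ eⱼ) = (b ⨯₃ w) j`, whereas the values of `l` on the `τ j` are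
  -- the coordinates of `w ⨯₃ b`.
  refine ⟨-b, fun V h t => ?_⟩
  by_cases hne : (V : Set X).Nonempty
  · have hd := isDomain_section hne
    obtain ⟨i, hi⟩ := Function.ne_iff.1 (vres_ne_zero h hne hU.ne_zero)
    refine mul_left_cancel₀ hi ?_
    have ht := hU.dot_coordT h t
    have h1 : vres h w i • t = ∑ j, (hU.coordT h t ⨯₃ Pi.single i 1) j • resM _ h (τ j) := by
      refine hU.coordT_injective h ?_
      rw [map_smul, smul_eq_cross _ _ _ ht, map_sum]
      simp only [map_smul, hτ']
      simp only [← map_smul, ← map_sum]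
      congr 1
      funext j
      simp [Pi.single_apply]
    have h2 := congrArg (levₗ l h) h1
    simp only [map_smul, map_sum, levₗ_apply, smul_eq_mul] at h2
    have h3 : ∀ j, lev l h (resM _ h (τ j)) = (vres h w ⨯₃ vres h b) j := by
      intro j
      rw [← vres_cross, ← hb, vres_apply, resO_lev]
    simp only [h3] at h2
    rw [h2]
    simp only [vec3_dotProduct] at ht
    have hneg : vres h (-b) = - vres h b := by
      funext j
      simp [vres_apply]
    rw [hneg]
    generalize hU.coordT h t = m at *
    generalize vres h w = w' at *
    generalize vres h b = b' at *
    simp only [vec3_dotProduct, Fin.sum_univ_three]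
    fin_cases i <;> simp [cross_apply]
    · linear_combination b' 0 * ht
    · linear_combination b' 1 * ht
    · linear_combination b' 2 * ht
  · have := subsingleton_section hne
    exact Subsingleton.elim _ _

end FModel

end Models

/-! ### Evaluation on a reflexive sheaf. -/

section Reflexive

variable {X : Scheme.{0}} {U : X.Opens}

/-- In degree one alternating forms are the same as linear forms. Carried through this
identification, `l` becomes a section of the double dual, and reflexivity represents it by a section
of `M`. -/
theorem IsReflexive.exists_eval {M : X.Modules} (hM : IsReflexive M) (l : Γ(dual (altSheaf M 1), U)) :
    ∃ t : Γ(M, U), ∀ V (h : V ≤ U) (a : Γ(altSheaf M 1, V)), lev l h a = alev a le_rfl (resM M h t) := by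
  have hA : ∀ V (l' : Γ(dual M, V)), ∃ a : Γ(altSheaf M 1, V), ∀ W (h : W ≤ V) m,
      alev a h m = lev l' h m := fun V l' =>
    exists_alev (fun W h => levₗ l' h) fun hW h m => resO_lev l' h hW m
  choose A hA using hA
  obtain ⟨b, hb⟩ := exists_lev (M := dual M) (U := U) (fun V h l' => lev l h (A V l'))
    (fun V h m n => by
      rw [← lev_map_add]
      exact congrArg _ (alev_ext fun W hW k => by rw [alev_add, hA, hA, hA, lev_add]))
    (fun V h a m => by
      rw [← lev_map_smul]
      exact congrArg _ (alev_ext fun W hW k => by rw [alev_smul, hA, hA, lev_smul]))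
    (fun hW h m => by
      rw [resO_lev]
      exact congrArg _ (alev_ext fun W hW k => by rw [alev_res, hA, hA, lev_res]))
  obtain ⟨t, ht⟩ := (hM.2 U).2 b
  refine ⟨t, fun V h a => ?_⟩
  obtain ⟨l', hl'⟩ := exists_lev (M := M) (U := V) (fun W hW m => alev a hW m)
    (fun W hW m n => map_add _ _ _) (fun W hW r m => map_smul _ _ _)
    (fun hW h m => resO_alev a hW h m)
  have ha : A V l' = a := alev_ext fun W hW m => by rw [hA, hl']
  rw [← hl', ← ha, ← hb V h l', ← ht]
  rfl

end Reflexive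

/-! ### Local normal form of the subfoliation: its vector field is a cross product. -/

section Subfoliation

open Matrix

variable {X : Scheme.{0}} {f : X ⟶ Spec (.of ℂ)} {U V W : X.Opens}
  {e : Fin 3 → Γ(tangentSheaf f, U)} {F : Distribution f 1} {L : X.Modules} {σ : L ⟶ F.T}

/-- An affine open over which `F` is in normal form and the section `σ` of `F.T` is given by the
primitive vector `v = h ⨯₃ w`. -/
structure GModel (σ : L ⟶ F.T) (U : X.Opens) (e : Fin 3 → Γ(tangentSheaf f, U))
    (w : Fin 3 → Γ(X, U)) (s₀ : Γ(L, U)) (h v : Fin 3 → Γ(X, U)) : Prop where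
  model : FModel F U e w
  isGen : IsGen L U s₀
  coordT_eq : model.coordT le_rfl (σ.app U s₀) = v
  v_ne_zero : v ≠ 0
  prim_v : ∀ (V : X.Opens) (h : V ≤ U) (m : Fin 3 → Γ(X, V)), vres h v ⨯₃ m = 0 →
    ∃ c : Γ(X, V), m = c • vres h v
  eq_cross : v = h ⨯₃ w

theorem GModel.coordT_eq' {w : Fin 3 → Γ(X, U)} {s₀ : Γ(L, U)} {h v : Fin 3 → Γ(X, U)}
    (hU : GModel σ U e w s₀ h v) (hV : V ≤ U) (c : Γ(X, V)) :
    hU.model.coordT hV (σ.app V (c • resM L hV s₀)) = c • vres hV v := by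
  rw [Scheme.Modules.Hom.app_smul, map_smul, ← resM_app, ← hU.model.coordT_res le_rfl hV,
    hU.coordT_eq]

/-- Exactness of the Hilbert–Burch complex with columns `h` and `w`. If `b` is orthogonal to `h ⨯₃
w`, then `b ⨯₃ w` is parallel to it, hence equal to `c` times it by primitivity of `v`. Then `b - c
• h` is parallel to the primitive vector `w`. -/
theorem GModel.perp {w : Fin 3 → Γ(X, U)} {s₀ : Γ(L, U)} {h v : Fin 3 → Γ(X, U)}
    (hU : GModel σ U e w s₀ h v) (hV : V ≤ U) {b : Fin 3 → Γ(X, V)} (hb : b ⬝ᵥ vres hV v = 0) :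
    ∃ c d : Γ(X, V), b = c • vres hV h + d • vres hV w := by
  have hv := congrArg (vres hV) hU.eq_cross
  rw [vres_cross] at hv
  obtain ⟨c, hc⟩ := hU.prim_v V hV (b ⨯₃ vres hV w) (by
    rw [hv, vec3_dotProduct] at hb
    rw [hv]
    generalize vres hV h = h' at *
    generalize vres hV w = w' at *
    simp [cross_apply] at hb
    ext j
    fin_cases j <;> simp [cross_apply]
    · linear_combination (-w' 0) * hb
    · linear_combination (-w' 1) * hb
    · linear_combination (-w' 2) * hb)
  obtain ⟨d, hd⟩ := hU.model.prim V hV (b - c • vres hV h) (by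
    rw [← cross_anticomm, map_sub, LinearMap.sub_apply, map_smul, LinearMap.smul_apply, hc, hv,
      sub_self, neg_zero])
  exact ⟨c, d, by rw [← hd]; abel⟩

variable [IsIntegral X]

variable {G : Distribution f 2}

/-- Koszul exactness for `w` makes the vector `v` of `σ` a cross product with `w`. Primitivity of
`v` is torsion-freeness of the normal sheaf of `G`: a field parallel to `v` has a nonzero multiple
in the image of `L`, so it lies in that image itself. -/
theorem exists_gmodel [SmoothOfRelativeDimension 3 f] (hF : F.IsGeneric) (hL : IsInvertible L)
    (hG : G.IsInducedBy F σ) (x : X) : ∃ U e w s₀ h v, x ∈ U ∧ GModel σ U e w s₀ h v := by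
  obtain ⟨U', e', w', s₀, hxb, hU, hs₁⟩ : ∃ U e w s₀, x ∈ U ∧ FModel F U e w ∧ IsGen L U s₀ := by
    obtain ⟨U, e, w, hx, hU⟩ := exists_fmodel F hF x
    obtain ⟨U₁, s₁, hx₁, hs₁⟩ := hL.exists_isGen x
    obtain ⟨b, hb, hxb⟩ := exists_basicOpen_le hU.isChart.isAffineOpen hx₁ hx
    exact ⟨_, _, _, _, hxb, hU.basicOpen b ⟨x, hxb⟩, hs₁.res hb⟩
  have hne : (U' : Set X).Nonempty := ⟨x, hxb⟩
  obtain ⟨ε, hε⟩ := hG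
  have hker : ∀ V (h : V ≤ U') (m : Γ(tangentSheaf f, V)), G.π.app V m = 0 →
      ∃ c : Γ(X, V), m = F.φ.app V (σ.app V (c • resM L h s₀)) := by
    intro V h m hm
    obtain ⟨t, rfl⟩ := G.exists_app_eq V hm
    obtain ⟨c, hc⟩ := hs₁.exists_smul h (ε.hom.app V t)
    exact ⟨c, by rw [← hc, hε]; rfl⟩
  have hker' : ∀ V (s : Γ(L, V)), G.π.app V (F.φ.app V (σ.app V s)) = 0 := by
    intro V s
    have : F.φ.app V (σ.app V s) = G.φ.app V (ε.inv.app V s) := by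
      rw [hε]
      have h1 : ε.hom.app V (ε.inv.app V s) = s := by
        rw [← app_comp_apply, ε.inv_hom_id]
        rfl
      exact congrArg (fun z => F.φ.app V (σ.app V z)) h1.symm
    rw [this, G.app_app]
  have hinj : ∀ V (s : Γ(L, V)), σ.app V s = 0 → s = 0 := by
    intro V s hs
    have h1 : G.φ.app V (ε.inv.app V s) = 0 := by
      rw [hε]
      have h1 : ε.hom.app V (ε.inv.app V s) = s := by
        rw [← app_comp_apply, ε.inv_hom_id]
        rfl
      have h2 : F.φ.app V (σ.app V (ε.hom.app V (ε.inv.app V s))) = 0 := by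
        rw [h1, hs, map_zero]
      exact h2
    have h2 := G.app_injective V (h1.trans (map_zero _).symm)
    have h3 := congrArg (ε.hom.app V) h2
    rw [← app_comp_apply, ε.inv_hom_id, map_zero] at h3
    exact h3
  have hd := isDomain_section hne
  have hv0 : hU.coordT le_rfl (σ.app U' s₀) ≠ 0 := by
    intro h0
    have h1 := hinj _ _ (hU.coordT_injective le_rfl (h0.trans (map_zero _).symm))
    have := (hs₁ U' le_rfl).1 (a₁ := 1) (a₂ := 0) (by simp [h1])
    exact one_ne_zero this
  obtain ⟨t, ht⟩ := hU.koszul (hU.coordT le_rfl (σ.app U' s₀)) (by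
    have := hU.dot_coordT le_rfl (σ.app U' s₀)
    rwa [vres_rfl, dotProduct_comm] at this)
  refine ⟨U', e', w', s₀, -t, _, hxb, hU, hs₁, rfl, hv0, fun V h m hm => ?_, ?_⟩
  · by_cases hV : (V : Set X).Nonempty
    · have := isDomain_section hV
      obtain ⟨k, hk⟩ := Function.ne_iff.1 (vres_ne_zero h hV hv0)
      have hv : vres h (hU.coordT le_rfl (σ.app U' s₀)) =
          hU.isChart.isBasisOver.coord h (F.φ.app V (σ.app V (resM L h s₀))) := by
        rw [hU.coordT_res, hU.coordT_apply, resM_app]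
      have h1 : (vres h (hU.coordT le_rfl (σ.app U' s₀)) k) •
          (hU.isChart.isBasisOver.coord h).symm m =
          m k • F.φ.app V (σ.app V (resM L h s₀)) := by
        refine (hU.isChart.isBasisOver.coord h).injective ?_
        rw [map_smul, map_smul, LinearEquiv.apply_symm_apply, ← hv]
        ext j
        simp only [Pi.smul_apply, smul_eq_mul]
        linear_combination cross_smul_eq hm k j
      have h2 := G.π_eq_zero_of_smul hk (m := (hU.isChart.isBasisOver.coord h).symm m) (by
        rw [h1, Scheme.Modules.Hom.app_smul, hker', smul_zero])
      obtain ⟨c, hc⟩ := hker V h _ h2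
      refine ⟨c, ?_⟩
      rw [hv, ← map_smul, ← LinearEquiv.symm_apply_eq, hc]
      simp only [Scheme.Modules.Hom.app_smul]
    · have := subsingleton_section hV
      exact ⟨0, Subsingleton.elim _ _⟩
  · rw [ht, map_neg, LinearMap.neg_apply, cross_anticomm]

end Subfoliation

/-! ### The ideal of values of one-forms on a twisted vector field. -/

section SingularScheme

open Matrix

variable {X : Scheme.{0}} [IsIntegral X] {f : X ⟶ Spec (.of ℂ)} [SmoothOfRelativeDimension 3 f]
  {U V W : X.Opens} {F : Distribution f 1} {L : X.Modules}

/-- The ideal of the zeros of a vector field with values in an invertible sheaf. -/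
def formIdeal (hL : IsInvertible L) (ψ : L ⟶ tangentSheaf f) : X.IdealSheafData where
  ideal U := Ideal.span {a | ∃ (η : Γ(altSheaf (tangentSheaf f) 1, U.1)) (s : Γ(L, U.1)),
    a = alev η le_rfl (ψ.app U.1 s)}
  map_ideal_basicOpen U a := by
    change Ideal.map (resO (X.basicOpen_le a)) _ = _
    rw [Ideal.map_span]
    refine le_antisymm (Ideal.span_mono ?_) (Ideal.span_le.2 ?_)
    · rintro _ ⟨_, ⟨η, s, rfl⟩, rfl⟩
      refine ⟨resM _ (X.basicOpen_le a) η, resM _ (X.basicOpen_le a) s, ?_⟩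
      exact (resO_alev η _ _ _).trans (congrArg _ (resM_app ψ _ s))
    · rintro _ ⟨(η : Γ(altSheaf (tangentSheaf f) 1, X.basicOpen a)), (s : Γ(L, X.basicOpen a)), rfl⟩
      obtain ⟨n, η', hη⟩ := exists_resM_eq (ι := Fin 3) (fun x => by
        obtain ⟨W, e, hx, hW⟩ := exists_isChart f x
        obtain ⟨ε, hε, -⟩ := hW.isBasisOver.exists_dual
        exact ⟨W, ε, hx, hε⟩) U.2 a η
      obtain ⟨k, s', hs⟩ := exists_resM_eq (ι := Unit) (fun x => by
        obtain ⟨W, g, hx, hg⟩ := hL.exists_isGen x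
        exact ⟨W, _, hx, hg.isBasisOver⟩) U.2 a s
      -- Both the form and the section extend after multiplication by powers of `a`, which are units
      -- on the basic open.
      have hu := ((isUnit_resO_basicOpen a).pow n).mul ((isUnit_resO_basicOpen a).pow k)
      have h1 : resO (X.basicOpen_le a) (alev η' le_rfl (ψ.app U.1 s')) =
          resO (X.basicOpen_le a) a ^ n * resO (X.basicOpen_le a) a ^ k *
            alev η le_rfl (ψ.app (X.basicOpen a) s) := by
        have h2 := alev_res η' (X.basicOpen_le a) le_rfl (ψ.app _ (resM L (X.basicOpen_le a) s'))
        rw [resO_alev, resM_app]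
        refine h2.symm.trans ((congrArg₂ (fun x y => alev x le_rfl (ψ.app (X.basicOpen a) y))
          hη hs).trans ?_)
        rw [Scheme.Modules.Hom.app_smul, map_smul, alev_smul, resO_rfl, smul_eq_mul]
        ring
      exact (Ideal.unit_mul_mem_iff_mem _ hu).1 (Ideal.subset_span
        ⟨alev η' le_rfl (ψ.app U.1 s'), ⟨η', s', rfl⟩, h1⟩)

end SingularScheme

/-! ### Saturation of the ideal of a cross product at closed points. -/

section LocalAlgebra

open Matrix

/-- The ideal of coordinates of `h ⨯₃ w` is saturated. -/
theorem mem_span_cross_of_forall {A : Type} [CommRing A] [IsDomain A] {h w : Fin 3 → A}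
    (perp : ∀ b : Fin 3 → A, b ⬝ᵥ (h ⨯₃ w) = 0 → ∃ c d : A, b = c • h + d • w) (hw : w ≠ 0)
    (hv : h ⨯₃ w ≠ 0) (reg : ∀ (p : Ideal A) [p.IsMaximal], ∃ x y z : Localization.AtPrime p,
      RegTriple (Localization.AtPrime p) x y z ∧
        Ideal.ofList [x, y, z] = IsLocalRing.maximalIdeal (Localization.AtPrime p)) {a : A}
    (ha : ∀ q : Ideal A, q.IsPrime → ¬ q.IsMaximal →
      ∃ r ∉ q, r * a ∈ Ideal.span (Set.range (h ⨯₃ w))) :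
    a ∈ Ideal.span (Set.range (h ⨯₃ w)) := by
  set v := h ⨯₃ w with hvdef
  -- `J` is the colon ideal of `a` into the ideal of `v`. If it were proper, it would lie in some
  -- maximal ideal `p`, and it suffices to find an element of `J` outside `p`.
  let J : Ideal A := Submodule.comap (LinearMap.toSpanSingleton A A a) (Ideal.span (Set.range v))
  have hJ : ∀ r, r ∈ J ↔ r * a ∈ Ideal.span (Set.range v) := fun r => Iff.rfl
  by_contra hav
  have hJtop : J ≠ ⊤ := fun hJtop => hav (by
    have := (hJ 1).1 (hJtop ▸ Submodule.mem_top)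
    rwa [one_mul] at this)
  obtain ⟨p, hp, hJp⟩ := J.exists_le_maximal hJtop
  let φ := algebraMap A (Localization.AtPrime p)
  have hφ : Function.Injective φ :=
    IsLocalization.injective _ p.primeCompl_le_nonZeroDivisors
  have hφc : Function.Injective fun v : Fin 3 → A => φ ∘ v := hφ.comp_left
  have : IsDomain (Localization.AtPrime p) :=
    IsLocalization.isDomain_localization p.primeCompl_le_nonZeroDivisors
  have hne : ∀ {u : Fin 3 → A}, u ≠ 0 → φ ∘ u ≠ 0 := fun hu h0 =>
    hu (hφc (h0.trans (funext fun i => (map_zero φ).symm)))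
  have hφv : φ ∘ v = (φ ∘ h) ⨯₃ (φ ∘ w) := by rw [hvdef, comp_cross]
  have hdot : ∀ {r : A}, r ∈ Ideal.span (Set.range v) →
      φ r ∈ Ideal.span (Set.range ((φ ∘ h) ⨯₃ (φ ∘ w))) := by
    intro r hr
    obtain ⟨b, rfl⟩ := mem_span_range_three.1 hr
    exact mem_span_range_three.2 ⟨φ ∘ b, by rw [φ.map_dotProduct, hφv]⟩
  obtain ⟨x, y, z, hreg, hm⟩ := reg p
  let K : Ideal (Localization.AtPrime p) := Submodule.comap (LinearMap.toSpanSingleton _ _ (φ a))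
    (Ideal.span (Set.range ((φ ∘ h) ⨯₃ (φ ∘ w))))
  -- A prime containing the local colon ideal `K` contracts to a maximal ideal by `ha`, hence to
  -- `p`. So powers of `x`, `y`, `z` multiply `a` into the ideal of `v`, and `exists_dotProduct_eq`
  -- applies to these powers.
  have hK : IsLocalRing.maximalIdeal (Localization.AtPrime p) ≤ K.radical := by
    rw [Ideal.radical_eq_sInf]
    refine le_sInf ?_
    rintro Q ⟨hQ, hQp⟩
    have hle : Q.comap φ ≤ p := fun a ha => by
      by_contra hap
      exact hQp.ne_top (Ideal.eq_top_of_isUnit_mem _ ha (isUnit_algebraMap hap))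
    have hmax : (Q.comap φ).IsMaximal := by
      by_contra hmax
      obtain ⟨r, hr, hra⟩ := ha (Q.comap φ) inferInstance hmax
      refine hr (hQ ?_)
      have := hdot hra
      rwa [map_mul] at this
    rw [← Localization.AtPrime.map_eq_maximalIdeal]
    exact (Ideal.map_mono (hmax.eq_of_le hp.ne_top hle).ge).trans Ideal.map_comap_le
  have key : ∀ r ∈ IsLocalRing.maximalIdeal (Localization.AtPrime p),
      ∃ n, ∃ b, r ^ n * φ a = b ⬝ᵥ ((φ ∘ h) ⨯₃ (φ ∘ w)) := by
    intro r hr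
    obtain ⟨n, hn⟩ := hK hr
    exact ⟨n, mem_span_range_three.1 hn⟩
  obtain ⟨n₁, b₁, hb₁⟩ := key x (by rw [← hm]; exact Ideal.subset_span (by simp))
  obtain ⟨n₂, b₂, hb₂⟩ := key y (by rw [← hm]; exact Ideal.subset_span (by simp))
  obtain ⟨n₃, b₃, hb₃⟩ := key z (by rw [← hm]; exact Ideal.subset_span (by simp))
  obtain ⟨b, hb⟩ := exists_dotProduct_eq (hreg.pow n₁ n₂ n₃) (h := φ ∘ h) (w := φ ∘ w)
    (fun b hb => by
      obtain ⟨s, hs, b', hb'⟩ := exists_vec_eq_algebraMap b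
      obtain ⟨c, d, hcd⟩ := perp b' (hφ (by
        rw [map_zero, φ.map_dotProduct, hφv]
        change (algebraMap _ _ ∘ b') ⬝ᵥ _ = 0
        rw [hb', smul_dotProduct, hb, smul_zero]))
      obtain ⟨t, ht⟩ := (isUnit_algebraMap hs).exists_left_inv
      refine ⟨t * φ c, t * φ d, ?_⟩
      have h1 : b = t • (algebraMap A (Localization.AtPrime p) ∘ b') := by
        rw [hb', smul_smul, ht, one_smul]
      rw [h1, hcd]
      ext i
      simp [φ]
      ring)
    (fun c d hcd => by
      have h1 : c • ((φ ∘ h) ⨯₃ (φ ∘ w)) = 0 := by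
        have := congrArg (fun z => z ⨯₃ (φ ∘ w)) hcd
        simpa [cross_self] using this
      obtain rfl := (smul_eq_zero.1 h1).resolve_right (by rw [← hφv]; exact hne hv)
      rw [zero_smul, zero_add] at hcd
      exact ⟨rfl, (smul_eq_zero.1 hcd).resolve_right (hne hw)⟩) hb₁ hb₂ hb₃
  obtain ⟨s, hs, b', hb'⟩ := exists_vec_eq_algebraMap b
  refine hs (hJp ((hJ s).2 (mem_span_range_three.2 ⟨b', hφ ?_⟩)))
  rw [map_mul, hb, φ.map_dotProduct, hφv]
  change _ = (algebraMap _ _ ∘ b') ⬝ᵥ _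
  rw [hb', smul_dotProduct, smul_eq_mul]

end LocalAlgebra

/-! ### Comparison of the singular scheme of `G` with the zero scheme of `σ`. -/

section SingularScheme

theorem sing0_eq_empty {X : Scheme.{0}} {I : X.IdealSheafData} (hI : sing1 I = I) : sing0 I = ∅ := by
  refine Set.eq_empty_of_forall_notMem ?_
  rintro x ⟨U, hx, a, ha, hax⟩
  rw [hI] at ha
  exact hax (Ideal.mem_map_of_mem _ ha)

open Matrix

variable {X : Scheme.{0}} [IsIntegral X] {f : X ⟶ Spec (.of ℂ)}
  {U V W : X.Opens} {F : Distribution f 1} {L : X.Modules} {σ : L ⟶ F.T} {G : Distribution f 2}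

/-- The ideal generated by `v` is saturated at the closed points. -/
theorem GModel.mem_span_of_forall {e : Fin 3 → Γ(tangentSheaf f, U)} {w : Fin 3 → Γ(X, U)}
    {s₀ : Γ(L, U)} {h v : Fin 3 → Γ(X, U)} (hU : GModel σ U e w s₀ h v) {a : Γ(X, U)}
    (ha : ∀ q : Ideal Γ(X, U), q.IsPrime → ¬ q.IsMaximal →
      ∃ r ∉ q, r * a ∈ Ideal.span (Set.range v)) : a ∈ Ideal.span (Set.range v) := by
  have hne : (U : Set X).Nonempty := by
    by_contra hne
    have := subsingleton_section hne
    exact hU.v_ne_zero (Subsingleton.elim _ _)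
  have := isDomain_section hne
  have hvhw := hU.eq_cross
  subst hvhw
  exact mem_span_cross_of_forall (fun b hb => by
    simpa using hU.perp le_rfl (b := b) (by simpa using hb)) hU.model.ne_zero hU.v_ne_zero
    (fun p hp => hU.model.isChart.exists_regTriple p) ha

variable [SmoothOfRelativeDimension 3 f]

/-- The tangent sheaf of `G` is reflexive of rank one, so a section of its determinant is evaluation
at a tangent section. The generators of the singular ideal are thus the values of one-forms on
sections of `L`. -/
theorem sing_eq_formIdeal (hL : IsInvertible L) (hG : G.IsInducedBy F σ) :
    G.sing = formIdeal hL (σ ≫ F.φ) := by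
  obtain ⟨ε, hε⟩ := hG
  have key : (fun U : X.affineOpens => Ideal.span
      {a | ∃ (l : Γ(det G.T (3 - 2), U)) (w : Γ(formSheaf f (3 - 2), U)),
        a = evalLin l (pullForm G.φ (3 - 2) U w)}) = (formIdeal hL (σ ≫ F.φ)).ideal := by
    funext U
    refine congrArg Ideal.span (Set.ext fun a => ⟨?_, ?_⟩)
    · rintro ⟨(l : Γ(dual (altSheaf G.T 1), U.1)), (η : Γ(altSheaf (tangentSheaf f) 1, U.1)), rfl⟩
      obtain ⟨t, ht⟩ := G.reflexive.exists_eval l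
      refine ⟨η, ε.hom.app U.1 t, (ht U.1 le_rfl _).trans ?_⟩
      rw [resM_rfl]
      exact congrArg (fun φ => alev η le_rfl (Scheme.Modules.Hom.app φ U.1 t)) hε
    · rintro ⟨η, s, rfl⟩
      obtain ⟨l, hl⟩ := exists_lev (M := altSheaf G.T 1) (U := U.1)
        (fun V h m => alev m le_rfl (resM _ h (ε.inv.app U.1 s)))
        (fun V h m n => rfl) (fun V h a m => by rw [alev_smul, resO_rfl])
        (fun hW h m => by rw [resO_alev, resM_resM, alev_res])
      refine ⟨l, η, Eq.trans ?_ (hl U.1 le_rfl (pullForm G.φ 1 U.1 η)).symm⟩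
      rw [resM_rfl]
      have h1 : ε.hom.app U.1 (ε.inv.app U.1 s) = s := by
        rw [← app_comp_apply, ε.inv_hom_id]
        rfl
      refine Eq.trans ?_ (congrArg (fun φ => alev η le_rfl
        (Scheme.Modules.Hom.app φ U.1 (ε.inv.app U.1 s))) hε.symm)
      exact congrArg (fun z => alev η le_rfl (F.φ.app U.1 (σ.app U.1 z))) h1.symm
  exact (congrArg Scheme.IdealSheafData.ofIdeals key).trans
    (Scheme.IdealSheafData.ofIdeals_ideal _)

/-- One inclusion restricts one-forms from TX to `F.T`. The other needs only the charts of
`exists_fmodel`, on which every linear form on `F.T` extends to a one-form on TX. -/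
theorem zeroScheme_eq_formIdeal (hF : F.IsGeneric) (hL : IsInvertible L) :
    zeroScheme σ = formIdeal hL (σ ≫ F.φ) := by
  refine le_antisymm ?_ (Scheme.IdealSheafData.le_ofIdeals_iff.2 fun U => Ideal.span_mono ?_)
  · choose U e w hx hU using exists_fmodel F hF
    refine Scheme.IdealSheafData.le_of_iSup_eq_top
      (fun x => ⟨U x, (hU x).isChart.isAffineOpen⟩)
      (top_unique fun x _ => Opens.mem_iSup.2 ⟨x, hx x⟩) fun x => ?_
    refine (Scheme.IdealSheafData.ideal_ofIdeals_le _ _).trans (Ideal.span_mono ?_)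
    rintro _ ⟨l, s, rfl⟩
    obtain ⟨b, hb⟩ := (hU x).exists_lev_eq l
    obtain ⟨η, hη⟩ := (hU x).isChart.isBasisOver.exists_alev_eq b
    exact ⟨η, s, (hb _ le_rfl _).trans (hη _ le_rfl _).symm⟩
  · rintro _ ⟨η, s, rfl⟩
    obtain ⟨l, hl⟩ := exists_lev (M := F.T) (U := U.1)
      (fun V h m => alev η h (F.φ.app V m))
      (fun V h m n => by rw [map_add, map_add])
      (fun V h a m => by rw [Scheme.Modules.Hom.app_smul, map_smul, smul_eq_mul])
      (fun hW h m => by rw [resO_alev, resM_app])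
    exact ⟨l, s, (hl U.1 le_rfl _).symm⟩

theorem GModel.formIdeal_eq {e : Fin 3 → Γ(tangentSheaf f, U)} {w : Fin 3 → Γ(X, U)}
    {s₀ : Γ(L, U)} {h v : Fin 3 → Γ(X, U)} (hU : GModel σ U e w s₀ h v) (hL : IsInvertible L) :
    (formIdeal hL (σ ≫ F.φ)).ideal ⟨U, hU.model.isChart.isAffineOpen⟩ =
      Ideal.span (Set.range v) := by
  refine le_antisymm (Ideal.span_le.2 ?_) fun a ha => ?_
  · rintro _ ⟨η, s, rfl⟩
    obtain ⟨c, rfl⟩ := hU.isGen.exists_smul le_rfl s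
    have h1 := hU.model.isChart.isBasisOver.alev_eq η le_rfl
      (F.φ.app U (σ.app U (c • resM L le_rfl s₀)))
    rw [← hU.model.coordT_apply, hU.coordT_eq', vres_rfl, vres_rfl] at h1
    exact mem_span_range_three.2 ⟨c • _, h1.trans (by rw [dotProduct_smul, smul_dotProduct])⟩
  · obtain ⟨b, rfl⟩ := mem_span_range_three.1 ha
    obtain ⟨η, hη⟩ := hU.model.isChart.isBasisOver.exists_alev_eq b
    refine Ideal.subset_span ⟨η, s₀, Eq.trans ?_ (hη U le_rfl _).symm⟩
    have := hU.coordT_eq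
    rw [hU.model.coordT_apply] at this
    rw [vres_rfl]
    exact congrArg _ this.symm

/-- On a local model the ideal is generated by the coordinates of `v`, whose quotient has positive
depth at closed points. A function lying in it at all non-closed points therefore lies in it. -/
theorem sing1_sing (hF : F.IsGeneric) (hL : IsInvertible L) (hG : G.IsInducedBy F σ) :
    sing1 G.sing = G.sing := by
  refine le_antisymm ?_ (Scheme.IdealSheafData.le_ofIdeals_iff.2 fun U => ?_)
  · choose U e w s₀ h v hx hU using exists_gmodel hF hL hG
    refine Scheme.IdealSheafData.le_of_iSup_eq_top
      (fun x => ⟨U x, (hU x).model.isChart.isAffineOpen⟩)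
      (top_unique fun x _ => Opens.mem_iSup.2 ⟨x, hx x⟩) fun x => ?_
    refine (Scheme.IdealSheafData.ideal_ofIdeals_le _ _).trans fun a ha => ?_
    have hA := (hU x).model.isChart.isAffineOpen
    rw [sing_eq_formIdeal hL hG, (hU x).formIdeal_eq]
    refine (hU x).mem_span_of_forall fun q hq hqm => ?_
    obtain ⟨y, hy, hyq⟩ := exists_point hA q
    obtain ⟨p, hp, hqp⟩ := q.exists_le_maximal hq.ne_top
    obtain ⟨z, hz, hzp⟩ := exists_point hA p
    have hyz := specializes_of_prime_le hA hqp hz hyq hzp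
    -- A non-maximal prime of the chart gives a point with a proper specialization inside the chart,
    -- so the point is not closed in X.
    have hcl : ¬ IsClosed ({y} : Set X) := by
      intro hcl
      have : z = y := hyz.mem_closed hcl rfl
      subst this
      have : q = p := by
        ext s
        rw [← not_iff_not, ← hyq, ← hzp]
      exact hqm (this ▸ hp)
    rw [Ideal.mem_iInf] at ha
    have h1 := ha y
    rw [Ideal.mem_iInf] at h1
    have h2 := h1 hy
    rw [Ideal.mem_iInf] at h2
    have h3 := (germ_mem_map_iff hA hy _ a).1 (h2 hcl)
    rw [sing_eq_formIdeal hL hG, (hU x).formIdeal_eq] at h3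
    obtain ⟨r, hr, hra⟩ := h3
    exact ⟨r, (hyq r).1 hr, hra⟩
  · exact le_iInf fun x => le_iInf fun hx => le_iInf fun _ => Ideal.le_comap_map

end SingularScheme

/-! ### Finite presentations from generators and relations on sections. -/

section Coherence

open SheafOfModules

variable {X : Scheme.{0}} {U V W : X.Opens}

/-- The structure sheaf. -/
abbrev unitSheaf (X : Scheme.{0}) : X.Modules := SheafOfModules.unit X.ringCatSheaf

/-- The morphism `𝒪_X → M` defined by a global section. -/
def unitHom {M : X.Modules} (s : Γ(M, ⊤)) : unitSheaf X ⟶ M :=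
  homOfApp (fun V (a : Γ(X, V)) => a • resM M le_top s)
    (fun V (a b : Γ(X, V)) => add_smul a b (resM M le_top s))
    (fun V a (b : Γ(X, V)) => mul_smul a b (resM M le_top s)) (fun h a => by
      refine (resM_smul M h _ _).trans ?_
      rw [resM_resM]
      rfl)

/-- The free sheaf of rank `n`. -/
abbrev freeSheaf (X : Scheme.{0}) (n : ℕ) : X.Modules :=
  SheafOfModules.free (R := X.ringCatSheaf) (Fin n)

/-- The morphism `𝒪_X^n → M` defined by global sections. -/
def freeHom {M : X.Modules} {n : ℕ} (s : Fin n → Γ(M, ⊤)) : freeSheaf X n ⟶ M :=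
  Limits.Cofan.IsColimit.desc (isColimitFreeCofan (R := X.ringCatSheaf) (Fin n))
    (fun i => unitHom (s i))

/-- The inclusion of a summand of the free sheaf. -/
def freeInc (X : Scheme.{0}) {n : ℕ} (i : Fin n) : unitSheaf X ⟶ freeSheaf X n :=
  ιFree (R := X.ringCatSheaf) i

theorem freeInc_freeHom {M : X.Modules} {n : ℕ} (s : Fin n → Γ(M, ⊤)) (i : Fin n) :
    freeInc X i ≫ freeHom s = unitHom (s i) :=
  Limits.Cofan.IsColimit.fac (isColimitFreeCofan (R := X.ringCatSheaf) (Fin n)) _ i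

theorem free_hom_ext {M : X.Modules} {n : ℕ} {φ ψ : freeSheaf X n ⟶ M}
    (h : ∀ i, freeInc X i ≫ φ = freeInc X i ≫ ψ) : φ = ψ :=
  Limits.Cofan.IsColimit.hom_ext (isColimitFreeCofan (R := X.ringCatSheaf) (Fin n)) _ _ h

/-- The sections of the free sheaf with given coordinates. -/
def freeSec {n : ℕ} (c : Fin n → Γ(X, V)) : Γ(freeSheaf X n, V) :=
  ∑ i, (freeInc X i).app V (c i)

theorem freeHom_freeSec {M : X.Modules} {n : ℕ} (s : Fin n → Γ(M, ⊤)) (c : Fin n → Γ(X, V)) :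
    (freeHom s).app V (freeSec c) = ∑ i, c i • resM M le_top (s i) := by
  rw [freeSec, map_sum]
  refine Finset.sum_congr rfl fun i _ => ?_
  refine (app_comp_apply (freeInc X i) (freeHom s) V (c i)).symm.trans ?_
  rw [freeInc_freeHom]
  rfl

theorem exists_freeSec {n : ℕ} (m : Γ(freeSheaf X n, V)) : ∃ c, m = freeSec c := by
  classical
  let p : Fin n → (freeSheaf X n ⟶ unitSheaf X) := fun i =>
    Limits.Cofan.IsColimit.desc (isColimitFreeCofan (R := X.ringCatSheaf) (Fin n))
      (fun j => if j = i then 𝟙 (unitSheaf X) else 0)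
  have hp : ∀ i j, freeInc X j ≫ p i = if j = i then 𝟙 (unitSheaf X) else 0 := fun i j =>
    Limits.Cofan.IsColimit.fac (isColimitFreeCofan (R := X.ringCatSheaf) (Fin n)) _ j
  have h1 : ∑ i, p i ≫ freeInc X i = 𝟙 _ := by
    refine free_hom_ext fun j => ?_
    rw [Preadditive.comp_sum, Finset.sum_eq_single j]
    · rw [← Category.assoc, hp, if_pos rfl]
      simp
    · intro i _ hij
      rw [← Category.assoc, hp, if_neg (Ne.symm hij), Limits.zero_comp]
    · simp
  refine ⟨fun i => (p i).app V m, ?_⟩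
  have h2 : (∑ i, p i ≫ freeInc X i : freeSheaf X n ⟶ freeSheaf X n).app V m = m := by
    rw [h1]
    rfl
  have : ∀ (t : Finset (Fin n)), (∑ i ∈ t, p i ≫ freeInc X i : freeSheaf X n ⟶ freeSheaf X n).app V m
      = ∑ i ∈ t, (p i ≫ freeInc X i).app V m := by
    intro t
    induction t using Finset.induction_on with
    | empty => rfl
    | insert a t ha ih => rw [Finset.sum_insert ha, Finset.sum_insert ha, ← ih]; rfl
  exact h2.symm.trans (this _)

/-- A criterion for epimorphisms. -/
theorem epi_of_local {M N : X.Modules} (φ : M ⟶ N)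
    (h : ∀ (V : X.Opens) (n : Γ(N, V)), ∀ x ∈ V, ∃ (W : X.Opens) (hW : W ≤ V), x ∈ W ∧
      ∃ m : Γ(M, W), φ.app W m = resM N hW n) : Epi φ := by
  refine ⟨fun {K} a b hab => modules_hom_ext fun V n => resM_ext fun x hx => ?_⟩
  obtain ⟨W, hW, hxW, m, hm⟩ := h V n x hx
  refine ⟨W, hW, hxW, ?_⟩
  rw [resM_app, resM_app, ← hm, ← app_comp_apply, ← app_comp_apply, hab]

/-- The sections `s i` generate `M` over `U`. -/
def Generates (M : X.Modules) (U : X.Opens) {n : ℕ} (s : Fin n → Γ(M, U)) : Prop :=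
  ∀ (V : X.Opens) (h : V ≤ U) (m : Γ(M, V)), ∀ x ∈ V, ∃ (W : X.Opens) (hW : W ≤ V), x ∈ W ∧
    ∃ c : Fin n → Γ(X, W), resM M hW m = ∑ i, c i • resM M (hW.trans h) (s i)

/-- The vectors `r j` generate the relations between the sections `s i` over `U`. -/
def GeneratesRelations (M : X.Modules) (U : X.Opens) {n k : ℕ} (s : Fin n → Γ(M, U))
    (r : Fin k → Fin n → Γ(X, U)) : Prop :=
  (∀ j, ∑ i, r j i • s i = 0) ∧
  ∀ (V : X.Opens) (h : V ≤ U) (c : Fin n → Γ(X, V)), ∑ i, c i • resM M h (s i) = 0 →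
    ∀ x ∈ V, ∃ (W : X.Opens) (hW : W ≤ V), x ∈ W ∧
      ∃ d : Fin k → Γ(X, W), ∀ i, resO hW (c i) = ∑ j, d j * resO (hW.trans h) (r j i)

/-- Generating sections from a generating family. -/
def generatingSections {M : X.Modules} {n : ℕ} {s : Fin n → Γ(M, ⊤)} (hs : Generates M ⊤ s) :
    SheafOfModules.GeneratingSections (R := X.ringCatSheaf) M where
  I := Fin n
  s := SheafOfModules.freeHomEquiv (R := X.ringCatSheaf) M (freeHom s)
  epi := by
    have e : (SheafOfModules.freeHomEquiv (R := X.ringCatSheaf) M).symm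
        (SheafOfModules.freeHomEquiv (R := X.ringCatSheaf) M (freeHom s)) = freeHom s :=
      Equiv.symm_apply_apply _ _
    refine (congrArg (fun φ : freeSheaf X n ⟶ M => Epi φ) e).mpr ?_
    refine epi_of_local (freeHom s) fun V m x hx => ?_
    obtain ⟨W, hW, hxW, c, hc⟩ := hs V le_top m x hx
    exact ⟨W, hW, hxW, freeSec c, (freeHom_freeSec s c).trans hc.symm⟩

theorem generatingSections_π {M : X.Modules} {n : ℕ} {s : Fin n → Γ(M, ⊤)}
    (hs : Generates M ⊤ s) : (generatingSections hs).π = freeHom s :=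
  Equiv.symm_apply_apply _ _

/-- The columns of `r` lift to the kernel of the map from the free sheaf, since a kernel is computed
on sections. They generate it because every local relation between the `s i` is locally a
combination of them. -/
theorem exists_presentation {M : X.Modules} {n k : ℕ} {s : Fin n → Γ(M, ⊤)}
    {r : Fin k → Fin n → Γ(X, ⊤)} (hs : Generates M ⊤ s) (hr : GeneratesRelations M ⊤ s r) :
    ∃ P : SheafOfModules.Presentation (R := X.ringCatSheaf) M, P.IsFinite := by
  let p : freeSheaf X n ⟶ M := (generatingSections hs).π
  have hp : p = freeHom s := generatingSections_π hs
  let K : X.Modules := Limits.kernel p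
  let ι : K ⟶ freeSheaf X n := Limits.kernel.ι p
  have hex : (ShortComplex.mk ι p (Limits.kernel.condition p)).Exact :=
    ShortComplex.exact_kernel p
  have hp' : ∀ (V : X.Opens) (c : Fin n → Γ(X, V)),
      p.app V (freeSec c) = ∑ i, c i • resM M le_top (s i) := by
    intro V c
    rw [hp, freeHom_freeSec]
  have h1 : ∀ j, ∃ q : Γ(K, ⊤), ι.app ⊤ q = freeSec (r j) := by
    intro j
    refine exists_app_eq hex ⊤ ?_
    refine (hp' _ _).trans ?_
    simpa using hr.1 j
  choose q hq using h1
  have hres : ∀ {W V : X.Opens} (hW : W ≤ V) (c : Fin n → Γ(X, V)),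
      resM (freeSheaf X n) hW (freeSec c) = freeSec fun i => resO hW (c i) := by
    intro W V hW c
    rw [freeSec, map_sum]
    exact Finset.sum_congr rfl fun i _ => resM_app (freeInc X i) hW _
  have hsmul : ∀ {W : X.Opens} (a : Γ(X, W)) (c : Fin n → Γ(X, W)),
      a • (freeSec c) = freeSec fun i => a * c i := by
    intro W a c
    rw [freeSec, Finset.smul_sum]
    exact Finset.sum_congr rfl fun i _ => (Scheme.Modules.Hom.app_smul (freeInc X i) a _).symm
  have hsum : ∀ {W : X.Opens} (c : Fin k → Fin n → Γ(X, W)),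
      ∑ j, freeSec (c j) = freeSec fun i => ∑ j, c j i := by
    intro W c
    simp only [freeSec]
    rw [Finset.sum_comm]
    exact Finset.sum_congr rfl fun i _ => (map_sum _ _ _).symm
  have hgen : Generates K ⊤ q := by
    intro V h m x hx
    obtain ⟨c, hc⟩ := exists_freeSec (ι.app V m)
    have h0 : ∑ i, c i • resM M h (s i) = 0 := by
      rw [← hp', ← hc, ← app_comp_apply, Limits.kernel.condition]
      rfl
    obtain ⟨W, hW, hxW, d, hd⟩ := hr.2 V h c h0 x hx
    refine ⟨W, hW, hxW, d, app_injective ι W ?_⟩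
    rw [← resM_app, hc, hres, map_sum]
    have : ∀ j, ι.app W (d j • resM K (hW.trans h) (q j)) =
        freeSec fun i => d j * resO (hW.trans h) (r j i) := by
      intro j
      rw [Scheme.Modules.Hom.app_smul, ← resM_app, hq, hres, hsmul]
    simp only [this, hsum]
    exact congrArg freeSec (funext hd)
  refine ⟨⟨generatingSections hs, generatingSections hgen⟩, ⟨⟨?_⟩, ⟨?_⟩⟩⟩
  · exact inferInstanceAs (Finite (Fin n))
  · exact inferInstanceAs (Finite (Fin k))

end Coherence

/-! ### From local presentations to coherence. -/

section Coherence

variable {X : Scheme.{0}} {U V W : X.Opens}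

theorem restrict_smul (M : X.Modules) (V : U.toScheme.Opens) (a : Γ(U.toScheme, V))
    (m : Γ(M.restrict U.ι, V)) :
    a • m = (show Γ(M, U.ι ''ᵁ V) from (show Γ(X, U.ι ''ᵁ V) from a) • (show Γ(M, U.ι ''ᵁ V) from m)) := by
  have h := Scheme.Modules.smul_restrictAppIso_hom_apply U.ι M V a m
  rw [Scheme.Opens.ι_appIso] at h
  exact h

theorem exists_presentation_restrict {M : X.Modules} {n k : ℕ} {s : Fin n → Γ(M, U)}
    {r : Fin k → Fin n → Γ(X, U)} (hs : Generates M U s) (hr : GeneratesRelations M U s r) :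
    ∃ P : SheafOfModules.Presentation (R := U.toScheme.ringCatSheaf) (M.restrict U.ι), P.IsFinite := by
  have hle : ∀ V : U.toScheme.Opens, U.ι ''ᵁ V ≤ U := fun V => by
    rintro _ ⟨y, -, rfl⟩
    exact y.2
  let s' : Fin n → Γ(M.restrict U.ι, ⊤) := fun i =>
    show Γ(M, U.ι ''ᵁ ⊤) from resM M (hle ⊤) (s i)
  let r' : Fin k → Fin n → Γ(U.toScheme, ⊤) := fun j i =>
    show Γ(X, U.ι ''ᵁ ⊤) from resO (hle ⊤) (r j i)
  have hs' : ∀ (V : U.toScheme.Opens) i, resM (M.restrict U.ι) (le_top : V ≤ ⊤) (s' i) =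
      (show Γ(M, U.ι ''ᵁ V) from resM M (hle V) (s i)) := fun V i =>
    resM_resM M (U.ι.image_mono le_top) (hle ⊤) (s i)
  have hr' : ∀ (V : U.toScheme.Opens) j i, resO (le_top : V ≤ ⊤) (r' j i) =
      (show Γ(X, U.ι ''ᵁ V) from resO (hle V) (r j i)) := fun V j i =>
    resO_resO (U.ι.image_mono le_top) (hle ⊤) (r j i)
  have hsum : ∀ (V : U.toScheme.Opens) (c : Fin n → Γ(U.toScheme, V)),
      ∑ i, c i • resM (M.restrict U.ι) (le_top : V ≤ ⊤) (s' i) =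
      (show Γ(M, U.ι ''ᵁ V) from ∑ i, (show Γ(X, U.ι ''ᵁ V) from c i) • resM M (hle V) (s i)) := by
    intro V c
    refine Finset.sum_congr rfl fun i _ => ?_
    rw [hs']
    exact restrict_smul M V _ _
  have key : ∀ (V : U.toScheme.Opens) (y : U.toScheme) (hy : y ∈ V) (W : X.Opens)
      (hW : W ≤ U.ι ''ᵁ V) (hxW : U.ι y ∈ W), ∃ W' : U.toScheme.Opens, ∃ hW' : W' ≤ V, y ∈ W' ∧
        U.ι ''ᵁ W' ≤ W := by
    intro V y hy W hW hxW
    refine ⟨V ⊓ U.ι ⁻¹ᵁ W, inf_le_left, ⟨hy, hxW⟩, ?_⟩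
    rintro _ ⟨z, hz, rfl⟩
    exact hz.2
  refine exists_presentation (s := s') (r := r') ?_ ⟨?_, ?_⟩
  · intro V h m y hy
    obtain ⟨W, hW, hxW, c, hc⟩ := hs (U.ι ''ᵁ V) (hle V) m (U.ι y) ⟨y, hy, rfl⟩
    obtain ⟨W', hW', hyW', hle'⟩ := key V y hy W hW hxW
    refine ⟨W', hW', hyW', fun i => show Γ(X, U.ι ''ᵁ W') from resO hle' (c i), ?_⟩
    have h2 : resM M hle' (∑ i, c i • resM M (hW.trans (hle V)) (s i)) =
        ∑ i, resO hle' (c i) • resM M (hle W') (s i) := by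
      rw [sum_smul_resM]
      simp only [resM_resM]
    refine (resM_resM M hle' hW (show Γ(M, U.ι ''ᵁ V) from m)).symm.trans
      ((congrArg (resM M hle') hc).trans (h2.trans ?_))
    exact (hsum W' fun i => show Γ(X, U.ι ''ᵁ W') from resO hle' (c i)).symm
  · intro j
    have := hsum ⊤ (r' j)
    simp only [resM_rfl] at this
    rw [this]
    have h2 := congrArg (resM M (hle ⊤)) (hr.1 j)
    rw [sum_smul_resM, map_zero] at h2
    exact h2
  · intro V h c hc y hy
    rw [hsum] at hc
    obtain ⟨W, hW, hxW, d, hd⟩ := hr.2 (U.ι ''ᵁ V) (hle V) c hc (U.ι y) ⟨y, hy, rfl⟩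
    obtain ⟨W', hW', hyW', hle'⟩ := key V y hy W hW hxW
    refine ⟨W', hW', hyW', fun i => show Γ(X, U.ι ''ᵁ W') from resO hle' (d i), fun i => ?_⟩
    refine (resO_resO hle' hW (show Γ(X, U.ι ''ᵁ V) from c i)).symm.trans
      ((congrArg (resO hle') (hd i)).trans ?_)
    rw [map_sum]
    refine Finset.sum_congr rfl fun j _ => ?_
    rw [map_mul, resO_resO, hr']
    rfl

/-- Sheaves of modules on the open subscheme are equivalent to those on the site over `U`. The
equivalence preserves colimits and the unit, so it carries finite presentations to finite
presentations. -/
theorem exists_presentation_over {M : X.Modules}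
    (P : SheafOfModules.Presentation (R := U.toScheme.ringCatSheaf) (M.restrict U.ι))
    [hP : P.IsFinite] :
    ∃ Q : SheafOfModules.Presentation (SheafOfModules.over (R := X.ringCatSheaf) M U), Q.IsFinite := by
  let F : SheafOfModules.{0} U.toScheme.ringCatSheaf ⥤ SheafOfModules.{0} (X.ringCatSheaf.over U) :=
    (Scheme.Modules.overEquiv U).inverse
  have hF : Limits.PreservesColimitsOfSize.{0, 0} F :=
    inferInstanceAs (Limits.PreservesColimitsOfSize.{0, 0} (Scheme.Modules.overEquiv U).inverse)
  have h1 : SheafOfModules.unit (X.ringCatSheaf.over U) ≅ F.obj (unitSheaf U.toScheme) :=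
    (Scheme.Modules.overEquiv U).unitIso.app _ ≪≫ F.mapIso
      ((Scheme.Modules.overFunctorEquiv U).app (unitSheaf X) ≪≫ Scheme.Modules.restrictUnitIso U.ι)
  have h2 : F.obj (M.restrict U.ι) ≅ SheafOfModules.over (R := X.ringCatSheaf) M U :=
    F.mapIso ((Scheme.Modules.overFunctorEquiv U).app M).symm ≪≫
      ((Scheme.Modules.overEquiv U).unitIso.app _).symm
  refine ⟨(P.map F h1).ofIsIso h2.hom, ?_⟩
  have : (P.map F h1).IsFinite := by
    exact ⟨⟨hP.isFiniteType_generators.finite⟩, ⟨hP.isFiniteType_relations.finite⟩⟩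
  infer_instance

theorem isCoherent_of_local {M : X.Modules}
    (h : ∀ x : X, ∃ U : X.Opens, x ∈ U ∧ ∃ (n k : ℕ) (s : Fin n → Γ(M, U))
      (r : Fin k → Fin n → Γ(X, U)), Generates M U s ∧ GeneratesRelations M U s r) :
    IsCoherent M := by
  choose U hxU n k s r hs hr using h
  choose P hP using fun x => exists_presentation_restrict (hs x) (hr x)
  choose Q hQ using fun x =>
    have := hP x
    exists_presentation_over (P x)
  refine ⟨⟨X, U, ?_, Q⟩, ⟨hQ⟩⟩
  rw [Opens.coversTop_iff, IsOpenCover, eq_top_iff]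
  exact fun x _ => Opens.mem_iSup.2 ⟨x, hxU x⟩

end Coherence

/-! ### Finite generation of solutions of linear systems over Noetherian charts. -/

section Syzygies

variable {X : Scheme.{0}} [IsIntegral X] {U V W : X.Opens}

theorem exists_finite_solutions {A : Type} [CommRing A] [IsNoetherianRing A] {n p : ℕ}
    (a : Fin p → Fin n → A) : ∃ (k : ℕ) (r : Fin k → Fin n → A),
      (∀ j q, ∑ i, a q i * r j i = 0) ∧
      ∀ c : Fin n → A, (∀ q, ∑ i, a q i * c i = 0) → ∃ d : Fin k → A, ∀ i, c i = ∑ j, d j * r j i := by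
  let N : Submodule A (Fin n → A) := LinearMap.ker (Matrix.mulVecLin (Matrix.of a))
  have hN : ∀ c, c ∈ N ↔ ∀ q, ∑ i, a q i * c i = 0 := fun c =>
    LinearMap.mem_ker.trans funext_iff
  obtain ⟨k, r, hr⟩ := Submodule.fg_iff_exists_fin_generating_family.1 (IsNoetherian.noetherian N)
  refine ⟨k, r, fun j => (hN _).1 (hr ▸ Submodule.subset_span ⟨j, rfl⟩), fun c hc => ?_⟩
  have h1 := (hN c).2 hc
  rw [← hr, Submodule.mem_span_range_iff_exists_fun] at h1
  obtain ⟨d, hd⟩ := h1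
  refine ⟨d, fun i => ?_⟩
  rw [← hd, Finset.sum_apply]
  rfl

/-- Systems of linear equations over a Noetherian affine open have a finite family of solutions
which generate the solutions over all smaller opens. -/
theorem exists_syzygies (hU : IsAffineOpen U) [IsNoetherianRing Γ(X, U)] {n p : ℕ}
    (a : Fin p → Fin n → Γ(X, U)) : ∃ (k : ℕ) (r : Fin k → Fin n → Γ(X, U)),
      (∀ j q, ∑ i, a q i * r j i = 0) ∧
      ∀ (V : X.Opens) (h : V ≤ U) (c : Fin n → Γ(X, V)), (∀ q, ∑ i, resO h (a q i) * c i = 0) →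
        ∀ x ∈ V, ∃ (W : X.Opens) (hW : W ≤ V), x ∈ W ∧
          ∃ d : Fin k → Γ(X, W), ∀ i, resO hW (c i) = ∑ j, d j * resO (hW.trans h) (r j i) := by
  obtain ⟨k, r, hr, hr'⟩ := exists_finite_solutions a
  refine ⟨k, r, hr, fun V h c hc x hx => ?_⟩
  obtain ⟨b, hb, hxb⟩ := exists_basicOpen_le hU hx (h hx)
  have hne : (X.basicOpen b : Set X).Nonempty := ⟨x, hxb⟩
  choose m c' hc' using fun i => exists_resO_eq hU b (resO hb (c i))
  let N := ∑ i, m i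
  have hN : ∀ i, N = (N - m i) + m i := fun i =>
    (Nat.sub_add_cancel (Finset.single_le_sum (fun _ _ => Nat.zero_le _) (Finset.mem_univ i))).symm
  -- A common power of `b` moves the local solution to `U`, where it still solves the system because
  -- restriction is injective. The power is inverted again at the end.
  let c'' : Fin n → Γ(X, U) := fun i => b ^ (N - m i) * c' i
  have hc'' : ∀ i, resO (X.basicOpen_le b) (c'' i) = resO (X.basicOpen_le b) b ^ N * resO hb (c i) := by
    intro i
    rw [map_mul, map_pow, hc', ← mul_assoc, ← pow_add, ← hN]
  obtain ⟨d, hd⟩ := hr' c'' (fun q => resO_injective (X.basicOpen_le b) hne (by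
    rw [map_sum, map_zero]
    have h1 := congrArg (fun z => resO (X.basicOpen_le b) b ^ N * resO hb z) (hc q)
    simp only [map_sum, map_mul, resO_resO, map_zero, mul_zero] at h1
    rw [Finset.mul_sum] at h1
    rw [← h1]
    refine Finset.sum_congr rfl fun i _ => ?_
    rw [map_mul, hc'']
    ring))
  obtain ⟨u, hu⟩ := ((isUnit_resO_basicOpen b).pow N).exists_left_inv
  refine ⟨_, hb, hxb, fun j => u * resO (X.basicOpen_le b) (d j), fun i => ?_⟩
  have h1 := congrArg (fun z => u * resO (X.basicOpen_le b) z) (hd i)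
  rw [hc'', ← mul_assoc, hu, one_mul, map_sum, Finset.mul_sum] at h1
  rw [h1]
  refine Finset.sum_congr rfl fun j _ => ?_
  rw [map_mul, mul_assoc]

end Syzygies

/-! ### Descent of one-forms along epimorphisms. -/

section Descent

variable {X : Scheme.{0}} {U V W : X.Opens} {M N : X.Modules}

theorem alev_ext_of_epi (φ : M ⟶ N) [Epi φ] {a b : Γ(altSheaf N 1, U)}
    (H : ∀ V (h : V ≤ U) m, alev a h (φ.app V m) = alev b h (φ.app V m)) : a = b := by
  refine alev_ext fun V h n => resO_ext fun x hx => ?_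
  obtain ⟨W, hW, hxW, m, hm⟩ := exists_app_eq_of_epi φ n x hx
  exact ⟨W, hW, hxW, by rw [resO_alev, resO_alev, ← hm, H]⟩

/-- One-forms descend along epimorphisms. -/
theorem exists_alev_descend (φ : M ⟶ N) [Epi φ] (l : Γ(altSheaf M 1, U))
    (hl : ∀ V (h : V ≤ U) m, φ.app V m = 0 → alev l h m = 0) :
    ∃ l' : Γ(altSheaf N 1, U), ∀ V (h : V ≤ U) m, alev l' h (φ.app V m) = alev l h m := by
  have hl' : ∀ V (h : V ≤ U) m m', φ.app V m = φ.app V m' → alev l h m = alev l h m' := by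
    intro V h m m' hm
    rw [← sub_eq_zero, ← map_sub]
    exact hl V h _ (by rw [map_sub, hm, sub_self])
  -- The value on `n` is `l` applied to any local lift of `n`. It does not depend on the lift since
  -- `l` kills the kernel of `φ`, so these values glue.
  have key : ∀ V (h : V ≤ U) (n : Γ(N, V)), ∃ a : Γ(X, V), ∀ W (hW : W ≤ V) (m : Γ(M, W)),
      φ.app W m = resM N hW n → resO hW a = alev l (hW.trans h) m := by
    intro V h n
    obtain ⟨a, ha⟩ := exists_section_of_local (V := V)
      (fun W hW a => ∃ m : Γ(M, W), φ.app W m = resM N hW n ∧ a = alev l (hW.trans h) m)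
      (by
        rintro W W' hW hW' _ ⟨m, hm, rfl⟩
        exact ⟨resM M hW' m, by rw [← resM_app, hm, resM_resM], resO_alev _ _ _ _⟩)
      (by
        rintro W hW _ _ ⟨m, hm, rfl⟩ ⟨m', hm', rfl⟩
        exact hl' _ _ _ _ (hm.trans hm'.symm))
      (fun x hx => by
        obtain ⟨W, hW, hxW, m, hm⟩ := exists_app_eq_of_epi φ n x hx
        exact ⟨W, hW, hxW, _, m, hm, rfl⟩)
    exact ⟨a, fun W hW m hm => ha W hW _ ⟨m, hm, rfl⟩⟩
  choose g hg using key
  obtain ⟨l', hl'⟩ := exists_alev (M := N) (U := U) (fun V h =>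
    { toFun := g V h
      map_add' := fun n n' => resO_ext fun x hx => by
        obtain ⟨W, hW, hxW, m, hm⟩ := exists_app_eq_of_epi φ n x hx
        obtain ⟨W', hW', hxW', m', hm'⟩ := exists_app_eq_of_epi φ (resM N hW n') x hxW
        have h1 : φ.app W' (resM M hW' m) = resM N (hW'.trans hW) n := by
          rw [← resM_app, hm, resM_resM]
        rw [resM_resM] at hm'
        refine ⟨W', hW'.trans hW, hxW', ?_⟩
        rw [hg V h (n + n') W' (hW'.trans hW) (resM M hW' m + m') (by
          rw [map_add, map_add, h1, hm']), map_add, map_add, hg V h n _ _ _ h1, hg V h n' _ _ _ hm']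
      map_smul' := fun a n => resO_ext fun x hx => by
        obtain ⟨W, hW, hxW, m, hm⟩ := exists_app_eq_of_epi φ n x hx
        refine ⟨W, hW, hxW, ?_⟩
        rw [hg V h (a • n) W hW (resO hW a • m) (by
          rw [Scheme.Modules.Hom.app_smul, hm, resM_smul]), map_smul, RingHom.id_apply,
          smul_eq_mul, smul_eq_mul, map_mul, hg V h n _ _ _ hm] })
    (fun {W V} hW h n => resO_ext fun x hx => by
      obtain ⟨W', hW', hxW', m, hm⟩ := exists_app_eq_of_epi φ (resM N hW n) x hx
      refine ⟨W', hW', hxW', ?_⟩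
      change resO hW' (resO hW (g V h n)) = resO hW' (g W _ (resM N hW n))
      rw [resO_resO, hg W _ (resM N hW n) _ _ _ hm, hg V h n W' (hW'.trans hW) m (by
        rw [hm, resM_resM])])
  refine ⟨l', fun V h m => ?_⟩
  rw [hl']
  have := hg V h (φ.app V m) V le_rfl m (resM_rfl _ _ _).symm
  rwa [resO_rfl] at this

end Descent

/-! ### The dual of the cokernel of `σ` is invertible, generated by `h`. -/

section ConormalGenerator

open Matrix

variable {X : Scheme.{0}} {f : X ⟶ Spec (.of ℂ)} {U V W : X.Opens}
  {e : Fin 3 → Γ(tangentSheaf f, U)} {F : Distribution f 1} {L : X.Modules} {σ : L ⟶ F.T}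
  {w : Fin 3 → Γ(X, U)} {s₀ : Γ(L, U)} {h v : Fin 3 → Γ(X, U)}

theorem FModel.coordT_basicOpen [IsIntegral X] (hU : FModel F U e w) (b : Γ(X, U))
    (hb : (X.basicOpen b : Set X).Nonempty) (hV : V ≤ X.basicOpen b) (t : Γ(F.T, V)) :
    (hU.basicOpen b hb).coordT hV t = hU.coordT (hV.trans (X.basicOpen_le b)) t := by
  rw [FModel.coordT_apply, FModel.coordT_apply, hU.isChart.isBasisOver.coord_frame_res]

theorem cokernel_π_app (V : X.Opens) (s : Γ(L, V)) :
    (Limits.cokernel.π σ).app V (σ.app V s) = 0 := by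
  rw [← app_comp_apply, Limits.cokernel.condition]
  rfl

theorem exists_of_cokernel_π_app_eq_zero [Mono σ] {t : Γ(F.T, V)}
    (ht : (Limits.cokernel.π σ).app V t = 0) : ∃ s, σ.app V s = t :=
  exists_app_eq (ShortComplex.exact_cokernel σ) V ht

/-- The forms on the cokernel of `σ` are generated by the restriction of `h`. -/
theorem GModel.exists_isGen_alt [IsIntegral X] [Mono σ] (hU : GModel σ U e w s₀ h v) :
    ∃ j : Γ(altSheaf (Limits.cokernel σ) 1, U), IsGen (altSheaf (Limits.cokernel σ) 1) U j ∧
      ∀ V (hV : V ≤ U) t, alev j hV ((Limits.cokernel.π σ).app V t) =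
        vres hV h ⬝ᵥ hU.model.coordT hV t := by
  obtain ⟨l, hl⟩ := exists_alev (M := F.T) (U := U)
    (fun V hV => (dotProductBilin Γ(X, V) Γ(X, V) (vres hV h)).comp (hU.model.coordT hV))
    (fun {W V} hW hV m => by
      change resO hW (vres hV h ⬝ᵥ hU.model.coordT hV m) = vres _ h ⬝ᵥ hU.model.coordT _ _
      rw [resO_dot, vres_vres, hU.model.coordT_res])
  -- The form `h` vanishes on the image of `σ` because `h` is orthogonal to `v = h ⨯₃ w`, so it
  -- descends to the cokernel.
  obtain ⟨j, hj⟩ := exists_alev_descend (Limits.cokernel.π σ) l (fun V hV t ht => by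
    obtain ⟨s, rfl⟩ := exists_of_cokernel_π_app_eq_zero ht
    obtain ⟨c, rfl⟩ := hU.isGen.exists_smul hV s
    rw [hl]
    change vres hV h ⬝ᵥ hU.model.coordT hV _ = 0
    rw [hU.coordT_eq', hU.eq_cross, vres_cross, dotProduct_smul, dot_self_cross, smul_zero])
  have hj' : ∀ V (hV : V ≤ U) t, alev j hV ((Limits.cokernel.π σ).app V t) =
        vres hV h ⬝ᵥ hU.model.coordT hV t := fun V hV t => (hj V hV t).trans (hl V hV t)
  refine ⟨j, IsGen.of_local (fun V hV c hc => ?_) (fun V hV m x hx => ?_), hj'⟩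
  · by_cases hne : (V : Set X).Nonempty
    · have hd := isDomain_section hne
      obtain ⟨i, hi⟩ := Function.ne_iff.1 (vres_ne_zero hV hne hU.v_ne_zero)
      -- On the tangent vector `w ⨯₃ eᵢ` the form `h` takes the value `v i`, which is nonzero for a
      -- suitable `i`; hence `j` has no annihilator.
      obtain ⟨t, ht⟩ := hU.model.exists_coordT_eq hV (m := vres hV w ⨯₃ Pi.single i 1)
        (by rw [dot_self_cross])
      have h1 := congrArg (fun l => alev l le_rfl ((Limits.cokernel.π σ).app V t)) hc
      have h2 : c * (vres hV h ⬝ᵥ hU.model.coordT hV t) = 0 := by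
        have h3 : alev (c • resM (altSheaf (Limits.cokernel σ) 1) hV j) le_rfl
          ((Limits.cokernel.π σ).app V t) = 0 := h1
        rwa [alev_smul, alev_res, resO_rfl, hj'] at h3
      have h3 : vres hV h ⬝ᵥ (vres hV w ⨯₃ Pi.single i 1) = vres hV v i := by
        rw [hU.eq_cross, vres_cross]
        generalize vres hV h = h'
        generalize vres hV w = w'
        rw [vec3_dotProduct]
        fin_cases i <;> simp [cross_apply] <;> ring
      rw [ht, h3] at h2
      exact (mul_eq_zero.1 h2).resolve_right hi
    · have := subsingleton_section hne
      exact Subsingleton.elim _ _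
  · obtain ⟨b, hb, hxb⟩ := exists_basicOpen_le hU.model.isChart.isAffineOpen hx (hV hx)
    have hne : (X.basicOpen b : Set X).Nonempty := ⟨x, hxb⟩
    obtain ⟨l', hl'⟩ := exists_lev (M := F.T) (U := X.basicOpen b)
      (fun W hW t => alev m (hW.trans hb) ((Limits.cokernel.π σ).app W t))
      (fun W hW t t' => by rw [map_add, map_add])
      (fun W hW a t => by rw [Scheme.Modules.Hom.app_smul, map_smul, smul_eq_mul])
      (fun hW hW' t => by rw [resO_alev, resM_app])
    obtain ⟨b', hb'⟩ := (hU.model.basicOpen b hne).exists_lev_eq l'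
    -- A form on the cokernel, pulled back to `F.T` and extended to a vector `b'`, kills `v`. Hence
    -- `b'` is a combination of `h` and `w`, and `w` contributes nothing on `F.T`.
    have h0 : b' ⬝ᵥ vres (X.basicOpen_le b) v = 0 := by
      have h1 := hb' _ le_rfl (σ.app _ ((1 : Γ(X, X.basicOpen b)) • resM L (X.basicOpen_le b) s₀))
      rw [hl', cokernel_π_app, map_zero, hU.model.coordT_basicOpen b hne, hU.coordT_eq', one_smul,
        vres_rfl] at h1
      exact h1.symm
    obtain ⟨c, d, hcd⟩ := hU.perp _ h0
    refine ⟨_, hb, hxb, c, alev_ext_of_epi (Limits.cokernel.π σ) fun W hW t => ?_⟩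
    have h1 := hb' W hW t
    rw [hl', hU.model.coordT_basicOpen b hne, hcd, vres_add, vres_smul, vres_smul, add_dotProduct,
      smul_dotProduct, smul_dotProduct, vres_vres, vres_vres, hU.model.dot_coordT, smul_zero,
      add_zero] at h1
    refine h1.trans ?_
    rw [alev_smul, alev_res, hj']
    rfl

end ConormalGenerator

/-! ### Extensions `θ` of the canonical map, and their local one-forms. -/

section Extension

open Matrix

variable {X : Scheme.{0}} {f : X ⟶ Spec (.of ℂ)} {U V W : X.Opens}
  {e : Fin 3 → Γ(tangentSheaf f, U)} {F : Distribution f 1} {L : X.Modules} {σ : L ⟶ F.T}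

/-- The sheaf of linear forms on the cokernel of `σ`. -/
abbrev conormal (σ : L ⟶ F.T) : X.Modules := altSheaf (Limits.cokernel σ) 1

/-- A morphism from the tangent sheaf to the double dual of the cokernel of `σ` which extends the
canonical morphism from `F.T`. -/
def IsExtension (θ : tangentSheaf f ⟶ dual (conormal σ)) : Prop :=
  ∀ (V : X.Opens) (t : Γ(F.T, V)) (W : X.Opens) (hW : W ≤ V) (j : Γ(conormal σ, W)),
    lev (θ.app V (F.φ.app V t)) hW j =
      alev j le_rfl ((Limits.cokernel.π σ).app W (resM F.T hW t))

/-- A local model of `σ` in which a given extension is the one-form `h`. -/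
structure HModel (θ : tangentSheaf f ⟶ dual (conormal σ)) (U : X.Opens)
    (e : Fin 3 → Γ(tangentSheaf f, U)) (w : Fin 3 → Γ(X, U)) (s₀ : Γ(L, U))
    (h v : Fin 3 → Γ(X, U)) (j : Γ(conormal σ, U)) : Prop where
  gmodel : GModel σ U e w s₀ h v
  isGen : IsGen (conormal σ) U j
  alev_eq : ∀ V (hV : V ≤ U) t, alev j hV ((Limits.cokernel.π σ).app V t) =
    vres hV h ⬝ᵥ gmodel.model.coordT hV t
  lev_app : ∀ V (hV : V ≤ U) m, lev (θ.app V m) le_rfl (resM (conormal σ) hV j) =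
    vres hV h ⬝ᵥ gmodel.model.isChart.isBasisOver.coord hV m

theorem cross_single_dot {A : Type} [CommRing A] (a b : Fin 3 → A) (i : Fin 3) :
    a ⬝ᵥ (b ⨯₃ Pi.single i 1) = (a ⨯₃ b) i := by
  rw [vec3_dotProduct]
  fin_cases i <;> simp [cross_apply] <;> ring

theorem cross_cross_eq_zero {A : Type} [CommRing A] {a b c : Fin 3 → A} (hb : b ⬝ᵥ a = 0)
    (hc : c ⬝ᵥ a = 0) : (b ⨯₃ c) ⨯₃ a = 0 := by
  rw [vec3_dotProduct] at hb hc
  ext i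
  fin_cases i <;> simp [cross_apply]
  · linear_combination c 0 * hb - b 0 * hc
  · linear_combination c 1 * hb - b 1 * hc
  · linear_combination c 2 * hb - b 2 * hc

section

variable {w h v : Fin 3 → Γ(X, U)} {s₀ : Γ(L, U)} {j : Γ(conormal σ, U)}
  {θ : tangentSheaf f ⟶ dual (conormal σ)}

theorem vres_single (i : Fin 3) (h : V ≤ U) :
    vres h (Pi.single i (1 : Γ(X, U))) = Pi.single i 1 := by
  funext k
  by_cases hij : k = i
  · subst hij; simp [vres_apply]
  · simp [vres_apply, hij]

/-- The pairing of `θ` with the generator `j` is a one-form `h'` on TX. It agrees with `h` on `F.T`,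
in particular on the vectors `w ⨯₃ eᵢ`, so `h' ⨯₃ w = h ⨯₃ w = v` and `h'` may replace `h` in the
model. -/
theorem GModel.exists_hmodel [IsIntegral X] [Mono σ] (hU : GModel σ U e w s₀ h v)
    (hθ : IsExtension θ) : ∃ h' j, HModel θ U e w s₀ h' v j := by
  obtain ⟨j, hj, hj'⟩ := hU.exists_isGen_alt
  have hB := hU.model.isChart.isBasisOver
  obtain ⟨l, hl⟩ := exists_alev (M := tangentSheaf f) (U := U) (fun V hV =>
    { toFun := fun m => lev (θ.app V m) le_rfl (resM (conormal σ) hV j)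
      map_add' := fun m n => by rw [map_add, lev_add]
      map_smul' := fun a m => by
        rw [Scheme.Modules.Hom.app_smul, lev_smul, resO_rfl]
        rfl }) (fun {W V} hW hV m => by
      change resO hW (lev (θ.app V m) le_rfl (resM (conormal σ) hV j)) =
        lev (θ.app W (resM _ hW m)) le_rfl (resM (conormal σ) (hW.trans hV) j)
      rw [resO_lev, ← resM_app, lev_res, resM_resM])
  obtain ⟨h', hh'⟩ : ∃ h' : Fin 3 → Γ(X, U), ∀ V (hV : V ≤ U) m,
      lev (θ.app V m) le_rfl (resM (conormal σ) hV j) = vres hV h' ⬝ᵥ hB.coord hV m :=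
    ⟨_, fun V hV m => (hl V hV m).symm.trans (hB.alev_eq l hV m)⟩
  have hT : ∀ V (hV : V ≤ U) t, vres hV h' ⬝ᵥ hU.model.coordT hV t =
      vres hV h ⬝ᵥ hU.model.coordT hV t := by
    intro V hV t
    rw [FModel.coordT_apply, ← hh', hθ, resM_rfl, alev_res, hj', FModel.coordT_apply]
  have hw : h' ⨯₃ w = h ⨯₃ w := by
    funext i
    obtain ⟨t, ht⟩ := hU.model.exists_coordT_eq le_rfl (m := w ⨯₃ Pi.single i 1)
      (by rw [vres_rfl, dot_self_cross])
    have := hT U le_rfl t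
    rwa [ht, vres_rfl, vres_rfl, cross_single_dot, cross_single_dot] at this
  refine ⟨h', j, ⟨hU.model, hU.isGen, hU.coordT_eq, hU.v_ne_zero, hU.prim_v, ?_⟩, hj, ?_, hh'⟩
  · rw [hU.eq_cross, hw]
  · exact fun V hV t => (hj' V hV t).trans (hT V hV t).symm

namespace HModel

theorem app_eq_zero_iff (hU : HModel θ U e w s₀ h v j) (hV : V ≤ U) (m : Γ(tangentSheaf f, V)) :
    θ.app V m = 0 ↔ vres hV h ⬝ᵥ hU.gmodel.model.isChart.isBasisOver.coord hV m = 0 := by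
  refine ⟨fun h0 => ?_, fun h0 => lev_ext fun W hW l => ?_⟩
  · rw [← hU.lev_app, h0, lev_zero]
  · obtain ⟨c, rfl⟩ := hU.isGen.exists_smul (hW.trans hV) l
    have h1 := congrArg (resO hW) ((hU.lev_app V hV m).trans h0)
    rw [resO_lev, resM_resM, map_zero] at h1
    rw [lev_map_smul, h1, mul_zero, lev_zero]

theorem h_ne_zero [IsIntegral X] (hU : HModel θ U e w s₀ h v j) : h ≠ 0 := by
  rintro rfl
  exact hU.gmodel.v_ne_zero (by rw [hU.gmodel.eq_cross, map_zero, LinearMap.zero_apply])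

/-- A vector parallel to `h` is orthogonal to `v = h ⨯₃ w`, so it is `c • h + d • w`. Its cross
product with `h` is `d • v` up to sign, which forces `d = 0`. -/
theorem prim_h [IsIntegral X] (hU : HModel θ U e w s₀ h v j) (hV : V ≤ U) {b : Fin 3 → Γ(X, V)}
    (hb : b ⨯₃ vres hV h = 0) : ∃ c : Γ(X, V), b = c • vres hV h := by
  by_cases hne : (V : Set X).Nonempty
  · have hd := isDomain_section hne
    have hv := congrArg (vres hV) hU.gmodel.eq_cross
    rw [vres_cross] at hv
    obtain ⟨c, d, hcd⟩ := hU.gmodel.perp hV (b := b) (by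
      rw [hv, triple_product_permutation, triple_product_permutation, hb, dotProduct_zero])
    have h1 : d • vres hV v = 0 := by
      rw [hcd, map_add, LinearMap.add_apply, map_smul, map_smul, LinearMap.smul_apply,
        LinearMap.smul_apply, cross_self, smul_zero, zero_add, ← cross_anticomm, ← hv,
        smul_neg, neg_eq_zero] at hb
      exact hb
    obtain rfl := (smul_eq_zero.1 h1).resolve_right (vres_ne_zero hV hne hU.gmodel.v_ne_zero)
    exact ⟨c, by rw [hcd, zero_smul, add_zero]⟩
  · have := subsingleton_section hne
    exact ⟨0, Subsingleton.elim _ _⟩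

end HModel

end

end Extension

/-! ### The kernel of `θ` meets `F.T` in the image of `σ`. -/

section Intersection

open Matrix

variable {X : Scheme.{0}} {f : X ⟶ Spec (.of ℂ)} {U V W : X.Opens}
  {F : Distribution f 1} {L : X.Modules} {σ : L ⟶ F.T}
  {θ : tangentSheaf f ⟶ dual (conormal σ)}

/-- The property that `X` is covered by local models of the extension `θ` of `σ`. -/
def HasModels (θ : tangentSheaf f ⟶ dual (conormal σ)) : Prop :=
  ∀ x : X, ∃ U e w s₀ h v j, x ∈ U ∧ HModel θ U e w s₀ h v j

/-- A vector orthogonal to both `h` and `w` is parallel to `h ⨯₃ w = v`, hence a multiple of the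
primitive vector `v`, which is the image of the generator of `L`. -/
theorem cokernel_π_app_eq_zero (hm : HasModels θ) {t : Γ(F.T, V)}
    (ht : θ.app V (F.φ.app V t) = 0) : (Limits.cokernel.π σ).app V t = 0 := by
  refine resM_ext fun x hx => ?_
  obtain ⟨U, e, w, s₀, h, v, j, hxU, hU⟩ := hm x
  refine ⟨V ⊓ U, inf_le_left, ⟨hx, hxU⟩, ?_⟩
  rw [resM_app, map_zero]
  have h1 : θ.app _ (F.φ.app _ (resM F.T (inf_le_left : V ⊓ U ≤ V) t)) = 0 := by
    rw [← resM_app, ← resM_app, ht, map_zero]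
  rw [hU.app_eq_zero_iff inf_le_right] at h1
  have h2 := hU.gmodel.model.dot_coordT inf_le_right (resM F.T (inf_le_left : V ⊓ U ≤ V) t)
  obtain ⟨c, hc⟩ := hU.gmodel.prim_v _ inf_le_right _ (by
    rw [hU.gmodel.eq_cross, vres_cross]
    exact cross_cross_eq_zero h1 h2)
  rw [← hU.gmodel.coordT_eq' inf_le_right] at hc
  rw [hU.gmodel.model.coordT_injective _ hc, cokernel_π_app]

variable (H : Distribution f 1) {G : Distribution f 2}

/-- The image of `L` lies in the kernel of `θ`, since on `F.T` the map `θ` factors through the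
cokernel of `σ`. Conversely a cone over the two inclusions has its first leg killed by that
cokernel, so the leg factors uniquely through `L`. -/
theorem isIntersection [Mono σ] (hm : HasModels θ) (hθ : IsExtension θ) (hG : G.IsInducedBy F σ)
    (hH : ∀ (V : X.Opens) (m : Γ(tangentSheaf f, V)), H.π.app V m = 0 ↔ θ.app V m = 0) :
    G.IsIntersection F H := by
  obtain ⟨ε, hε⟩ := hG
  have := H.exact.mono_f
  have h0 : (ε.hom ≫ σ ≫ F.φ) ≫ H.π = 0 := by
    refine modules_hom_ext fun V t => ?_
    refine (hH V _).2 (lev_ext fun W hW l => ?_)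
    rw [lev_zero]
    refine (hθ V _ W hW l).trans ?_
    have : resM F.T hW (σ.app V (ε.hom.app V t)) = σ.app W (resM L hW (ε.hom.app V t)) :=
      resM_app _ _ _
    refine (congrArg (fun z => alev l le_rfl ((Limits.cokernel.π σ).app W z)) this).trans ?_
    simp only [cokernel_π_app, map_zero]
  let b : G.T ⟶ H.T := H.exact.exact.lift (ε.hom ≫ σ ≫ F.φ) h0
  have hb : b ≫ H.φ = ε.hom ≫ σ ≫ F.φ := H.exact.exact.lift_f _ h0
  refine ⟨ε.hom ≫ σ, b, ⟨⟨by rw [hb, Category.assoc]⟩, ⟨?_⟩⟩, by rw [hε, Category.assoc]⟩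
  have hx : ∀ s : Limits.PullbackCone F.φ H.φ, s.fst ≫ Limits.cokernel.π σ = 0 := fun s =>
    modules_hom_ext fun V k => cokernel_π_app_eq_zero (t := s.fst.app V k) hm ((hH V _).1 (by
      have h1 : F.φ.app V (s.fst.app V k) = H.φ.app V (s.snd.app V k) :=
        congrArg (fun φ : s.pt ⟶ tangentSheaf f => φ.app V k) s.condition
      rw [h1, H.app_app]))
  let lf : ∀ s : Limits.PullbackCone F.φ H.φ, s.pt ⟶ L := fun s =>
    (ShortComplex.exact_cokernel σ).lift s.fst (hx s)
  have hlf : ∀ s, lf s ≫ σ = s.fst := fun s => (ShortComplex.exact_cokernel σ).lift_f s.fst (hx s)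
  refine Limits.PullbackCone.IsLimit.mk _ (fun s => lf s ≫ ε.inv) (fun s => ?_) (fun s => ?_)
    (fun s m hm1 hm2 => ?_)
  · simp [hlf]
  · rw [← cancel_mono H.φ, Category.assoc, hb, ← s.condition, ← hlf]
    simp
  · rw [← cancel_mono ε.hom, ← cancel_mono σ]
    simp [hlf, ← hm1]

end Intersection

/-! ### Coherence and reflexivity of the kernel of `θ`. -/

section Kernel

open Matrix

variable {X : Scheme.{0}} {f : X ⟶ Spec (.of ℂ)} {U V W : X.Opens}
  {e : Fin 3 → Γ(tangentSheaf f, U)} {F : Distribution f 1} {L : X.Modules} {σ : L ⟶ F.T}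
  {w h v : Fin 3 → Γ(X, U)} {s₀ : Γ(L, U)} {j : Γ(conormal σ, U)}
  {θ : tangentSheaf f ⟶ dual (conormal σ)}

theorem kernel_app (t : Γ(Limits.kernel θ, V)) : θ.app V ((Limits.kernel.ι θ).app V t) = 0 := by
  rw [← app_comp_apply, Limits.kernel.condition]
  rfl

theorem exists_kernel_app_eq {m : Γ(tangentSheaf f, V)} (hm : θ.app V m = 0) :
    ∃ t, (Limits.kernel.ι θ).app V t = m :=
  exists_app_eq (ShortComplex.exact_kernel θ) V hm

namespace HModel

/-- The coordinates of a section of the kernel of `θ`. -/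
def coordK (hU : HModel θ U e w s₀ h v j) (hV : V ≤ U) :
    Γ(Limits.kernel θ, V) →ₗ[Γ(X, V)] (Fin 3 → Γ(X, V)) where
  toFun t := hU.gmodel.model.isChart.isBasisOver.coord hV ((Limits.kernel.ι θ).app V t)
  map_add' a b := by simp only [map_add]
  map_smul' a b := by simp only [Scheme.Modules.Hom.app_smul, map_smul, RingHom.id_apply]

theorem coordK_apply (hU : HModel θ U e w s₀ h v j) (hV : V ≤ U) (t : Γ(Limits.kernel θ, V)) :
    hU.coordK hV t =
      hU.gmodel.model.isChart.isBasisOver.coord hV ((Limits.kernel.ι θ).app V t) := rfl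

theorem coordK_res (hU : HModel θ U e w s₀ h v j) (hV : V ≤ U) (hW : W ≤ V)
    (t : Γ(Limits.kernel θ, V)) :
    vres hW (hU.coordK hV t) = hU.coordK (hW.trans hV) (resM _ hW t) := by
  rw [coordK_apply, coordK_apply, ← resM_app, hU.gmodel.model.isChart.isBasisOver.coord_res]
  rfl

theorem dot_coordK (hU : HModel θ U e w s₀ h v j) (hV : V ≤ U) (t : Γ(Limits.kernel θ, V)) :
    vres hV h ⬝ᵥ hU.coordK hV t = 0 :=
  (hU.app_eq_zero_iff hV _).1 (kernel_app t)

theorem coordK_injective (hU : HModel θ U e w s₀ h v j) (hV : V ≤ U) :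
    Function.Injective (hU.coordK hV) :=
  (hU.gmodel.model.isChart.isBasisOver.coord hV).injective.comp (app_injective _ V)

theorem exists_coordK_eq (hU : HModel θ U e w s₀ h v j) (hV : V ≤ U) {m : Fin 3 → Γ(X, V)}
    (hm : vres hV h ⬝ᵥ m = 0) : ∃ t, hU.coordK hV t = m := by
  obtain ⟨t, ht⟩ := exists_kernel_app_eq (θ := θ)
    (m := (hU.gmodel.model.isChart.isBasisOver.coord hV).symm m) (by
      rw [hU.app_eq_zero_iff hV, LinearEquiv.apply_symm_apply, hm])
  exact ⟨t, by rw [coordK_apply, ht, LinearEquiv.apply_symm_apply]⟩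

theorem exists_coordK_form (hU : HModel θ U e w s₀ h v j) (hV : V ≤ U) :
    ∃ ε : Fin 3 → Γ(dual (Limits.kernel θ), V), ∀ i W (hW : W ≤ V) t,
      lev (ε i) hW t = hU.coordK (hW.trans hV) t i := by
  choose ε hε using fun i => exists_lev (M := Limits.kernel θ) (U := V)
    (fun W hW t => hU.coordK (hW.trans hV) t i)
    (fun W hW a b => by rw [map_add]; rfl) (fun W hW a b => by rw [map_smul]; rfl)
    (fun hW hV' t => by rw [← hU.coordK_res _ hW]; rfl)
  exact ⟨ε, hε⟩

/-- The coordinates of the section representing `μ` are its values on the three coordinate forms.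
They are orthogonal to `h` because the forms satisfy that relation. Agreement on all other forms is
verified after multiplication by a nonzero coordinate of `h`. -/
theorem exists_toBidual_eq [IsIntegral X] (hU : HModel θ U e w s₀ h v j) (hV : V ≤ U)
    (μ : Γ(dual (dual (Limits.kernel θ)), V)) : ∃ t, toBidual _ V t = μ := by
  obtain ⟨ε, hε⟩ := hU.exists_coordK_form hV
  obtain ⟨t, ht⟩ := hU.exists_coordK_eq hV (m := fun i => lev μ le_rfl (ε i)) (by
    have h0 : ∑ i, vres hV h i • ε i = 0 := lev_ext fun W hW s => by
      rw [lev_zero, lev_sum]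
      simp only [lev_smul, hε]
      have := hU.dot_coordK (hW.trans hV) s
      rw [← vres_vres hW hV] at this
      exact this
    have := congrArg (levₗ μ le_rfl) h0
    simp only [map_sum, map_smul, map_zero] at this
    exact this)
  refine ⟨t, lev_ext fun W hW l => ?_⟩
  change lev l le_rfl (resM _ hW t) = lev μ hW l
  by_cases hne : (W : Set X).Nonempty
  · have hd := isDomain_section hne
    have hWU := hW.trans hV
    obtain ⟨i, hi⟩ := Function.ne_iff.1 (vres_ne_zero hWU hne hU.h_ne_zero)
    refine mul_left_cancel₀ hi ?_
    choose τ hτ using fun k : Fin 3 => hU.exists_coordK_eq hWU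
      (m := vres hWU h ⨯₃ Pi.single k 1) (dot_self_cross _ _)
    have hτ' : ∀ W' (hW' : W' ≤ W) k, hU.coordK (hW'.trans hWU) (resM _ hW' (τ k)) =
        vres (hW'.trans hWU) h ⨯₃ Pi.single k 1 := by
      intro W' hW' k
      rw [← hU.coordK_res hWU hW', hτ, vres_cross, vres_single, vres_vres]
    -- By `smul_eq_cross`, `h i` times a section of the kernel is a combination of the `τ k`, with
    -- coefficients linear in the coordinates of the section.
    have hexp : ∀ W' (hW' : W' ≤ W) s, vres (hW'.trans hWU) h i • s =
        ∑ k, (hU.coordK (hW'.trans hWU) s ⨯₃ Pi.single i 1) k • resM _ hW' (τ k) := by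
      intro W' hW' s
      refine hU.coordK_injective (hW'.trans hWU) ?_
      rw [map_smul, smul_eq_cross _ _ _ (hU.dot_coordK _ s), map_sum]
      simp only [map_smul, hτ']
      simp only [← map_smul, ← map_sum]
      congr 1
      funext k
      simp [Pi.single_apply]
    have hlin : ∀ {A : Type} [CommRing A] (x : Fin 3 → A) (k : Fin 3),
        (x ⨯₃ Pi.single i 1) k = ∑ m, (Pi.single m 1 ⨯₃ Pi.single i 1 : Fin 3 → A) k * x m := by
      intro A _ x k
      rw [Fin.sum_univ_three]
      fin_cases i <;> fin_cases k <;> simp [cross_apply]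
    -- Consequently `h i • l` is a combination of the coordinate forms, on which `μ` is already
    -- known.
    have hl : vres hWU h i • l = ∑ k, lev l le_rfl (τ k) •
        ∑ m, (Pi.single m 1 ⨯₃ Pi.single i 1 : Fin 3 → Γ(X, W)) k • resM _ hW (ε m) := by
      refine lev_ext fun W' hW' s => ?_
      have h1 := congrArg (levₗ l hW') (hexp W' hW' s)
      simp only [map_smul, map_sum, levₗ_apply, smul_eq_mul] at h1
      rw [lev_smul, lev_sum]
      refine (congrArg (· * lev l hW' s) (resO_resO _ _ _)).trans (h1.trans ?_)
      refine Finset.sum_congr rfl fun k _ => ?_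
      rw [lev_smul, lev_sum, resO_lev, hlin, mul_comm]
      congr 1
      refine Finset.sum_congr rfl fun m _ => ?_
      rw [lev_smul, lev_res, hε]
      congr 1
      have := congrFun (vres_cross hW' (Pi.single m 1) (Pi.single i 1 : Fin 3 → Γ(X, W))) k
      rw [vres_single, vres_single] at this
      exact this.symm
    have h2 := congrArg (levₗ μ hW) hl
    have h3 : ∀ m, lev μ hW (resM _ hW (ε m)) = vres hW (hU.coordK hV t) m := by
      intro m
      rw [ht, vres_apply, resO_lev]
    simp only [map_smul, map_sum, levₗ_apply, smul_eq_mul, h3, ← hlin] at h2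
    rw [h2]
    have h4 := congrArg (levₗ l le_rfl) (hexp W le_rfl (resM _ hW t))
    simp only [map_smul, map_sum, levₗ_apply, smul_eq_mul, resM_rfl] at h4
    rw [h4]
    refine Finset.sum_congr rfl fun k _ => ?_
    rw [hU.coordK_res, mul_comm]
  · have := subsingleton_section hne
    exact Subsingleton.elim _ _

/-- Locally the kernel consists of the solutions of `h ⬝ᵥ m = 0`. Its generators, and then the
relations between them, are solutions of linear systems over a Noetherian ring. -/
theorem generates_kernel [IsIntegral X] (hU : HModel θ U e w s₀ h v j) :
    ∃ (n k : ℕ) (s : Fin n → Γ(Limits.kernel θ, U)) (r : Fin k → Fin n → Γ(X, U)),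
      Generates (Limits.kernel θ) U s ∧ GeneratesRelations (Limits.kernel θ) U s r := by
  have hA := hU.gmodel.model.isChart.isAffineOpen
  have := hU.gmodel.model.isChart.isNoetherianRing
  obtain ⟨n, a, ha, ha'⟩ := exists_syzygies hA (fun _ : Fin 1 => h)
  obtain ⟨k, r, hr, hr'⟩ := exists_syzygies hA (fun (q : Fin 3) (i : Fin n) => a i q)
  choose s hs using fun i => hU.exists_coordK_eq le_rfl (m := a i) (by
    rw [vres_rfl]
    exact ha i 0)
  have hs' : ∀ V (hV : V ≤ U) i, hU.coordK hV (resM _ hV (s i)) = vres hV (a i) := by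
    intro V hV i
    rw [← hU.coordK_res le_rfl, hs]
  have hsum : ∀ V (hV : V ≤ U) (c : Fin n → Γ(X, V)) q,
      hU.coordK hV (∑ i, c i • resM _ hV (s i)) q = ∑ i, resO hV (a i q) * c i := by
    intro V hV c q
    simp only [map_sum, map_smul, hs', Finset.sum_apply, Pi.smul_apply, smul_eq_mul, vres_apply]
    exact Finset.sum_congr rfl fun i _ => mul_comm _ _
  refine ⟨n, k, s, r, fun V hV m x hx => ?_, fun i => ?_, fun V hV c hc => ?_⟩
  · obtain ⟨W, hW, hxW, d, hd⟩ := ha' V hV (hU.coordK hV m) (fun _ => hU.dot_coordK hV m) x hx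
    refine ⟨W, hW, hxW, d, hU.coordK_injective (hW.trans hV) (funext fun q => ?_)⟩
    rw [hsum, ← hU.coordK_res hV hW, vres_apply, hd]
    exact Finset.sum_congr rfl fun i _ => mul_comm _ _
  · refine hU.coordK_injective le_rfl (funext fun q => ?_)
    have h1 := hsum U le_rfl (r i) q
    simp only [resM_rfl, resO_rfl] at h1
    rw [h1, hr, map_zero]
    rfl
  · refine hr' V hV c fun q => ?_
    rw [← hsum, hc, map_zero]
    rfl

theorem generates_cokernel [IsIntegral X] (hU : HModel θ U e w s₀ h v j) {N : X.Modules}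
    (π : tangentSheaf f ⟶ N) [Epi π] (hπ : ∀ (V : X.Opens) m, π.app V m = 0 ↔ θ.app V m = 0) :
    ∃ (n k : ℕ) (s : Fin n → Γ(N, U)) (r : Fin k → Fin n → Γ(X, U)),
      Generates N U s ∧ GeneratesRelations N U s r := by
  have hA := hU.gmodel.model.isChart.isAffineOpen
  have := hU.gmodel.model.isChart.isNoetherianRing
  have hB := hU.gmodel.model.isChart.isBasisOver
  obtain ⟨k, r, hr, hr'⟩ := exists_syzygies hA (fun _ : Fin 1 => h)
  have hsum : ∀ V (hV : V ≤ U) (c : Fin 3 → Γ(X, V)),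
      ∑ i, c i • resM N hV (π.app U (e i)) = π.app V ((hB.coord hV).symm c) := by
    intro V hV c
    rw [hB.coord_symm_apply, map_sum]
    exact Finset.sum_congr rfl fun i _ => by rw [Scheme.Modules.Hom.app_smul, resM_app]
  refine ⟨3, k, fun i => π.app U (e i), r, fun V hV m x hx => ?_, fun i => ?_, fun V hV c hc => ?_⟩
  · obtain ⟨W, hW, hxW, m', hm'⟩ := exists_app_eq_of_epi π m x hx
    refine ⟨W, hW, hxW, hB.coord (hW.trans hV) m', ?_⟩
    rw [hsum, LinearEquiv.symm_apply_apply, hm']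
  · have h1 := hsum U le_rfl (r i)
    simp only [resM_rfl] at h1
    rw [h1, hπ, hU.app_eq_zero_iff le_rfl, LinearEquiv.apply_symm_apply, vres_rfl]
    exact hr i 0
  · rw [hsum, hπ, hU.app_eq_zero_iff hV, LinearEquiv.apply_symm_apply] at hc
    exact hr' V hV c fun _ => hc

end HModel

theorem toBidual_kernel_injective (hm : HasModels θ) (V : X.Opens) :
    Function.Injective (toBidual (Limits.kernel θ) V) := by
  intro a b hab
  refine resM_ext fun x hx => ?_
  obtain ⟨U, e, w, s₀, h, v, j, hxU, hU⟩ := hm x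
  refine ⟨V ⊓ U, inf_le_left, ⟨hx, hxU⟩, hU.coordK_injective inf_le_right (funext fun i => ?_)⟩
  obtain ⟨ε, hε⟩ := hU.exists_coordK_form (inf_le_right : V ⊓ U ≤ U)
  rw [← hε i _ le_rfl, ← hε i _ le_rfl]
  exact congrArg (fun z : Γ(dual (dual (Limits.kernel θ)), V) => lev z inf_le_left (ε i)) hab

theorem isReflexive_kernel [IsIntegral X] (hm : HasModels θ) : IsReflexive (Limits.kernel θ) := by
  refine ⟨isCoherent_of_local fun x => ?_, fun V => ⟨?_, fun μ => ?_⟩⟩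
  · obtain ⟨U, e, w, s₀, h, v, j, hxU, hU⟩ := hm x
    exact ⟨U, hxU, hU.generates_kernel⟩
  · exact toBidual_kernel_injective hm V
  · have hres : ∀ {W V : X.Opens} (hW : W ≤ V) t, toBidual (Limits.kernel θ) W (resM _ hW t) =
        resM _ hW (toBidual (Limits.kernel θ) V t) := by
      intro W V hW t
      refine lev_ext fun W' hW' l => ?_
      exact congrArg (lev l le_rfl) (resM_resM _ hW' hW t)
    have hloc : ∀ x ∈ V, ∃ (W : X.Opens) (hW : W ≤ V), x ∈ W ∧
        ∃ t, toBidual (Limits.kernel θ) W t = resM _ hW μ := by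
      intro x hx
      obtain ⟨U, e, w, s₀, h, v, j, hxU, hU⟩ := hm x
      exact ⟨V ⊓ U, inf_le_left, ⟨hx, hxU⟩, hU.exists_toBidual_eq inf_le_right _⟩
    obtain ⟨t, ht⟩ := exists_sectionM_of_local (Limits.kernel θ) (V := V)
      (fun W hW t => toBidual (Limits.kernel θ) W t = resM _ hW μ)
      (fun hW hW' t ht => by rw [hres, ht, resM_resM])
      (fun hW a b ha hb => toBidual_kernel_injective hm _ (ha.trans hb.symm)) hloc
    refine ⟨t, resM_ext fun x hx => ?_⟩
    obtain ⟨W, hW, hxW, t', ht'⟩ := hloc x hx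
    exact ⟨W, hW, hxW, by rw [← hres, ht W hW t' ht', ht']⟩

end Kernel

/-! ### Injectivity of restriction, and duals of isomorphic sheaves. -/

section Rank

variable {X : Scheme.{0}} [IsIntegral X] {U V W : X.Opens}

theorem resM_injective_of_frames {ι : Type} [Fintype ι] {M : X.Modules}
    (hM : ∀ x : X, ∃ (W : X.Opens) (e : ι → Γ(M, W)), x ∈ W ∧ IsBasisOver M W e) (h : W ≤ V)
    (hW : (W : Set X).Nonempty) : Function.Injective (resM M h) := by
  intro a b hab
  refine resM_ext fun x hx => ?_
  obtain ⟨U, e, hxU, he⟩ := hM x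
  refine ⟨V ⊓ U, inf_le_left, ⟨hx, hxU⟩, ?_⟩
  have hne : ((V ⊓ U ⊓ W : X.Opens) : Set X).Nonempty :=
    nonempty_preirreducible_inter (V ⊓ U).2 W.2 ⟨x, hx, hxU⟩ hW
  refine he.resM_injective inf_le_right (inf_le_left : V ⊓ U ⊓ W ≤ V ⊓ U) hne ?_
  have := congrArg (resM M (inf_le_right : V ⊓ U ⊓ W ≤ W)) hab
  rw [resM_resM] at this ⊢
  rw [this, resM_resM, resM_resM]

theorem resM_dual_injective {M : X.Modules} (h : W ≤ V) (hW : (W : Set X).Nonempty) :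
    Function.Injective (resM (dual M) h) := by
  intro a b hab
  refine lev_ext fun V' hV' m => ?_
  by_cases hne : (V' : Set X).Nonempty
  · have hne' := nonempty_preirreducible_inter V'.2 W.2 hne hW
    refine resO_injective (inf_le_left : V' ⊓ W ≤ V') hne' ?_
    have := congrArg (fun l => lev l (inf_le_right : V' ⊓ W ≤ W) (resM M inf_le_left m)) hab
    rw [resO_lev, resO_lev]
    exact this
  · have := subsingleton_section hne
    exact Subsingleton.elim _ _

/-- Isomorphic sheaves have isomorphic duals. -/
theorem nonempty_dual_iso {X : Scheme.{0}} {M N : X.Modules} (φ : M ≅ N) :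
    Nonempty (dual N ≅ dual M) := by
  have h1 : ∀ (V : X.Opens) m, φ.inv.app V (φ.hom.app V m) = m := fun V m => by
    rw [← app_comp_apply, φ.hom_inv_id]
    rfl
  have h2 : ∀ (V : X.Opens) m, φ.hom.app V (φ.inv.app V m) = m := fun V m => by
    rw [← app_comp_apply, φ.inv_hom_id]
    rfl
  choose g hg using fun (V : X.Opens) (l : Γ(dual N, V)) => exists_lev (M := M) (U := V)
    (fun W h m => lev l h (φ.hom.app W m)) (fun W h m n => by rw [map_add, lev_map_add])
    (fun W h a m => by rw [Scheme.Modules.Hom.app_smul, lev_map_smul])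
    (fun hW h m => by rw [resO_lev, resM_app])
  let ψ : dual N ⟶ dual M := homOfApp g
    (fun V l l' => lev_ext fun W h m => by rw [lev_add, hg, hg, hg, lev_add])
    (fun V a l => lev_ext fun W h m => by rw [lev_smul, hg, hg, lev_smul])
    (fun h l => lev_ext fun W h m => by rw [lev_res, hg, hg, lev_res])
  have hψ : ∀ (V : X.Opens) (l : Γ(dual N, V)) W (h : W ≤ V) m,
      lev (ψ.app V l) h m = lev l h (φ.hom.app W m) := hg
  have : IsIso ψ := isIso_of_bijective ψ fun V => by
    refine ⟨fun a b hab => lev_ext fun W h m => ?_, fun l => ?_⟩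
    · rw [← h2 W m, ← hψ, hab, hψ]
    · obtain ⟨l', hl'⟩ := exists_lev (M := N) (U := V)
        (fun W h m => lev l h (φ.inv.app W m)) (fun W h m n => by rw [map_add, lev_map_add])
        (fun W h a m => by rw [Scheme.Modules.Hom.app_smul, lev_map_smul])
        (fun hW h m => by rw [resO_lev, resM_app])
      exact ⟨l', lev_ext fun W h m => by rw [hψ, hl', h1]⟩
  exact ⟨asIso ψ⟩

end Rank

/-! ### The distribution `H` defined by `θ`, and the determinant of its normal sheaf. -/

section Construction

open Matrix

variable {X : Scheme.{0}} [IsIntegral X] {f : X ⟶ Spec (.of ℂ)} {U V W : X.Opens}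
  {F : Distribution f 1} {L : X.Modules} {σ : L ⟶ F.T}
  {θ : tangentSheaf f ⟶ dual (conormal σ)}

theorem hasRank_kernel (hm : HasModels θ) : HasRank (Limits.kernel θ) 2 := by
  classical
  rintro ⟨V, hV⟩ ⟨x, hx⟩
  change Module.rank Γ(X, V) Γ(Limits.kernel θ, V) = 2
  have hneV : (V : Set X).Nonempty := ⟨x, hx⟩
  have hdV := isDomain_section hneV
  obtain ⟨U, e, w, s₀, h, v, j, hxU, hU⟩ := hm x
  obtain ⟨b, hb, hxb⟩ := exists_basicOpen_le hV hxU hx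
  have hne : (X.basicOpen b : Set X).Nonempty := ⟨x, hxb⟩
  have hd := isDomain_section hne
  have hbV := X.basicOpen_le b
  have hu : ∀ n : ℕ, (resO hbV b ^ n) ≠ 0 := fun n =>
    ((isUnit_resO_basicOpen b).pow n).ne_zero
  have hframe : ∀ x : X, ∃ (W : X.Opens) (e : Fin 3 → Γ(tangentSheaf f, W)),
      x ∈ W ∧ IsBasisOver (tangentSheaf f) W e := fun x => by
    obtain ⟨U, e, w, s₀, h, v, j, hxU, hU⟩ := hm x
    exact ⟨U, e, hxU, hU.gmodel.model.isChart.isBasisOver⟩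
  have hTinj := resM_injective_of_frames hframe hbV hne
  have hh0 := vres_ne_zero hb hne hU.h_ne_zero
  let cK := fun t : Γ(Limits.kernel θ, V) => hU.coordK hb (resM _ hbV t)
  have hcK : ∀ {n : ℕ} (c : Fin n → Γ(X, V)) (g : Fin n → Γ(Limits.kernel θ, V)),
      cK (∑ i, c i • g i) = ∑ i, resO hbV (c i) • cK (g i) := by
    intro n c g
    simp only [cK, map_sum, resM_smul, map_smul]
  have hcK0 : ∀ t, cK t = 0 → t = 0 := by
    intro t ht
    have h1 := hU.coordK_injective hb (ht.trans (map_zero _).symm)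
    refine app_injective (Limits.kernel.ι θ) V (hTinj ?_)
    rw [resM_app, h1, map_zero, map_zero, map_zero]
  apply le_antisymm
  · refine rank_le fun s hs => ?_
    by_contra hcard
    push Not at hcard
    obtain ⟨g, hg⟩ : ∃ g : Fin 3 → s, Function.Injective g :=
      ⟨fun i => s.equivFin.symm (Fin.castLE hcard i),
        s.equivFin.symm.injective.comp (Fin.castLE_injective hcard)⟩
    have hli := hs.comp g hg
    -- Three sections of the kernel have a coordinate matrix that kills the nonzero vector `h`. Its
    -- rows are dependent, and clearing denominators gives a relation over `V`.
    let M : Matrix (Fin 3) (Fin 3) Γ(X, X.basicOpen b) := Matrix.of fun i => cK (g i)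
    have hM : M *ᵥ vres hb h = 0 := by
      funext i
      have := hU.dot_coordK hb (resM _ hbV (g i : Γ(Limits.kernel θ, V)))
      rw [dotProduct_comm] at this
      exact this
    obtain ⟨c, hc0, hc⟩ := exists_vecMul_eq_zero_iff.2 (exists_mulVec_eq_zero_iff.1 ⟨_, hh0, hM⟩)
    obtain ⟨n, c', hc'⟩ := exists_vres_eq hV b c
    rw [Fintype.linearIndependent_iff] at hli
    have h0 := hli c' (hcK0 _ (by
      rw [hcK]
      have h1 : ∀ i, resO hbV (c' i) = resO hbV b ^ n * c i := fun i => congrFun hc' i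
      simp only [h1, mul_smul, ← Finset.smul_sum]
      have h2 : ∑ i, c i • cK (g i) = 0 := by
        funext k
        have := congrFun hc k
        simp only [vecMul, dotProduct] at this
        rw [Finset.sum_apply]
        exact this
      exact (congrArg (resO hbV b ^ n • ·) h2).trans (smul_zero _)))
    have h1 : c' = 0 := funext h0
    rw [h1, vres_zero] at hc'
    exact hc0 ((smul_eq_zero.1 hc'.symm).resolve_left (hu n))
  · have hlift : ∀ m : Fin 3 → Γ(X, X.basicOpen b), vres hb h ⬝ᵥ m = 0 →
        ∃ (n : ℕ) (t : Γ(Limits.kernel θ, V)), cK t = resO hbV b ^ n • m := by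
      intro m hm0
      obtain ⟨t, ht⟩ := hU.exists_coordK_eq hb hm0
      obtain ⟨n, t', ht'⟩ := exists_resM_eq hframe hV b ((Limits.kernel.ι θ).app _ t)
      -- The extended vector field is still killed by `θ`: restriction is injective on the dual
      -- sheaf in which `θ` takes values.
      obtain ⟨t'', rfl⟩ := exists_kernel_app_eq (θ := θ) (m := t') (by
        refine resM_dual_injective hbV hne ?_
        have h1 : θ.app (X.basicOpen b) (resM (tangentSheaf f) hbV t') = 0 := by
          rw [ht', Scheme.Modules.Hom.app_smul, kernel_app, smul_zero]
        rw [resM_app, h1, map_zero])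
      refine ⟨n, t'', ?_⟩
      rw [← ht, ← map_smul]
      refine congrArg (hU.coordK hb) (app_injective (Limits.kernel.ι θ) _ ?_)
      rw [← resM_app, ht', Scheme.Modules.Hom.app_smul]
    obtain ⟨i, hi⟩ := Function.ne_iff.1 hh0
    have hlift2 : ∃ t : Fin 2 → Γ(Limits.kernel θ, V), ∀ c : Fin 2 → Γ(X, V),
        ∑ k, c k • t k = 0 → ∀ k, c k = 0 := by
      -- With `h i` nonzero and `p`, `q` the other two indices, `h ⨯₃ eₚ` and `h ⨯₃ e_q` are
      -- independent: in the coordinates `p` and `q` they are `h i` up to sign times distinct basis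
      -- vectors.
      choose n t ht using fun k : Fin 3 => hlift (vres hb h ⨯₃ Pi.single k 1) (dot_self_cross _ _)
      have key : ∀ p q : Fin 3, p ≠ q → i ≠ p → i ≠ q → ∀ c d : Γ(X, V),
          c • t p + d • t q = 0 → c = 0 ∧ d = 0 := by
        intro p q hpq hip hiq c d hcd
        have h1 := hcK ![c, d] ![t p, t q]
        simp only [Fin.sum_univ_two, Matrix.cons_val_zero, Matrix.cons_val_one, hcd, ht] at h1
        have h2 : cK 0 = 0 := by simp only [cK, map_zero]
        rw [h2] at h1
        set y := vres hb h
        have e1 := congrFun h1 p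
        have e2 := congrFun h1 q
        have hb' : (resO hbV) b ≠ 0 := by simpa using hu 1
        have : (resO hbV c = 0) ∧ (resO hbV d = 0) := by
          fin_cases i <;> fin_cases p <;> fin_cases q <;>
            simp [cross_apply, hb'] at hpq hip hiq e1 e2 hi ⊢ <;> tauto
        exact ⟨resO_injective hbV hne (this.1.trans (map_zero _).symm),
          resO_injective hbV hne (this.2.trans (map_zero _).symm)⟩
      obtain ⟨p, q, hpq, hip, hiq⟩ : ∃ p q : Fin 3, p ≠ q ∧ i ≠ p ∧ i ≠ q := by
        fin_cases i
        · exact ⟨1, 2, by decide, by decide, by decide⟩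
        · exact ⟨0, 2, by decide, by decide, by decide⟩
        · exact ⟨0, 1, by decide, by decide, by decide⟩
      refine ⟨![t p, t q], fun c hc k => ?_⟩
      rw [Fin.sum_univ_two] at hc
      have := key p q hpq hip hiq (c 0) (c 1) hc
      fin_cases k
      · exact this.1
      · exact this.2
    obtain ⟨t, ht⟩ := hlift2
    have := (Fintype.linearIndependent_iff.2 ht).cardinal_le_rank
    simpa using this

/-- The distribution defined by an extension `θ`. -/
theorem exists_distribution (hm : HasModels θ) : ∃ H : Distribution f 1,
    ∀ (V : X.Opens) (m : Γ(tangentSheaf f, V)), H.π.app V m = 0 ↔ θ.app V m = 0 := by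
  let K := Limits.kernel.ι θ
  let N := Limits.cokernel K
  -- The normal sheaf is the coimage of `θ`. It embeds in a dual sheaf, where functions on an
  -- integral scheme can be cancelled, so it is torsion free.
  let ι : N ⟶ dual (conormal σ) := Limits.cokernel.desc K θ (Limits.kernel.condition θ)
  have hι : Limits.cokernel.π K ≫ ι = θ := Limits.cokernel.π_desc _ _ _
  have : Mono ι := inferInstanceAs (Mono (Abelian.factorThruCoimage θ))
  have hπ : ∀ (V : X.Opens) (m : Γ(tangentSheaf f, V)),
      (Limits.cokernel.π K).app V m = 0 ↔ θ.app V m = 0 := by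
    intro V m
    have h1 : θ.app V m = ι.app V ((Limits.cokernel.π K).app V m) :=
      congrArg (fun φ : tangentSheaf f ⟶ dual (conormal σ) => φ.app V m) hι.symm
    refine ⟨fun h0 => by rw [h1, h0, map_zero], fun h0 => ?_⟩
    exact app_injective ι V (h1.symm.trans (h0.trans (map_zero _).symm))
  refine ⟨{
    T := Limits.kernel θ
    N := N
    φ := K
    π := Limits.cokernel.π K
    zero := Limits.cokernel.condition K
    exact := ?_
    reflexive := isReflexive_kernel hm
    rank := hasRank_kernel hm
    torsionFree := ⟨isCoherent_of_local fun x => ?_, fun V a n han => ?_⟩ }, hπ⟩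
  · exact { exact := ShortComplex.exact_cokernel K
            mono_f := inferInstanceAs (Mono (Limits.kernel.ι θ))
            epi_g := inferInstanceAs (Epi (Limits.cokernel.π K)) }
  · obtain ⟨U, e, w, s₀, h, v, j, hxU, hU⟩ := hm x
    exact ⟨U, hxU, hU.generates_cokernel (Limits.cokernel.π K) hπ⟩
  · by_cases ha : a = 0
    · exact Or.inl ha
    · refine Or.inr (app_injective ι V (lev_ext fun W hW l => ?_))
      refine eq_zero_of_resO_mul hW ha ?_ |>.trans ?_
      · rw [← lev_smul, ← Scheme.Modules.Hom.app_smul, han, map_zero, lev_zero]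
      · rw [map_zero, lev_zero]

theorem HModel.exists_isGen_normal {e : Fin 3 → Γ(tangentSheaf f, U)} {w h v : Fin 3 → Γ(X, U)}
    {s₀ : Γ(L, U)} {j : Γ(conormal σ, U)} (hU : HModel θ U e w s₀ h v j) {N : X.Modules}
    (π : tangentSheaf f ⟶ N) [Epi π] (hπ : ∀ (V : X.Opens) m, π.app V m = 0 ↔ θ.app V m = 0) :
    ∃ n : Γ(altSheaf N 1, U), IsGen (altSheaf N 1) U n ∧
      ∀ V (hV : V ≤ U) m, alev n hV (π.app V m) =
        vres hV h ⬝ᵥ hU.gmodel.model.isChart.isBasisOver.coord hV m := by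
  have hB := hU.gmodel.model.isChart.isBasisOver
  obtain ⟨l, hl⟩ := hB.exists_alev_eq h
  obtain ⟨n, hn⟩ := exists_alev_descend π l (fun V hV m hm => by
    rw [hl]
    exact (hU.app_eq_zero_iff hV m).1 ((hπ V m).1 hm))
  have hn' : ∀ V (hV : V ≤ U) m, alev n hV (π.app V m) = vres hV h ⬝ᵥ hB.coord hV m :=
    fun V hV m => (hn V hV m).trans (hl V hV m)
  refine ⟨n, IsGen.of_local (fun V hV c hc => ?_) (fun V hV n' x hx => ?_), hn'⟩
  · by_cases hne : (V : Set X).Nonempty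
    · have hd := isDomain_section hne
      obtain ⟨i, hi⟩ := Function.ne_iff.1 (vres_ne_zero hV hne hU.h_ne_zero)
      have h1 : alev (c • resM (altSheaf N 1) hV n) le_rfl
        (π.app V ((hB.coord hV).symm (Pi.single i 1))) = 0 := by
        rw [hc]
        rfl
      rw [alev_smul, alev_res, resO_rfl, hn', LinearEquiv.apply_symm_apply,
        dotProduct_single_one] at h1
      exact (mul_eq_zero.1 h1).resolve_right hi
    · have := subsingleton_section hne
      exact Subsingleton.elim _ _
  · obtain ⟨l', hl'⟩ := exists_alev (M := tangentSheaf f) (U := V)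
      (fun W hW =>
        { toFun := fun m => alev n' hW (π.app W m)
          map_add' := fun a b => by rw [map_add, map_add]
          map_smul' := fun a b => by rw [Scheme.Modules.Hom.app_smul, map_smul, RingHom.id_apply] })
      (fun {W W'} hW hW' m => by
        change resO hW (alev n' hW' (π.app W' m)) = alev n' _ (π.app W (resM _ hW m))
        rw [resO_alev, resM_app])
    obtain ⟨b, hb⟩ : ∃ b : Fin 3 → Γ(X, V), ∀ W (hW : W ≤ V) m,
        alev n' hW (π.app W m) = vres hW b ⬝ᵥ hB.coord (hW.trans hV) m :=
      ⟨_, fun W hW m => (hl' W hW m).symm.trans (((hB.res hV).alev_eq l' hW m).trans (by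
        rw [hB.coord_frame_res]))⟩
    -- A form on the normal sheaf, pulled back to TX, kills the vectors `h ⨯₃ eᵢ`; it is therefore
    -- parallel to the primitive vector `h`.
    obtain ⟨c, hc⟩ := hU.prim_h hV (b := b) (by
      funext i
      have h1 := hb V le_rfl ((hB.coord hV).symm (vres hV h ⨯₃ Pi.single i 1))
      rw [(hπ V _).2 ((hU.app_eq_zero_iff hV _).2 (by
        rw [LinearEquiv.apply_symm_apply, dot_self_cross])), map_zero,
        LinearEquiv.apply_symm_apply, vres_rfl, cross_single_dot] at h1
      exact h1.symm)
    refine ⟨V, le_rfl, hx, c, alev_ext_of_epi π fun W hW m => ?_⟩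
    rw [resM_rfl, hb, hc, alev_smul, alev_res, hn', vres_smul, smul_dotProduct, vres_vres]
    rfl

/-- In rank one both determinants are duals of sheaves of one-forms. A form on `N` corresponds to a
form on the cokernel of `σ` when they agree on `F.T`; in a local model both generators are given
there by `h`. -/
theorem nonempty_det_iso (hm : HasModels θ) {N : X.Modules} (π : tangentSheaf f ⟶ N) [Epi π]
    (hπ : ∀ (V : X.Opens) m, π.app V m = 0 ↔ θ.app V m = 0) :
    Nonempty (det N 1 ≅ det (Limits.cokernel σ) 1) := by
  suffices h : Nonempty (conormal σ ≅ altSheaf N 1) from h.elim nonempty_dual_iso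
  refine nonempty_iso_of_generators (fun W j n => IsGen (conormal σ) W j ∧ IsGen (altSheaf N 1) W n ∧
    ∀ V (hV : V ≤ W) (t : Γ(F.T, V)), alev n hV (π.app V (F.φ.app V t)) =
      alev j hV ((Limits.cokernel.π σ).app V t)) (fun h => ⟨h.1, h.2.1⟩) (fun h j n hjn =>
      ⟨hjn.1.res h, hjn.2.1.res h, fun V hV t => hjn.2.2 V _ t⟩) (fun x => ?_) ?_
  · obtain ⟨U, e, w, s₀, h, v, j, hxU, hU⟩ := hm x
    obtain ⟨n, hn, hn'⟩ := hU.exists_isGen_normal π hπ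
    refine ⟨U, j, n, hxU, hU.isGen, hn, fun V hV t => ?_⟩
    rw [hn', hU.alev_eq]
    rfl
  · rintro W j₁ n₁ j₂ n₂ ⟨-, -, h1⟩ ⟨-, hn₂, h2⟩
    obtain ⟨c, hc⟩ := hn₂.exists_smul le_rfl n₁
    rw [resM_rfl] at hc
    refine ⟨c, alev_ext_of_epi (Limits.cokernel.π σ) fun V hV t => ?_, hc⟩
    rw [← h1, hc, alev_smul, alev_smul, h2]

end Construction

/-! ### Sheaves of bilinear forms. -/

section Bilinear

variable {X : Scheme.{0}} {U V W : X.Opens}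

/-- `𝒪_X`-bilinear maps `A × B → 𝒪_X`. -/
def biOps (A B : X.Modules) : LocalOps X where
  S V := Γ(A, V) × Γ(B, V)
  res h m := (resM A h m.1, resM B h m.2)
  res_res hWV hVU m := Prod.ext (resM_resM A hWV hVU m.1) (resM_resM B hWV hVU m.2)
  P V :=
    { carrier := {g | (∀ a a' b, g (a + a', b) = g (a, b) + g (a', b)) ∧
        (∀ a b b', g (a, b + b') = g (a, b) + g (a, b')) ∧
        (∀ (c : Γ(X, V)) a b, g (c • a, b) = c * g (a, b)) ∧
        ∀ (c : Γ(X, V)) a b, g (a, c • b) = c * g (a, b)}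
      zero_mem' := by simp
      add_mem' := by
        rintro g g' ⟨h1, h2, h3, h4⟩ ⟨h1', h2', h3', h4'⟩
        refine ⟨fun a a' b => ?_, fun a b b' => ?_, fun c a b => ?_, fun c a b => ?_⟩
        · simp only [Pi.add_apply, h1, h1']; ring
        · simp only [Pi.add_apply, h2, h2']; ring
        · simp only [Pi.add_apply, h3, h3']; ring
        · simp only [Pi.add_apply, h4, h4']; ring
      smul_mem' := by
        rintro r g ⟨h1, h2, h3, h4⟩
        refine ⟨fun a a' b => ?_, fun a b b' => ?_, fun c a b => ?_, fun c a b => ?_⟩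
        · simp only [Pi.smul_apply, smul_eq_mul, h1]; ring
        · simp only [Pi.smul_apply, smul_eq_mul, h2]; ring
        · simp only [Pi.smul_apply, smul_eq_mul, h3]; ring
        · simp only [Pi.smul_apply, smul_eq_mul, h4]; ring }
  isLocal V g H := by
    refine ⟨fun a a' b => ?_, fun a b b' => ?_, fun c a b => ?_, fun c a b => ?_⟩ <;>
    · refine resO_ext fun x hx => ?_
      obtain ⟨W, hW, hxW, h, ⟨h1, h2, h3, h4⟩, he⟩ := H x hx
      refine ⟨W, hW, hxW, ?_⟩
      simp only [map_add, map_mul, he, resM_smul, h1, h2, h3, h4]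

/-- The sheaf of bilinear maps `A × B → 𝒪_X`. -/
def biSheaf (A B : X.Modules) : X.Modules := (biOps A B).sheaf

variable {A B : X.Modules}

/-- The value of a bilinear form. -/
def bev (l : Γ(biSheaf A B, U)) (h : V ≤ U) (a : Γ(A, V)) (b : Γ(B, V)) : Γ(X, V) :=
  LocalOps.Sec.fn (D := biOps A B) l V h (a, b)

theorem bev_smul (c : Γ(X, U)) (l : Γ(biSheaf A B, U)) (h : V ≤ U) (a : Γ(A, V)) (b : Γ(B, V)) :
    bev (c • l) h a b = resO h c * bev l h a b := rfl

theorem bev_zero (h : V ≤ U) (a : Γ(A, V)) (b : Γ(B, V)) :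
    bev (0 : Γ(biSheaf A B, U)) h a b = 0 := rfl

theorem bev_res (hV : V ≤ U) (l : Γ(biSheaf A B, U)) (h : W ≤ V) (a : Γ(A, W)) (b : Γ(B, W)) :
    bev (resM (biSheaf A B) hV l) h a b = bev l (h.trans hV) a b := rfl

theorem bev_ext {l l' : Γ(biSheaf A B, U)} (H : ∀ V (h : V ≤ U) a b, bev l h a b = bev l' h a b) :
    l = l' :=
  LocalOps.Sec.ext (funext fun V => funext fun hV => funext fun m => H V hV m.1 m.2)

theorem resO_bev (l : Γ(biSheaf A B, U)) (h : V ≤ U) (hW : W ≤ V) (a : Γ(A, V)) (b : Γ(B, V)) :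
    resO hW (bev l h a b) = bev l (hW.trans h) (resM A hW a) (resM B hW b) :=
  LocalOps.Sec.compat (D := biOps A B) l hW h (a, b)

theorem bev_add_left (l : Γ(biSheaf A B, U)) (h : V ≤ U) (a a' : Γ(A, V)) (b : Γ(B, V)) :
    bev l h (a + a') b = bev l h a b + bev l h a' b :=
  (LocalOps.Sec.mem (D := biOps A B) l V h).1 a a' b

theorem bev_add_right (l : Γ(biSheaf A B, U)) (h : V ≤ U) (a : Γ(A, V)) (b b' : Γ(B, V)) :
    bev l h a (b + b') = bev l h a b + bev l h a b' :=
  (LocalOps.Sec.mem (D := biOps A B) l V h).2.1 a b b'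

theorem bev_smul_left (l : Γ(biSheaf A B, U)) (h : V ≤ U) (c : Γ(X, V)) (a : Γ(A, V))
    (b : Γ(B, V)) : bev l h (c • a) b = c * bev l h a b :=
  (LocalOps.Sec.mem (D := biOps A B) l V h).2.2.1 c a b

theorem bev_smul_right (l : Γ(biSheaf A B, U)) (h : V ≤ U) (c : Γ(X, V)) (a : Γ(A, V))
    (b : Γ(B, V)) : bev l h a (c • b) = c * bev l h a b :=
  (LocalOps.Sec.mem (D := biOps A B) l V h).2.2.2 c a b

theorem exists_bev (g : ∀ V : X.Opens, V ≤ U → Γ(A, V) → Γ(B, V) → Γ(X, V))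
    (h1 : ∀ V h a a' b, g V h (a + a') b = g V h a b + g V h a' b)
    (h2 : ∀ V h a b b', g V h a (b + b') = g V h a b + g V h a b')
    (h3 : ∀ V h (c : Γ(X, V)) a b, g V h (c • a) b = c * g V h a b)
    (h4 : ∀ V h (c : Γ(X, V)) a b, g V h a (c • b) = c * g V h a b)
    (hres : ∀ {W V : X.Opens} (hW : W ≤ V) (h : V ≤ U) a b,
      resO hW (g V h a b) = g W (hW.trans h) (resM A hW a) (resM B hW b)) :
    ∃ l : Γ(biSheaf A B, U), ∀ V (h : V ≤ U) a b, bev l h a b = g V h a b :=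
  ⟨(show (biOps A B).Sec U from ⟨fun V h m => g V h m.1 m.2,
    fun V h => ⟨h1 V h, h2 V h, h3 V h, h4 V h⟩, fun hW h m => hres hW h m.1 m.2⟩),
    fun _ _ _ _ => rfl⟩

/-- Bilinear forms against a generator. -/
theorem IsGen.exists_bev_eq {g : Γ(B, U)} (hg : IsGen B U g) (l : Γ(altSheaf A 1, U)) :
    ∃ l' : Γ(biSheaf A B, U), ∀ V (h : V ≤ U) a b, bev l' h a b = alev l h a * hg.coef h b :=
  exists_bev (fun V h a b => alev l h a * hg.coef h b)
    (fun V h a a' b => by rw [map_add, add_mul])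
    (fun V h a b b' => by rw [hg.coef_add, mul_add])
    (fun V h c a b => by rw [map_smul, smul_eq_mul, mul_assoc])
    (fun V h c a b => by rw [hg.coef_smul_left]; ring)
    (fun hW h a b => by rw [map_mul, resO_alev, hg.coef_res])

theorem IsGen.bev_eq {g : Γ(B, U)} (hg : IsGen B U g) (l : Γ(biSheaf A B, W)) (hU : V ≤ U)
    (hW : V ≤ W) (a : Γ(A, V)) (b : Γ(B, V)) :
    bev l hW a b = bev l hW a (resM B hU g) * hg.coef hU b := by
  conv_lhs => rw [← hg.coef_smul hU b]
  rw [bev_smul_right, mul_comm]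

theorem exists_alev_bev (l : Γ(biSheaf A B, U)) (b : Γ(B, U)) :
    ∃ l' : Γ(altSheaf A 1, U), ∀ V (h : V ≤ U) a, alev l' h a = bev l h a (resM B h b) :=
  exists_alev (fun V h =>
    { toFun := fun a => bev l h a (resM B h b)
      map_add' := fun a a' => bev_add_left l h a a' _
      map_smul' := fun c a => bev_smul_left l h c a _ })
    (fun {W V} hW h a => by
      change resO hW (bev l h a (resM B h b)) = bev l _ (resM A hW a) (resM B (hW.trans h) b)
      rw [resO_bev, resM_resM])

/-- The restriction of bilinear forms along a morphism. -/
def biPull {A' : X.Modules} (φ : A' ⟶ A) (B : X.Modules) : biSheaf A B ⟶ biSheaf A' B :=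
  homOfApp (fun V (l : Γ(biSheaf A B, V)) => (show (biOps A' B).Sec V from
    { fn := fun W h m => bev l h (φ.app W m.1) m.2
      mem := fun W h => ⟨fun a a' b =>
        (congrArg (fun z => bev l h z b) (map_add (φ.app W).hom a a')).trans (bev_add_left l h _ _ b),
        fun a b b' => bev_add_right _ _ _ _ _,
        fun c a b =>
        (congrArg (fun z => bev l h z b) (Scheme.Modules.Hom.app_smul φ c a)).trans
          (bev_smul_left l h c _ b),
        fun c a b => bev_smul_right _ _ _ _ _⟩
      compat := fun hW h m => by
        rw [resO_bev, resM_app]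
        rfl }))
    (fun V l l' => rfl) (fun V a l => rfl) (fun h l => rfl)

theorem bev_biPull {A' : X.Modules} (φ : A' ⟶ A) (l : Γ(biSheaf A B, U)) (h : V ≤ U)
    (a : Γ(A', V)) (b : Γ(B, V)) : bev ((biPull φ B).app U l) h a b = bev l h (φ.app V a) b := rfl

end Bilinear

/-! ### Restriction of forms from TX to `F.T`: local surjectivity and the kernel. -/

section RestrictionSequence

open Matrix

variable {X : Scheme.{0}} {f : X ⟶ Spec (.of ℂ)} {U V W : X.Opens}
  {F : Distribution f 1} {L : X.Modules} {σ : L ⟶ F.T}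

/-- The restriction of bilinear forms on vector fields and conormal forms to `F.T`. -/
abbrev restrictBi (σ : L ⟶ F.T) : biSheaf (tangentSheaf f) (conormal σ) ⟶ biSheaf F.T (conormal σ) :=
  biPull F.φ (conormal σ)

/-- With a local generator of the conormal sheaf in the second variable, a bilinear form becomes a
linear form on `F.T`, and `FModel.exists_lev_eq` extends it locally to TX. -/
theorem epi_restrictBi [IsIntegral X] [Mono σ]
    (hm : ∀ x : X, ∃ U e w s₀ h v, x ∈ U ∧ GModel σ U e w s₀ h v) : Epi (restrictBi σ) := by
  refine epi_of_local _ fun V p x hx => ?_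
  obtain ⟨U, e, w, s₀, h, v, hxU, hU⟩ := hm x
  obtain ⟨j, hj, -⟩ := hU.exists_isGen_alt
  obtain ⟨b, hb, hxb⟩ := exists_basicOpen_le hU.model.isChart.isAffineOpen hx hxU
  have hne : (X.basicOpen b : Set X).Nonempty := ⟨x, hxb⟩
  have hbU := X.basicOpen_le b
  obtain ⟨l, hl⟩ := exists_lev (M := F.T) (U := X.basicOpen b)
    (fun W hW t => bev p (hW.trans hb) t (resM _ (hW.trans hbU) j))
    (fun W hW t t' => bev_add_left _ _ _ _ _) (fun W hW a t => bev_smul_left _ _ _ _ _)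
    (fun hW hW' t => by rw [resO_bev, resM_resM])
  obtain ⟨c, hc⟩ := (hU.model.basicOpen b hne).exists_lev_eq l
  obtain ⟨l', hl'⟩ := (hU.model.isChart.isBasisOver.res hbU).exists_alev_eq c
  obtain ⟨q, hq⟩ := (hj.res hbU).exists_bev_eq l'
  refine ⟨_, hb, hxb, q, bev_ext fun W hW t k => ?_⟩
  rw [bev_biPull, hq, hl', bev_res, (hj.res hbU).bev_eq p hW (hW.trans hb), resM_resM, ← hl, hc]
  rfl

/-- The bilinear forms that vanish on `F.T`. -/
abbrev vanishing (σ : L ⟶ F.T) : X.Modules := Limits.kernel (restrictBi σ)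

/-- A section of the kernel as a bilinear form. -/
def vev (κ : Γ(vanishing σ, U)) (h : V ≤ U) (m : Γ(tangentSheaf f, V)) (j : Γ(conormal σ, V)) :
    Γ(X, V) := bev ((Limits.kernel.ι (restrictBi σ)).app U κ) h m j

theorem vev_smul (c : Γ(X, U)) (κ : Γ(vanishing σ, U)) (h : V ≤ U) (m : Γ(tangentSheaf f, V))
    (j : Γ(conormal σ, V)) : vev (c • κ) h m j = resO h c * vev κ h m j := by
  rw [vev, Scheme.Modules.Hom.app_smul, bev_smul]
  rfl

theorem vev_res (hV : V ≤ U) (κ : Γ(vanishing σ, U)) (h : W ≤ V) (m : Γ(tangentSheaf f, W))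
    (j : Γ(conormal σ, W)) : vev (resM (vanishing σ) hV κ) h m j = vev κ (h.trans hV) m j := by
  rw [vev, ← resM_app, bev_res]
  rfl

theorem vev_ext {κ κ' : Γ(vanishing σ, U)} (H : ∀ V (h : V ≤ U) m j, vev κ h m j = vev κ' h m j) :
    κ = κ' :=
  app_injective (Limits.kernel.ι (restrictBi σ)) U (bev_ext H)

theorem vev_app (κ : Γ(vanishing σ, U)) (h : V ≤ U) (t : Γ(F.T, V)) (j : Γ(conormal σ, V)) :
    vev κ h (F.φ.app V t) j = 0 := by
  have h1 : (restrictBi σ).app U ((Limits.kernel.ι (restrictBi σ)).app U κ) = 0 := by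
    rw [← app_comp_apply, Limits.kernel.condition]
    rfl
  have h2 := congrArg (fun l => bev l h t j) h1
  exact h2

theorem exists_vev_eq (l : Γ(biSheaf (tangentSheaf f) (conormal σ), U))
    (hl : ∀ V (h : V ≤ U) t j, bev l h (F.φ.app V t) j = 0) :
    ∃ κ : Γ(vanishing σ, U), ∀ V (h : V ≤ U) m j, vev κ h m j = bev l h m j := by
  obtain ⟨κ, hκ⟩ := exists_app_eq (ShortComplex.exact_kernel (restrictBi σ)) U (m := l)
    (bev_ext fun V h t j => hl V h t j)
  exact ⟨κ, fun V h m j => congrArg (fun z => bev z h m j) hκ⟩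

/-- The bilinear forms that vanish on `F.T` are generated by `w`. -/
theorem FModel.exists_isGen_vanishing [IsIntegral X] {e : Fin 3 → Γ(tangentSheaf f, U)} {w : Fin 3 → Γ(X, U)}
    (hU : FModel F U e w) {j : Γ(conormal σ, U)} (hj : IsGen (conormal σ) U j) :
    ∃ κ : Γ(vanishing σ, U), IsGen (vanishing σ) U κ ∧ ∀ V (h : V ≤ U) m k,
      vev κ h m k = (vres h w ⬝ᵥ hU.isChart.isBasisOver.coord h m) * hj.coef h k := by
  have hB := hU.isChart.isBasisOver
  obtain ⟨l, hl⟩ := hB.exists_alev_eq w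
  obtain ⟨q, hq⟩ := hj.exists_bev_eq l
  obtain ⟨κ, hκ⟩ := exists_vev_eq q (fun V h t k => by
    rw [hq, hl]
    exact (congrArg (· * hj.coef h k) (hU.dot_coordT h t)).trans (zero_mul _))
  have hκ' : ∀ V (h : V ≤ U) m k, vev κ h m k = (vres h w ⬝ᵥ hB.coord h m) * hj.coef h k :=
    fun V h m k => by rw [hκ, hq, hl]
  refine ⟨κ, IsGen.of_local (fun V hV c hc => ?_) (fun V hV κ' x hx => ?_), hκ'⟩
  · by_cases hne : (V : Set X).Nonempty
    · have hd := isDomain_section hne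
      obtain ⟨i, hi⟩ := Function.ne_iff.1 (vres_ne_zero hV hne hU.ne_zero)
      have h1 : vev (c • resM (vanishing σ) hV κ) le_rfl ((hB.coord hV).symm (Pi.single i 1))
          (resM _ hV j) = 0 := by
        rw [hc, vev, map_zero, bev_zero]
      rw [vev_smul, vev_res, hκ', resO_rfl, LinearEquiv.apply_symm_apply, dotProduct_single_one,
        hj.coef_self, mul_one] at h1
      exact (mul_eq_zero.1 h1).resolve_right hi
    · have := subsingleton_section hne
      exact Subsingleton.elim _ _
  · obtain ⟨l', hl'⟩ := exists_alev_bev ((Limits.kernel.ι (restrictBi σ)).app V κ') (resM _ hV j)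
    obtain ⟨b, hb⟩ : ∃ b : Fin 3 → Γ(X, V), ∀ W (hW : W ≤ V) m,
        vev κ' hW m (resM _ (hW.trans hV) j) = vres hW b ⬝ᵥ hB.coord (hW.trans hV) m :=
      ⟨_, fun W hW m => by
        rw [← hB.coord_frame_res hV hW, ← (hB.res hV).alev_eq l' hW m, hl', resM_resM]
        rfl⟩
    -- A one-form that vanishes on the tangent vectors `w ⨯₃ eᵢ` is parallel to `w`, hence a
    -- multiple of it.
    obtain ⟨c, hc⟩ := hU.prim V hV b (by
      rw [← cross_anticomm, neg_eq_zero]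
      funext i
      obtain ⟨t, ht⟩ := hU.exists_coordT_eq hV (m := vres hV w ⨯₃ Pi.single i 1)
        (dot_self_cross _ _)
      have h1 := hb V le_rfl (F.φ.app V t)
      rw [vev_app, ← FModel.coordT_apply hU, ht, vres_rfl, cross_single_dot] at h1
      exact h1.symm)
    refine ⟨V, le_rfl, hx, c, vev_ext fun W hW m k => ?_⟩
    rw [resM_rfl, vev_smul, vev_res, hκ', vev, hj.bev_eq _ (hW.trans hV) hW]
    have h2 := hb W hW m
    rw [vev, hc, vres_smul, smul_dotProduct, vres_vres, smul_eq_mul] at h2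
    rw [h2, mul_assoc]

end RestrictionSequence

/-! ### Generators of duals and of top exterior powers. -/

section DualGenerators

variable {X : Scheme.{0}} {U V W : X.Opens} {M : X.Modules}

/-- The generator of the dual of an invertible sheaf. -/
theorem IsGen.exists_dual_gen {g : Γ(M, U)} (hg : IsGen M U g) :
    ∃ l : Γ(dual M, U), IsGen (dual M) U l ∧ lev l le_rfl g = 1 := by
  obtain ⟨l, hl⟩ := exists_lev (M := M) (U := U) (fun V h m => hg.coef h m)
    (fun V h => hg.coef_add h) (fun V h => hg.coef_smul_left h) (fun hW h m => (hg.coef_res h hW m).symm)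
  have hl1 : ∀ V (h : V ≤ U), lev l h (resM M h g) = 1 := fun V h => by rw [hl, hg.coef_self]
  refine ⟨l, fun V h => ⟨fun c d hcd => ?_, fun l' => ⟨lev l' le_rfl (resM M h g), ?_⟩⟩,
    by simpa only [resM_rfl] using hl1 U le_rfl⟩
  · have h1 := congrArg (fun l => lev l le_rfl (resM M h g)) hcd
    simpa only [lev_smul, lev_res, hl1, mul_one, resO_rfl] using h1
  · refine lev_ext fun W hW m => ?_
    rw [lev_smul, lev_res, hl, resO_lev, resM_resM]
    conv_rhs => rw [← hg.coef_smul (hW.trans h) m, lev_map_smul]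
    exact mul_comm _ _

theorem IsGen.eq_smul_dual {g g' : Γ(M, U)} {l l' : Γ(dual M, U)} (hl : IsGen (dual M) U l)
    (h1 : lev l le_rfl g = 1) (h1' : lev l' le_rfl g' = 1) {a : Γ(X, U)} (ha : g = a • g') :
    l' = a • l := by
  obtain ⟨c, hc⟩ := hl.exists_smul le_rfl l'
  rw [resM_rfl] at hc
  subst hc
  rw [lev_smul, resO_rfl] at h1'
  rw [ha, lev_map_smul] at h1
  congr 1
  rw [← mul_one c, ← h1, mul_left_comm, h1', mul_one]

/-- The determinant generates the top exterior power of the dual of a free sheaf. -/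
theorem IsBasisOver.exists_isGen_det {e : Fin 3 → Γ(M, U)} (he : IsBasisOver M U e) :
    ∃ D : Γ(altSheaf M 3, U), IsGen (altSheaf M 3) U D ∧
      (∀ V (h : V ≤ U) η, aev D h η = Matrix.det (Matrix.of fun i => he.coord h (η i))) ∧
      ∀ V (h : V ≤ U), aev D h (fun i => resM M h (e i)) = 1 := by
  obtain ⟨D, hD⟩ := exists_aev (M := M) (r := 3) (U := U)
    (fun V h => (Matrix.detRowAlternating (R := Γ(X, V))).compLinearMap (he.coord h).toLinearMap)
    (fun {W V} hW h η => by
      change resO hW (Matrix.det (Matrix.of fun i => he.coord h (η i))) =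
        Matrix.det (Matrix.of fun i => he.coord _ (resM M hW (η i)))
      rw [RingHom.map_det]
      refine congrArg Matrix.det (Matrix.ext fun i k => ?_)
      exact (congrFun (he.coord_res h hW (η i)) k).symm)
  have hD' : ∀ V (h : V ≤ U) η, aev D h η = Matrix.det (Matrix.of fun i => he.coord h (η i)) := hD
  have h1 : ∀ V (h : V ≤ U), aev D h (fun i => resM M h (e i)) = 1 := fun V h => by
    rw [hD', ← Matrix.det_one (n := Fin 3)]
    refine congrArg Matrix.det (Matrix.ext fun i k => ?_)
    rw [Matrix.of_apply, he.coord_basis, Matrix.one_apply, Pi.single_apply]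
    simp only [eq_comm]
  refine ⟨D, fun V h => ⟨fun c d hcd => ?_, fun D' => ⟨aev D' le_rfl fun i => resM M h (e i), ?_⟩⟩, hD', h1⟩
  · have h2 := congrArg (fun l => aev l le_rfl fun i => resM M h (e i)) hcd
    simpa only [aev_smul, aev_res, h1, mul_one, resO_rfl] using h2
  · refine aev_ext fun W hW η => ?_
    let b := Module.Basis.ofEquivFun (he.coord (hW.trans h))
    have hb : ∀ i, b i = resM M (hW.trans h) (e i) := fun i => by
      rw [Module.Basis.coe_ofEquivFun, LinearEquiv.symm_apply_eq, he.coord_basis]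
    have hdet : ∀ (A : Γ(M, W) [⋀^Fin 3]→ₗ[Γ(X, W)] Γ(X, W)), A η = A b * b.det η := fun A => by
      conv_lhs => rw [A.eq_smul_basis_det b]
      rfl
    have e1 := hdet (aevₗ D' hW)
    have e2 := hdet (aevₗ D (hW.trans h))
    have hb' : (b : Fin 3 → Γ(M, W)) = fun i => resM M (hW.trans h) (e i) := funext hb
    rw [aevₗ_apply, aevₗ_apply, hb'] at e1 e2
    rw [h1, one_mul] at e2
    rw [aev_smul, aev_res, e1, e2, resO_aev]
    simp only [resM_resM]

end DualGenerators

/-! ### Identification of the kernel of restriction with the line bundle of the hypothesis. -/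

section Kernel

open Matrix

variable {X : Scheme.{0}} {f : X ⟶ Spec (.of ℂ)} {U V W : X.Opens}
  {e : Fin 3 → Γ(tangentSheaf f, U)} {w : Fin 3 → Γ(X, U)}
  {F : Distribution f 1} {L : X.Modules} {σ : L ⟶ F.T}

theorem cross_single_cross_dot {R : Type} [CommRing R] (x y w : Fin 3 → R) (k : Fin 3) :
    ((x ⨯₃ Pi.single k 1) ⨯₃ (y ⨯₃ Pi.single k 1)) ⬝ᵥ w = (x ⨯₃ y) k * w k := by
  rw [vec3_dotProduct]
  fin_cases k <;> simp [cross_apply] <;> ring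

theorem cross_cross_of_dot {R : Type} [CommRing R] {w t : Fin 3 → R} (ht : w ⬝ᵥ t = 0)
    (h : Fin 3 → R) : (h ⨯₃ w) ⨯₃ t = (h ⬝ᵥ t) • w := by
  rw [vec3_dotProduct] at ht
  ext i
  fin_cases i <;> simp [cross_apply, vec3_dotProduct]
  · linear_combination (-h 0) * ht
  · linear_combination (-h 1) * ht
  · linear_combination (-h 2) * ht

theorem det_of_dotProduct {R : Type} [CommRing R] (a : Fin 3 → Fin 3 → R) (x y z : Fin 3 → R) :
    Matrix.det (Matrix.of fun i k => a i ⬝ᵥ ![x, y, z] k) =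
      Matrix.det (Matrix.of a) * ((x ⨯₃ y) ⬝ᵥ z) := by
  have h1 : (Matrix.of fun i k => a i ⬝ᵥ ![x, y, z] k) =
      Matrix.of a * (Matrix.of ![x, y, z])ᵀ := rfl
  rw [h1, Matrix.det_mul, Matrix.det_transpose]
  congr 1
  rw [vec3_dotProduct]
  simp [Matrix.det_fin_three, cross_apply]
  ring

theorem FModel.smul_injective [IsIntegral X] (hU : FModel F U e w) (h : V ≤ U) {c d : Γ(X, V)}
    (hcd : c • vres h w = d • vres h w) : c = d := by
  by_cases hne : (V : Set X).Nonempty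
  · have := isDomain_section hne
    obtain ⟨i, hi⟩ := Function.ne_iff.1 (vres_ne_zero h hne hU.ne_zero)
    exact mul_right_cancel₀ hi (congrFun hcd i)
  · have := subsingleton_section hne
    exact Subsingleton.elim _ _

/-- The vectors `w ⨯₃ eᵢ` are tangent to `F`. -/
theorem FModel.exists_coordT_cross (hU : FModel F U e w) :
    ∃ τ : Fin 3 → Γ(F.T, U), ∀ i V (h : V ≤ U),
      hU.coordT h (resM F.T h (τ i)) = vres h w ⨯₃ Pi.single i 1 := by
  choose τ hτ using fun i : Fin 3 => hU.exists_coordT_eq le_rfl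
    (m := w ⨯₃ Pi.single i 1) (by rw [vres_rfl, dot_self_cross])
  exact ⟨τ, fun i V h => by rw [← hU.coordT_res le_rfl h, hτ, vres_cross, vres_single]⟩

theorem FModel.smul_eq_sum (hU : FModel F U e w) {τ : Fin 3 → Γ(F.T, U)}
    (hτ : ∀ i V (h : V ≤ U), hU.coordT h (resM F.T h (τ i)) = vres h w ⨯₃ Pi.single i 1)
    (h : V ≤ U) (k : Fin 3) (t : Γ(F.T, V)) :
    vres h w k • t = ∑ i, (hU.coordT h t ⨯₃ Pi.single k 1) i • resM F.T h (τ i) := by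
  refine hU.coordT_injective h ?_
  rw [map_smul, smul_eq_cross _ _ _ (hU.dot_coordT h t), map_sum]
  simp only [map_smul, hτ]
  generalize hU.coordT h t ⨯₃ Pi.single k 1 = a
  simp only [← map_smul, ← map_sum]
  congr 1
  ext i
  simp [Finset.sum_apply, Pi.single_apply]

/-- The product of `w ⨯₃ eᵢ₊₁` and `w ⨯₃ eᵢ₊₂`, with indices modulo three, is `w i • w`. -/
theorem FModel.area_cross [IsIntegral X] (hU : FModel F U e w) {τ : Fin 3 → Γ(F.T, U)}
    {ω : Γ(altSheaf F.T 2, U)} (hω : ∀ V (h : V ≤ U) t,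
      hU.coordT h (t 0) ⨯₃ hU.coordT h (t 1) = aev ω h t • vres h w)
    (hτ : ∀ i V (h : V ≤ U), hU.coordT h (resM F.T h (τ i)) = vres h w ⨯₃ Pi.single i 1)
    (h : V ≤ U) (i : Fin 3) :
    aev ω h ![resM F.T h (τ (i + 1)), resM F.T h (τ (i + 2))] = vres h w i := by
  refine hU.smul_injective h ?_
  rw [← hω]
  change hU.coordT h (resM F.T h (τ (i + 1))) ⨯₃ hU.coordT h (resM F.T h (τ (i + 2))) = _
  rw [hτ, hτ]
  generalize vres h w = w'
  fin_cases i <;> ext k <;> fin_cases k <;> simp [cross_apply] <;> ring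

/-- The two-form on `F.T` given by the cross product. -/
theorem FModel.exists_isGen_area [IsIntegral X] (hU : FModel F U e w) :
    ∃ ω : Γ(altSheaf F.T 2, U), IsGen (altSheaf F.T 2) U ω ∧ ∀ V (h : V ≤ U) t,
      hU.coordT h (t 0) ⨯₃ hU.coordT h (t 1) = aev ω h t • vres h w := by
  have huniq : ∀ V (h : V ≤ U) (c d : Γ(X, V)), c • vres h w = d • vres h w → c = d :=
    fun V h c d hcd => hU.smul_injective h hcd
  have hex : ∀ V (h : V ≤ U) (t t' : Γ(F.T, V)), ∃ c : Γ(X, V),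
      hU.coordT h t ⨯₃ hU.coordT h t' = c • vres h w := fun V h t t' =>
    hU.prim V h _ (cross_cross_perp (hU.dot_coordT h t) (hU.dot_coordT h t'))
  choose c hc using hex
  have hcross_add : ∀ {V : X.Opens} (x y z : Fin 3 → Γ(X, V)), (x + y) ⨯₃ z = x ⨯₃ z + y ⨯₃ z :=
    fun x y z => LinearMap.map_add₂ _ x y z
  have hcross_smul : ∀ {V : X.Opens} (a : Γ(X, V)) (x z : Fin 3 → Γ(X, V)),
      (a • x) ⨯₃ z = a • (x ⨯₃ z) := fun a x z => LinearMap.map_smul₂ _ a x z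
  have hadd : ∀ V (h : V ≤ U) t t' t'', c V h (t + t') t'' = c V h t t'' + c V h t' t'' :=
    fun V h t t' t'' => huniq V h _ _ (by
      rw [add_smul, ← hc, ← hc, ← hc, (hU.coordT h).map_add, hcross_add])
  have hsmul : ∀ V (h : V ≤ U) a t t', c V h (a • t) t' = a * c V h t t' :=
    fun V h a t t' => huniq V h _ _ (by
      rw [mul_smul, ← hc, ← hc, (hU.coordT h).map_smul, hcross_smul])
  have hswap : ∀ V (h : V ≤ U) t t', c V h t t' = - c V h t' t :=
    fun V h t t' => huniq V h _ _ (by rw [neg_smul, ← hc, ← hc, cross_anticomm])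
  have hres : ∀ {W V : X.Opens} (hW : W ≤ V) (h : V ≤ U) t t',
      resO hW (c V h t t') = c W (hW.trans h) (resM F.T hW t) (resM F.T hW t') :=
    fun {W V} hW h t t' => huniq W (hW.trans h) _ _ (by
      rw [← hc, ← hU.coordT_res h hW, ← hU.coordT_res h hW, ← vres_cross, hc, vres_smul, vres_vres])
  have hself : ∀ V (h : V ≤ U) t, c V h t t = 0 := fun V h t => huniq V h _ _ (by
    rw [← hc, cross_self, zero_smul])
  obtain ⟨ω, hω⟩ := exists_aev (M := F.T) (r := 2) (U := U)
    (fun V h => altOfBilin (LinearMap.mk₂ Γ(X, V) (c V h) (hadd V h) (hsmul V h)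
      (fun t t' t'' => by rw [hswap, hadd, hswap V h t' t, hswap V h t'' t, neg_add, neg_neg, neg_neg])
      (fun a t t' => by rw [hswap, hsmul, hswap V h t' t, smul_eq_mul, mul_neg, neg_neg]))
      (hself V h))
    (fun hW h t => hres hW h (t 0) (t 1))
  have hω' : ∀ V (h : V ≤ U) t,
      hU.coordT h (t 0) ⨯₃ hU.coordT h (t 1) = aev ω h t • vres h w := fun V h t => by
    rw [hω, hc]
    rfl
  refine ⟨ω, ?_, hω'⟩
  obtain ⟨τ, hτ⟩ := hU.exists_coordT_cross
  have harea := fun V (h : V ≤ U) i => hU.area_cross hω' hτ h i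
  refine fun V h => ⟨fun a b hab => huniq V h _ _ (funext fun i => ?_), fun ω' => ?_⟩
  · have h1 := congrArg
      (fun l => aev l le_rfl ![resM F.T h (τ (i + 1)), resM F.T h (τ (i + 2))]) hab
    rw [aev_smul, aev_smul, aev_res, harea, resO_rfl, resO_rfl] at h1
    exact h1
  -- A two-form on `F.T` is determined by its values `u` on pairs of the `τ i`. The relation `∑ w k
  -- • τ k = 0` makes `u` parallel to `w`, and the factor is the coefficient with respect to `ω`.
  · let u : Fin 3 → Γ(X, V) := fun i =>
      aev ω' le_rfl ![resM F.T h (τ (i + 1)), resM F.T h (τ (i + 2))]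
    have hu : ∀ W (hW : W ≤ V) (a b : Fin 3 → Γ(X, W)),
        altBilin (aevₗ ω' hW) (∑ i, a i • resM F.T (hW.trans h) (τ i))
          (∑ i, b i • resM F.T (hW.trans h) (τ i)) = (a ⨯₃ b) ⬝ᵥ vres hW u := by
      intro W hW a b
      have h1 : ∀ i, vres hW u i = altBilin (aevₗ ω' hW) (resM F.T (hW.trans h) (τ (i + 1)))
          (resM F.T (hW.trans h) (τ (i + 2))) := by
        intro i
        rw [vres_apply, altBilin_apply, aevₗ_apply]
        refine (resO_aev _ _ _ _).trans (congrArg _ (funext fun k => ?_))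
        fin_cases k <;> exact resM_resM _ _ _ _
      rw [altBilin_sum, vec3_dotProduct, h1, h1, h1]
      rfl
    obtain ⟨c, hc⟩ := hU.prim V h u (by
      rw [← cross_anticomm, neg_eq_zero]
      funext i
      have h1 : ∑ k, vres h w k • resM F.T h (τ k) = 0 := by
        refine hU.coordT_injective h ?_
        rw [map_zero, map_sum, ← cross_self (vres h w)]
        simp only [map_smul, hτ]
        simp only [← map_smul, ← map_sum]
        congr 1
        ext i
        simp [Finset.sum_apply, Pi.single_apply]
      have h2 := hu V le_rfl (vres h w) (Pi.single i 1)
      rw [h1, map_zero, LinearMap.zero_apply, vres_rfl, dotProduct_comm, cross_single_dot] at h2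
      exact h2.symm)
    refine ⟨c, aev_ext fun W hW t => ?_⟩
    rw [aev_smul, aev_res]
    by_cases hne : (W : Set X).Nonempty
    · have := isDomain_section hne
      obtain ⟨k, hk⟩ := Function.ne_iff.1 (vres_ne_zero (hW.trans h) hne hU.ne_zero)
      have h1 := hu W hW (hU.coordT (hW.trans h) (t 0) ⨯₃ Pi.single k 1)
        (hU.coordT (hW.trans h) (t 1) ⨯₃ Pi.single k 1)
      have h2 := hω' W (hW.trans h) t
      have ht : t = ![t 0, t 1] := by
        ext i
        fin_cases i <;> rfl
      rw [← hU.smul_eq_sum hτ, ← hU.smul_eq_sum hτ, map_smul, map_smul, LinearMap.smul_apply,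
        altBilin_apply, aevₗ_apply, ← ht, hc, vres_smul, vres_vres, dotProduct_smul,
        cross_single_cross_dot, h2] at h1
      simp only [smul_eq_mul, Pi.smul_apply] at h1
      refine mul_left_cancel₀ hk (mul_left_cancel₀ hk ?_)
      rw [h1]
      ring
    · have := subsingleton_section hne
      exact Subsingleton.elim _ _

/-- Compatible generators of the kernel of the restriction of bilinear forms, of `L`, of
`det F.T` and of the determinant of the one-forms. -/
structure KModel (σ : L ⟶ F.T) (U : X.Opens) (κ : Γ(vanishing σ, U)) (s : Γ(L, U))
    (D : Γ(altSheaf (altSheaf (tangentSheaf f) 1) 3, U)) (ω : Γ(altSheaf F.T 2, U)) : Prop where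
  genK : IsGen (vanishing σ) U κ
  genL : IsGen L U s
  genD : IsGen (altSheaf (altSheaf (tangentSheaf f) 1) 3) U D
  genω : IsGen (altSheaf F.T 2) U ω
  eq : ∀ V (h : V ≤ U) m j (t t' t'' : Γ(F.T, V)) (η : Fin 3 → Γ(altSheaf (tangentSheaf f) 1, V)),
    vev κ h m j * (aev ω h ![t, t'] * aev ω h ![σ.app V (resM L h s), t''] * aev D h η) =
      alev j le_rfl ((Limits.cokernel.π σ).app V t'') *
        Matrix.det (Matrix.of fun i k => alev (η i) le_rfl (![F.φ.app V t, F.φ.app V t', m] k))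
  ne_zero : ∀ V (h : V ≤ U), (V : Set X).Nonempty → ∃ t t' t'' η,
    aev ω h ![t, t'] * aev ω h ![σ.app V (resM L h s), t''] * aev D h η ≠ 0

theorem KModel.res {κ : Γ(vanishing σ, U)} {s : Γ(L, U)}
    {D : Γ(altSheaf (altSheaf (tangentSheaf f) 1) 3, U)} {ω : Γ(altSheaf F.T 2, U)} (hU : KModel σ U κ s D ω)
    (h : V ≤ U) : KModel σ V (resM _ h κ) (resM _ h s) (resM _ h D) (resM _ h ω) where
  genK := hU.genK.res h
  genL := hU.genL.res h
  genD := hU.genD.res h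
  genω := hU.genω.res h
  eq W hW m j t t' t'' η := by
    rw [vev_res, aev_res, aev_res, aev_res, resM_resM]
    exact hU.eq W _ m j t t' t'' η
  ne_zero W hW hne := by
    rw [resM_resM]
    exact hU.ne_zero W (hW.trans h) hne

/-- The defining equation of a `KModel` is a product of local formulas: `κ` is `w` times the
coefficient of `j`, the area form pairs the vector of `σ` with `t''` to give `h ⬝ᵥ t''`, and the
determinant of the pairings equals `D(η)` times the triple product of the vectors of `t`, `t'` and
`m`. -/
theorem GModel.exists_kmodel [IsIntegral X] [Mono σ] {s₀ : Γ(L, U)} {h v : Fin 3 → Γ(X, U)}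
    (hU : GModel σ U e w s₀ h v) : ∃ κ D ω, KModel σ U κ s₀ D ω := by
  obtain ⟨j₀, hj₀, hj₀'⟩ := hU.exists_isGen_alt
  obtain ⟨κ, hκ, hκ'⟩ := hU.model.exists_isGen_vanishing hj₀
  obtain ⟨ω, hω, hω'⟩ := hU.model.exists_isGen_area
  have hB := hU.model.isChart.isBasisOver
  obtain ⟨ε, hε, hε'⟩ := hB.exists_dual
  obtain ⟨D, hD, hD', hD1⟩ := hε.exists_isGen_det
  have hcoord : ∀ V (hV : V ≤ U) (η : Γ(altSheaf (tangentSheaf f) 1, V)) (m : Γ(tangentSheaf f, V)),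
      alev η le_rfl m = hε.coord hV η ⬝ᵥ hB.coord hV m := by
    intro V hV η m
    conv_lhs => rw [← (hε.coord hV).symm_apply_apply η, hε.coord_symm_apply]
    simp only [Fin.sum_univ_three, alev_add, alev_smul, alev_res, hε', vec3_dotProduct, resO_rfl]
  -- For `t` orthogonal to `w` one has `(h ⨯₃ w) ⨯₃ t = (h ⬝ᵥ t) • w`, and the coefficient of `w` is
  -- unique.
  have hs : ∀ V (hV : V ≤ U) (t : Γ(F.T, V)), aev ω hV ![σ.app V (resM L hV s₀), t] =
      vres hV h ⬝ᵥ hU.model.coordT hV t := by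
    intro V hV t
    refine hU.model.smul_injective hV ((hω' V hV _).symm.trans ?_)
    change hU.model.coordT hV (σ.app V (resM L hV s₀)) ⨯₃ hU.model.coordT hV t = _
    have h1 := hU.coordT_eq' hV 1
    rw [one_smul, one_smul] at h1
    have h2 := congrArg (vres hV) hU.eq_cross
    rw [h1, h2, vres_cross, cross_cross_of_dot (hU.model.dot_coordT hV t)]
  refine ⟨κ, D, ω, hκ, hU.isGen, hD, hω, fun V hV m j t t' t'' η => ?_, fun V hV hne => ?_⟩
  · have hdet : Matrix.det (Matrix.of fun i k =>
        alev (η i) le_rfl (![F.φ.app V t, F.φ.app V t', m] k)) = aev D hV η *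
          (aev ω hV ![t, t'] * (vres hV w ⬝ᵥ hB.coord hV m)) := by
      have h1 : (hU.model.coordT hV t ⨯₃ hU.model.coordT hV t') ⬝ᵥ hB.coord hV m =
          aev ω hV ![t, t'] * (vres hV w ⬝ᵥ hB.coord hV m) := by
        rw [← smul_eq_mul, ← smul_dotProduct, ← hω']
        rfl
      rw [← h1, hD', ← det_of_dotProduct]
      refine congrArg Matrix.det (Matrix.ext fun i k => ?_)
      rw [Matrix.of_apply, Matrix.of_apply, hcoord V hV]
      fin_cases k <;> rfl
    have hj : alev j le_rfl ((Limits.cokernel.π σ).app V t'') =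
        hj₀.coef hV j * (vres hV h ⬝ᵥ hU.model.coordT hV t'') := by
      conv_lhs => rw [← hj₀.coef_smul hV j]
      rw [alev_smul, alev_res, hj₀', resO_rfl]
    rw [hκ', hs, hdet, hj]
    ring
  · have := isDomain_section hne
    obtain ⟨i, hi⟩ := Function.ne_iff.1 (vres_ne_zero hV hne hU.model.ne_zero)
    obtain ⟨k, hk⟩ := Function.ne_iff.1 (vres_ne_zero hV hne hU.v_ne_zero)
    obtain ⟨τ, hτ⟩ := hU.model.exists_coordT_cross
    refine ⟨_, _, resM F.T hV (τ k), fun i => resM _ hV (ε i),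
      mul_ne_zero (mul_ne_zero ((hU.model.area_cross hω' hτ hV i).trans_ne hi) ?_) ?_⟩
    · have h2 := congrArg (vres hV) hU.eq_cross
      rw [hs, hτ, cross_single_dot, ← vres_cross, ← h2]
      exact hk
    · rw [hD1]
      exact one_ne_zero

/-- The kernel of the restriction of bilinear forms. -/
theorem nonempty_vanishing_iso [IsIntegral X] [Mono σ]
    (hm : ∀ x : X, ∃ U e w s₀ h v, x ∈ U ∧ GModel σ U e w s₀ h v) :
    Nonempty (vanishing σ ≅
      tensor (tensor (dual L) (det (formSheaf f 1) 3)) (tensor (det F.T 2) (det F.T 2))) := by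
  refine nonempty_iso_of_generators (M := vanishing σ)
    (N := tensor (tensor (dual L) (dual (altSheaf (altSheaf (tangentSheaf f) 1) 3)))
      (tensor (dual (altSheaf F.T 2)) (dual (altSheaf F.T 2))))
    (fun W κ g => ∃ s D ω l δ ρ, KModel σ W κ s D ω ∧
      IsGen (dual L) W l ∧ lev l le_rfl s = 1 ∧
      IsGen (dual (altSheaf (altSheaf (tangentSheaf f) 1) 3)) W δ ∧ lev δ le_rfl D = 1 ∧
      IsGen (dual (altSheaf F.T 2)) W ρ ∧ lev ρ le_rfl ω = 1 ∧ g = tmul (tmul l δ) (tmul ρ ρ))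
    ?_ ?_ (fun x => ?_) ?_
  · rintro W κ g ⟨s, D, ω, l, δ, ρ, hW, hl, -, hδ, -, hρ, -, rfl⟩
    exact ⟨hW.genK, (hl.tmul hδ).tmul (hρ.tmul hρ)⟩
  · rintro W W' h κ g ⟨s, D, ω, l, δ, ρ, hW, hl, h1, hδ, h2, hρ, h3, rfl⟩
    refine ⟨_, _, _, _, _, _, hW.res h, hl.res h, ?_, hδ.res h, ?_, hρ.res h, ?_, ?_⟩
    · rw [lev_res, ← resO_lev l le_rfl, h1, map_one]
    · rw [lev_res, ← resO_lev δ le_rfl, h2, map_one]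
    · rw [lev_res, ← resO_lev ρ le_rfl, h3, map_one]
    · rw [resM_tmul, resM_tmul, resM_tmul]
  · obtain ⟨U, e, w, s₀, h, v, hxU, hU⟩ := hm x
    obtain ⟨κ, D, ω, hκ⟩ := hU.exists_kmodel
    obtain ⟨l, hl, h1⟩ := hκ.genL.exists_dual_gen
    obtain ⟨δ, hδ, h2⟩ := hκ.genD.exists_dual_gen
    obtain ⟨ρ, hρ, h3⟩ := hκ.genω.exists_dual_gen
    exact ⟨U, κ, _, hxU, s₀, D, ω, l, δ, ρ, hκ, hl, h1, hδ, h2, hρ, h3, rfl⟩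
  · rintro W κ g κ' g' ⟨s, D, ω, l, δ, ρ, hW, hl, h1, hδ, h2, hρ, h3, rfl⟩
      ⟨s', D', ω', l', δ', ρ', hW', hl', h1', hδ', h2', hρ', h3', rfl⟩
    obtain ⟨a, ha⟩ := hW.genL.exists_smul le_rfl s'
    obtain ⟨b, hb⟩ := hW.genD.exists_smul le_rfl D'
    obtain ⟨c, hc⟩ := hW.genω.exists_smul le_rfl ω'
    rw [resM_rfl] at ha hb hc
    -- The right side of `KModel.eq` does not involve the chosen generators. Rescaling `s`, `D`, `ω`
    -- by `a`, `b`, `c` therefore divides `κ` by `a * b * c * c`, with `c` twice because `ω` occurs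
    -- twice; dual generators scale in the same inverse manner.
    refine ⟨a * b * c * c, vev_ext fun V hV m j => ?_, ?_⟩
    · by_cases hne : (V : Set X).Nonempty
      · have := isDomain_section hne
        obtain ⟨t, t', t'', η, hN⟩ := hW.ne_zero V hV hne
        refine mul_right_cancel₀ hN ?_
        rw [hW.eq, ← hW'.eq V hV, vev_smul]
        subst ha hb hc
        have h4 : aev ω hV ![σ.app V (resM L hV (a • s)), t''] =
            resO hV a * aev ω hV ![σ.app V (resM L hV s), t''] := by
          rw [resM_smul, Scheme.Modules.Hom.app_smul]
          exact LinearMap.map_smul₂ (altBilin (aevₗ ω hV)) _ _ _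
        simp only [aev_smul, h4, map_mul]
        ring
      · have := subsingleton_section hne
        exact Subsingleton.elim _ _
    · rw [hl'.eq_smul_dual h1' h1 ha, hδ'.eq_smul_dual h2' h2 hb, hρ'.eq_smul_dual h3' h3 hc]
      simp only [smul_tmul, tmul_smul, smul_smul]
      congr 1
      ring

end Kernel

/-! ### Lifting global sections when the first cohomology of the kernel vanishes. -/

section Cohomology

variable {X : Scheme.{0}}

/-- The underlying sheaf of abelian groups. -/
def toAbSheaf (X : Scheme.{0}) :
    X.Modules ⥤ Sheaf (Opens.grothendieckTopology X) AddCommGrpCat.{0} :=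
  SheafOfModules.toSheaf X.ringCatSheaf

instance : (toAbSheaf X).PreservesZeroMorphisms where
  map_zero _ _ := rfl

instance : Limits.PreservesFiniteLimits (toAbSheaf X) :=
  inferInstanceAs (Limits.PreservesFiniteLimits (SheafOfModules.toSheaf X.ringCatSheaf))

theorem epi_toAbSheaf_map {M N : X.Modules} (φ : M ⟶ N) [Epi φ] : Epi ((toAbSheaf X).map φ) := by
  refine (TopCat.Sheaf.isLocallySurjective_iff_epi _).1
    ((TopCat.Presheaf.isLocallySurjective_iff _).2 fun V n x hx => ?_)
  obtain ⟨W, hW, hxW, m, hm⟩ := exists_app_eq_of_epi φ n x hx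
  exact ⟨W, hW, ⟨m, hm⟩, hxW⟩

theorem shortExact_toAbSheaf_kernel {M N : X.Modules} (φ : M ⟶ N) [Epi φ] :
    ((ShortComplex.mk _ φ (Limits.kernel.condition φ)).map (toAbSheaf X)).ShortExact where
  exact := (ShortComplex.exact_kernel φ).map_of_mono_of_preservesKernel
    (toAbSheaf X) inferInstance inferInstance
  mono_f := inferInstanceAs (Mono ((toAbSheaf X).map (Limits.kernel.ι φ)))
  epi_g := epi_toAbSheaf_map φ

theorem subsingleton_cohomology_of_iso {M N : X.Modules} (i : M ≅ N) (n : ℕ)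
    (h : Subsingleton (cohomology N n)) : Subsingleton (cohomology M n) := by
  let j := (toAbSheaf X).mapIso i
  have : Function.Injective (Sheaf.H.map j.hom n) := by
    refine Function.LeftInverse.injective (g := Sheaf.H.map j.inv n) fun x => ?_
    rw [← Sheaf.H.map_comp_apply, j.hom_inv_id, Sheaf.H.map_id_apply]
  have h : Subsingleton (Sheaf.H ((toAbSheaf X).obj N) n) := h
  exact this.subsingleton

/-- Sections over a terminal object lift along an epimorphism whose kernel has no first
cohomology. -/
theorem surjective_of_subsingleton_H {S : ShortComplex (Sheaf (Opens.grothendieckTopology X)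
    AddCommGrpCat.{0})} (hS : S.ShortExact) (h : Subsingleton (Sheaf.H S.X₁ 1)) {T : X.Opens}
    (hT : Limits.IsTerminal T) : Function.Surjective (S.g.hom.app (op T)) := by
  intro n
  -- Global sections are the cohomology of degree zero, and the obstruction to lifting lies in the
  -- vanishing group of degree one.
  obtain ⟨x, hx⟩ := Abelian.Ext.covariant_sequence_exact₃ _ hS
    ((Sheaf.H.equiv₀ S.X₃ hT).symm n) (zero_add 1) (Subsingleton.elim _ _)
  refine ⟨Sheaf.H.equiv₀ S.X₂ hT x, (Sheaf.H.equiv₀_naturality (hT := hT) S.g x).trans ?_⟩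
  rw [Sheaf.H.map_apply, hx, AddEquiv.apply_symm_apply]

theorem surjective_app_top {M N : X.Modules} (φ : M ⟶ N) [Epi φ]
    (h : Subsingleton (cohomology (Limits.kernel φ) 1)) : Function.Surjective (φ.app ⊤) :=
  surjective_of_subsingleton_H (shortExact_toAbSheaf_kernel φ) h
    (Limits.IsTerminal.ofUniqueHom (fun _ => homOfLE le_top) fun _ _ => rfl)

end Cohomology

/-! ### Existence of the extension `θ`. -/

section Extension

variable {X : Scheme.{0}} {f : X ⟶ Spec (.of ℂ)} {F : Distribution f 1} {L : X.Modules}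
  {σ : L ⟶ F.T}

/-- The pairing of `F.T` with forms on the cokernel of `σ` is a global section of the target of
`restrictBi σ`. It lifts to TX because the kernel has no first cohomology, and the lifted bilinear
form is read as a map into the dual. -/
theorem exists_isExtension [Epi (restrictBi σ)] (h : Subsingleton (cohomology (vanishing σ) 1)) :
    ∃ θ : tangentSheaf f ⟶ dual (conormal σ), IsExtension θ := by
  obtain ⟨p, hp⟩ := exists_bev (A := F.T) (B := conormal σ) (U := ⊤)
    (fun V _ t j => alev j le_rfl ((Limits.cokernel.π σ).app V t))
    (fun V _ t t' j => by rw [map_add, map_add])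
    (fun V _ t j j' => alev_add _ _ _ _)
    (fun V _ c t j => by rw [Scheme.Modules.Hom.app_smul, map_smul, smul_eq_mul])
    (fun V _ c t j => by rw [alev_smul, resO_rfl])
    (fun hW _ t j => by rw [resO_alev, resM_app, alev_res])
  obtain ⟨l, hl⟩ := surjective_app_top (restrictBi σ) h p
  have hl' : ∀ V (t : Γ(F.T, V)) (j : Γ(conormal σ, V)), bev l le_top (F.φ.app V t) j =
      alev j le_rfl ((Limits.cokernel.π σ).app V t) := fun V t j => by
    rw [← bev_biPull, hl, hp]
  have hg : ∀ V (m : Γ(tangentSheaf f, V)), ∃ a : Γ(dual (conormal σ), V), ∀ W (hW : W ≤ V) j,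
      lev a hW j = bev l le_top (resM _ hW m) j := fun V m =>
    exists_lev _ (fun W hW j j' => bev_add_right _ _ _ _ _)
      (fun W hW c j => bev_smul_right _ _ _ _ _)
      (fun hW' hW j => by rw [resO_bev, resM_resM])
  choose g hg using hg
  refine ⟨homOfApp g (fun V m n => lev_ext fun W hW j => ?_) (fun V a m => lev_ext fun W hW j => ?_)
    (fun hV m => lev_ext fun W hW j => ?_), fun V t W hW j => ?_⟩
  · rw [lev_add, hg, hg, hg, map_add, bev_add_left]
  · rw [lev_smul, hg, hg, resM_smul, bev_smul_left]
  · rw [lev_res, hg, hg, resM_resM]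
  · rw [homOfApp_app, hg, resM_app, hl']

end Extension

end Foliated

end

/-! ### Assembly of the theorem. -/

open Foliated
theorem mainTheorem2 (X : Scheme.{0}) (f : X ⟶ Spec (.of ℂ)) [IsIntegral X]
    [SmoothOfRelativeDimension 3 f] (hX : IsProjective f)
    (F : Distribution f 1) (hF : F.IsGeneric)
    (L : X.Modules) (hL : IsInvertible L) (σ : L ⟶ F.T)
    (hY : topologicalKrullDim ((zeroScheme σ).support : Set X) ≤ 1)
    (G : Distribution f 2) (hG : G.IsInducedBy F σ) :
    (zeroScheme σ = sing1 G.sing ∧ sing0 G.sing = ∅) ∧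
    (Subsingleton (cohomology
        (tensor (tensor (dual L) (det (formSheaf f 1) 3)) (tensor (det F.T 2) (det F.T 2))) 1) →
      ∃ H : Distribution f 1, G.IsIntersection F H ∧
        Nonempty (det H.N 1 ≅ det (Limits.cokernel σ) 1)) := by
  have h1 := sing1_sing hF hL hG
  refine ⟨⟨?_, sing0_eq_empty h1⟩, ?_⟩
  · rw [h1, zeroScheme_eq_formIdeal hF hL, sing_eq_formIdeal hL hG]
  · intro hH1
    -- Up to the isomorphism of `L` with the tangent sheaf of `G`, the composite of `σ` with the
    -- inclusion of `F.T` is the inclusion of that tangent sheaf, a monomorphism.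
    have : Mono σ := by
      obtain ⟨ε, hε⟩ := hG
      have := G.exact.mono_f
      have h2 : (ε.inv ≫ G.φ) = σ ≫ F.φ := by rw [hε, ε.inv_hom_id_assoc]
      have : Mono G.φ := this
      have : Mono (σ ≫ F.φ) := h2 ▸ inferInstance
      exact mono_of_mono σ F.φ
    have hm := exists_gmodel hF hL hG
    have := epi_restrictBi hm
    obtain ⟨i⟩ := nonempty_vanishing_iso hm
    obtain ⟨θ, hθ⟩ := exists_isExtension (subsingleton_cohomology_of_iso i 1 hH1)
    -- Locally the form `h` of the model is replaced by the one-form of `θ`, which has the same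
    -- cross product with `w`.
    have hmod : HasModels θ := fun x => by
      obtain ⟨U, e, w, s₀, h, v, hx, hU⟩ := hm x
      obtain ⟨h', j, hj⟩ := hU.exists_hmodel hθ
      exact ⟨U, e, w, s₀, h', v, j, hx, hj⟩
    obtain ⟨H, hH⟩ := exists_distribution hmod
    have : Epi H.π := H.exact.epi_g
    exact ⟨H, isIntersection H hmod hθ hG hH, nonempty_det_iso hmod H.π hH⟩
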